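/- Let $n\ge 1$, and let $A_0$ be the $2n\times 2n$ block diagonal matrix with diagonal blocks $\begin{pmatrix}0&-(2k-1)\\2k-1&0\end{pmatrix}$, $k=1,\dots,n$. For a real $2n\times 2n$ matrix $A$, a vector $b\in\mathbb R^{2n}\setminus\{0\}$ and a real $\varepsilon$ consider the discontinuous piecewise linear system $$\dot x=A_0x+\varepsilon\bigl(Ax+\psi(x_1)b\bigr),\qquad \psi(s)=\begin{cases}-1,&s<0,\\ 1,&s>0,\end{cases}\tag{1}$$ with solutions in the sense of Filippov. A limit cycle is a (non-constant) periodic orbit that is the only periodic orbit in some neighbourhood of itself. Put $r_0=r$, $\theta_0=0$ and introduce polar variables $x_{2j-1}=r_{j-1}\cos((2j-1)\theta+\theta_{j-1})$, $x_{2j}=r_{j-1}\sin((2j-1)\theta+\theta_{j-1})$, $j=1,\dots,n$, with $z=(r,\theta_1,r_1,\dots,\theta_{n-1},r_{n-1})$ in the domain $D$ where all $r_j>0$. With $\theta$ as new time, (1) becomes $dz/d\theta=\varepsilon H(\theta,z)+O(\varepsilon^2)$. Let $h(z)=\int_0^{2\pi}H(\theta,z)\,d\theta$ be the averaged function. Say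 that the conditions of the averaging theory of first order hold on a bounded open set $C\subset D$ if every zero $a\in C$ of $h$ has an open neighbourhood $U\subset C$ such that $h\ne0$ on $\overline U\setminus\{a\}$ and the Brouwer degree $d_B(h,U,0)$ is not zero. Say that limit cycles $\gamma_\varepsilon$ of (1) bifurcate from $C$ as $\varepsilon\to0$ if they are parametrized by periodic solutions $x_\varepsilon$ of (1) that tend, locally uniformly in time and together with their periods $T_\varepsilon$, to a periodic solution $x_0$ of $\dot x=A_0x$ and a period $T_0>0$ of it, where the orbit of $x_0$ meets the section $\theta=0$ in a point with polar variables in $C$. (a) If the conditions of the averaging theory of first order hold on $C$, then for $|\varepsilon|>0$ sufficiently small at most one limit cycle of (1) bifurcates from $C$: if two families $\gamma_\varepsilon,\gamma'_\varepsilon$ of limit cycles of (1), given for $\varepsilon\ne0$ tending to $0$ (from both sides, from one side or along a sequence), bifurcate from $C$, then $\gamma_\varepsilon=\gamma'_\varepsilon$ as soon as $|\varepsilon|$ is small enough. (b) For every $n\ge1$ there are $A$, $b\neq0$ and $C$ for which the conditions hold on $C$ and for which, for all $\varepsilon\ne0$ with $|\varepsilon|$ sufficiently small, (1) has a limit cycle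 $\gamma_\varepsilon$ such that this family bifurcates from $C$, with $T_0=2\pi$. -/

import Mathlib

open Set Filter Topology MeasureTheory

namespace ControlCenter

noncomputable section

/-- The phase space `ℝ²ⁿ`.  The coordinates are grouped in `n` planes: for `k = 1, …, n` the index
`(0, k - 1)` stands for `x_{2k-1}` and `(1, k - 1)` for `x_{2k}`.  In particular `x (0, 0)` is
`x₁`.  (All that is used of the norm is its topology, which does not depend on the norm.) -/
abbrev Phase (n : ℕ) : Type := Fin 2 × Fin n → ℝ

/-- Real `2n × 2n` matrices, indexed as `Phase n`. -/
abbrev SqMatrix (n : ℕ) : Type := Matrix (Fin 2 × Fin n) (Fin 2 × Fin n) ℝ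

/-- The matrix `A₀`, block diagonal with the blocks `(0, -(2k-1); 2k-1, 0)`, `k = 1, …, n`. -/
def A₀ (n : ℕ) : SqMatrix n :=
  Matrix.blockDiagonal fun k : Fin n => !![0, -(2 * (k : ℝ) + 1); 2 * (k : ℝ) + 1, 0]

/-- The values of the sign function in Filippov's sense: `{-1}` on the negative reals, `{1}` on the
positive reals, and the segment `[-1, 1]` at the discontinuity. -/
def signSet (s : ℝ) : Set ℝ :=
  {u | (s < 0 → u = -1) ∧ (0 < s → u = 1) ∧ (s = 0 → u ∈ Icc (-1) 1)}

/-! ### Solutions, periodic orbits, limit cycles -/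

/-- `x : ℝ → ℝ²ⁿ` is a solution, in the sense of Filippov, of the discontinuous system
`ẋ = A₀ x + ε (A x + ψ(x₁) b)`, `ψ` the sign function: it is locally absolutely continuous and
satisfies the differential inclusion at almost every time. -/
structure IsSolution {n : ℕ} [NeZero n] (A : SqMatrix n) (b : Phase n) (ε : ℝ)
    (x : ℝ → Phase n) : Prop where
  absolutelyContinuous : ∀ s t : ℝ, AbsolutelyContinuousOnInterval x s t
  inclusion : ∀ᵐ t : ℝ, ∃ u ∈ signSet (x t (0, 0)),
    HasDerivAt x ((A₀ n).mulVec (x t) + ε • (A.mulVec (x t) + u • b)) t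

/-- `x` is a non-constant periodic solution and `T > 0` is a period of it. -/
structure IsPeriodicSolution {n : ℕ} [NeZero n] (A : SqMatrix n) (b : Phase n) (ε T : ℝ)
    (x : ℝ → Phase n) : Prop where
  isSolution : IsSolution A b ε x
  period_pos : 0 < T
  periodic : Function.Periodic x T
  nonconstant : ∃ s t : ℝ, x s ≠ x t

/-- `Γ` is a periodic orbit: the set of points of a non-constant periodic solution. -/
def IsPeriodicOrbit {n : ℕ} [NeZero n] (A : SqMatrix n) (b : Phase n) (ε : ℝ)
    (Γ : Set (Phase n)) : Prop :=
  ∃ (T : ℝ) (x : ℝ → Phase n), IsPeriodicSolution A b ε T x ∧ range x = Γ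

/-- `Γ` is a limit cycle: a periodic orbit that is isolated among all periodic orbits, that is,
the only periodic orbit in some neighbourhood of itself. -/
def IsLimitCycle {n : ℕ} [NeZero n] (A : SqMatrix n) (b : Phase n) (ε : ℝ)
    (Γ : Set (Phase n)) : Prop :=
  IsPeriodicOrbit A b ε Γ ∧
    ∃ O : Set (Phase n), IsOpen O ∧ Γ ⊆ O ∧
      ∀ Γ' : Set (Phase n), IsPeriodicOrbit A b ε Γ' → Γ' ⊆ O → Γ' = Γ

/-! ### Polar coordinates and the averaged function -/

/-- The space `ℝ²ⁿ⁻¹` of the variables `(r, θ₁, r₁, …, θₙ₋₁, rₙ₋₁)`: the first component holds the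
radii `r = r₀, r₁, …, rₙ₋₁`, the second one the angles `θ₁, …, θₙ₋₁`. -/
abbrev Polar (n : ℕ) [NeZero n] : Type := (Fin n → ℝ) × ({j : Fin n // j ≠ 0} → ℝ)

/-- The domain of the polar variables: all radii are positive. -/
def polarDomain (n : ℕ) [NeZero n] : Set (Polar n) := {z | ∀ j, 0 < z.1 j}

/-- The angle in the plane of index `j`: it is `θ` for `j = 0` and `(2j + 1) θ + θⱼ` for
`j = 1, …, n - 1`. -/
def angle {n : ℕ} [NeZero n] (θ : ℝ) (z : Polar n) (j : Fin n) : ℝ :=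
  (2 * (j : ℝ) + 1) * θ + if h : j = 0 then 0 else z.2 ⟨j, h⟩

/-- The change of variables `(θ, r, θ₁, r₁, …) ↦ x`. -/
def polarMap {n : ℕ} [NeZero n] (θ : ℝ) (z : Polar n) : Phase n := fun p =>
  z.1 p.2 * if p.1 = 0 then Real.cos (angle θ z p.2) else Real.sin (angle θ z p.2)

/-- The perturbation `A x + ψ(x₁) b` at the point with polar variables `(θ, z)`. -/
def perturbation {n : ℕ} [NeZero n] (A : SqMatrix n) (b : Phase n) (θ : ℝ) (z : Polar n) :
    Phase n :=
  A.mulVec (polarMap θ z) + Real.sign (polarMap θ z (0, 0)) • b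

/-- The radial component of the perturbation in the plane of index `j`. -/
def radialPart {n : ℕ} [NeZero n] (A : SqMatrix n) (b : Phase n) (θ : ℝ) (z : Polar n)
    (j : Fin n) : ℝ :=
  perturbation A b θ z (0, j) * Real.cos (angle θ z j) +
    perturbation A b θ z (1, j) * Real.sin (angle θ z j)

/-- The angular velocity that the perturbation induces in the plane of index `j`. -/
def angularPart {n : ℕ} [NeZero n] (A : SqMatrix n) (b : Phase n) (θ : ℝ) (z : Polar n)
    (j : Fin n) : ℝ :=
  (perturbation A b θ z (1, j) * Real.cos (angle θ z j) -
    perturbation A b θ z (0, j) * Real.sin (angle θ z j)) / z.1 j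

/-- The first-order part `H` of the system in polar variables with `θ` as the new time: the system
reads `dz/dθ = ε H(θ, z) + O(ε²)`, with `θ̇ = 1 + ε * angularPart 0`, `ṙⱼ = ε * radialPart j` and
`θⱼ` the angle in the plane of index `j` minus `(2j + 1) θ`. -/
def firstOrder {n : ℕ} [NeZero n] (A : SqMatrix n) (b : Phase n) (θ : ℝ) (z : Polar n) :
    Polar n :=
  (fun j => radialPart A b θ z j,
   fun j => angularPart A b θ z j - (2 * ((j : Fin n) : ℝ) + 1) * angularPart A b θ z 0)

/-- The averaged function `h(z) = ∫₀^{2π} H(θ, z) dθ`. -/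
def averaged {n : ℕ} [NeZero n] (A : SqMatrix n) (b : Phase n) (z : Polar n) : Polar n :=
  (fun j => ∫ θ in (0 : ℝ)..(2 * Real.pi), (firstOrder A b θ z).1 j,
   fun j => ∫ θ in (0 : ℝ)..(2 * Real.pi), (firstOrder A b θ z).2 j)

/-! ### The hypotheses of the averaging theory -/

/-- `d` is the Brouwer degree `d_B(f, U, y)`: `U` is a bounded open set, `f` is continuous on its
closure, `y` is not attained on the boundary, and `d` is the number of solutions in `U` of
`g z = y`, counted with the signs of the Jacobian determinants, for a map `g` that is `C¹` in `U`,
continuous on the closure, has `y` as a regular value and is so close to `f` that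
`sup |g - f| < dist (y, f (∂U))`.  (By classical theorems such a `g` exists and `d` does not
depend on it.) -/
def HasBrouwerDegree {E : Type*} [NormedAddCommGroup E] [NormedSpace ℝ E]
    (f : E → E) (U : Set E) (y : E) (d : ℤ) : Prop :=
  IsOpen U ∧ Bornology.IsBounded U ∧ ContinuousOn f (closure U) ∧ (∀ w ∈ frontier U, f w ≠ y) ∧
  ∃ g : E → E, ContDiffOn ℝ 1 g U ∧ ContinuousOn g (closure U) ∧
    (∀ z ∈ closure U, ∀ w ∈ frontier U, ‖g z - f z‖ < ‖f w - y‖) ∧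
    (∀ z ∈ U, g z = y → (fderiv ℝ g z).det ≠ 0) ∧
    d = ∑ᶠ z ∈ {z | z ∈ U ∧ g z = y}, ((SignType.sign (fderiv ℝ g z).det : SignType) : ℤ)

/-- The conditions for applying the first-order averaging theory on the set `C` of polar variables:
`C` is bounded and open, its radii are positive, and every zero `a` of the averaged function in `C`
has a neighbourhood `U` in `C` whose closure contains no other zero and on which the Brouwer degree
is not zero.  (The other two conditions of that theory, that the system in polar variables is
locally Lipschitz on either side of the discontinuity and that the discontinuity is reached only at
crossing points, need not be assumed: the discontinuity is `cos θ = 0` and the new time is `θ`.) -/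
structure AveragingConditions {n : ℕ} [NeZero n] (A : SqMatrix n) (b : Phase n)
    (C : Set (Polar n)) : Prop where
  isOpen : IsOpen C
  isBounded : Bornology.IsBounded C
  subset_domain : C ⊆ polarDomain n
  zeros : ∀ a ∈ C, averaged A b a = 0 →
    ∃ U : Set (Polar n), IsOpen U ∧ a ∈ U ∧ U ⊆ C ∧
      (∀ z ∈ closure U, z ≠ a → averaged A b z ≠ 0) ∧
      ∃ d : ℤ, d ≠ 0 ∧ HasBrouwerDegree (averaged A b) U 0 d

/-! ### Bifurcation -/

/-- Along the filter `l` (in use: a filter of non-zero `ε` that tend to `0`), the limit cycles `Γ ε`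
of the perturbed systems bifurcate from a periodic orbit of the linear center `ẋ = A₀ x` that
passes through the point of the section `θ = 0` with some polar variables `a ∈ C`: every `Γ ε` is a
limit cycle, parametrized by a periodic solution that tends to a periodic solution `x₀` of the
system for `ε = 0`, and the period tends to the period `T₀` of `x₀`. -/
def BifurcatesFrom {n : ℕ} [NeZero n] (A : SqMatrix n) (b : Phase n) (l : Filter ℝ)
    (C : Set (Polar n)) (T₀ : ℝ) (Γ : ℝ → Set (Phase n)) : Prop :=
  ∃ (x₀ : ℝ → Phase n) (x : ℝ → ℝ → Phase n) (T : ℝ → ℝ),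
    IsPeriodicSolution A b 0 T₀ x₀ ∧ (∃ a ∈ C, polarMap 0 a ∈ range x₀) ∧
    (∀ᶠ ε in l, IsLimitCycle A b ε (Γ ε) ∧ IsPeriodicSolution A b ε (T ε) (x ε) ∧
      range (x ε) = Γ ε) ∧
    TendstoLocallyUniformly x x₀ l ∧ Tendsto T l (𝓝 T₀)

end

end ControlCenter

open ControlCenter

/-! The system is odd and all frequencies 2k-1 are odd, so the linear flow satisfies `rot n π = -1`.
Following the flow from one crossing of x₁ = 0 to the next and then reflecting by x ↦ -x is
therefore the identity for ε = 0 and time π. With a constant extra coordinate r = 1 the affine flow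
on x₁ > 0 becomes linear, an exponential exp(t(N + εM)). The half-return is thus a smooth family of
linear operators, and variation of constants gives its strict derivative at (0, π): A₀ in time, the
half-period average of the perturbation in ε (`hasStrictFDerivAt_halfMap`).

(a) A bifurcating periodic solution tends to one of the linear center that crosses x₁ = 0
transversally, so it is encoded by a closed chain of 2M crossing points and flight times
(`exists_crossingData`). Summing the first-order expansion over the chain shows that the limit ξ₀
satisfies h(ξ₀) + σ A₀ ξ₀ = 0, with h the half-period average and σ the first-order change of the
flight time (`CrossingData.halfAverage_eq`); such a point is a zero of the averaged function
(`averaged_eq_zero`). The linear part of h commutes with A₀, whose frequencies are distinct, so the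
equation splits into scalar equations (c_j + iσ(2j+1)) w_j + d_j = 0, one for each plane. If Re c_0
= 0, or if c_j + iσ(2j+1) = 0 for some j ≠ 0, a curve of zeros through the given one can be written
down; isolation excludes this (`nondegenerate_of_isolated`). Non-degeneracy makes the equilibrium on
the section unique, so two families have the same limit, and it makes the linearization L injective
up to time shifts. The difference Δ of two chains satisfies 2Mε LΔ + μ A₀ξ₀ = o(ε‖Δ‖), whence Δ = 0
(`CrossingData.eventually_eq`). All estimates are along an arbitrary filter of non-zero ε tending to
0.

(b) The example consists of damped oscillators, all forced by the sign of x₁ and with a common half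
period P = π/√(1-ε²). On crossing points the half-return is affine with multipliers exp(-ε(2j+1)P) ≠
1, hence has exactly one fixed point, and every periodic orbit in the open region where x₁ = 0 can
only be crossed passes through it (`eq_cycle_of_isPeriodicOrbit`). As ε → 0 the fixed point tends to
the section point with all radii 1 and all phases 0, a simple zero of the averaged function. -/

namespace ControlCenter

/-! ### Affine differential equations satisfied almost everywhere -/

section LinearODE

variable {E : Type*} [NormedAddCommGroup E] [NormedSpace ℝ E]

lemma lipschitzWith_affine (M : E →L[ℝ] E) (c : E) : LipschitzWith ‖M‖₊ fun v => M v + c := by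
  refine LipschitzWith.of_dist_le_mul fun v w => ?_
  rw [dist_add_right]
  exact M.lipschitz.dist_le_mul v w

lemma affineODE_unique {M : E →L[ℝ] E} {c : E} {f g : ℝ → E} {t₀ : ℝ}
    (hf : ∀ t, HasDerivAt f (M (f t) + c) t) (hg : ∀ t, HasDerivAt g (M (g t) + c) t)
    (h : f t₀ = g t₀) : f = g :=
  ODE_solution_unique_univ (v := fun _ v => M v + c) (s := fun _ => univ)
    (fun _ => (lipschitzWith_affine M c).lipschitzOnWith)
    (fun t => ⟨hf t, mem_univ _⟩) (fun t => ⟨hg t, mem_univ _⟩) h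

variable [CompleteSpace E]

/-- An absolutely continuous function that satisfies an affine differential equation almost
everywhere on an interval satisfies it everywhere. -/
lemma eqOn_of_ae_affineODE {M : E →L[ℝ] E} {c : E} {x y : ℝ → E} {s t : ℝ} (hst : s ≤ t)
    (hx : Continuous x) (hac : AbsolutelyContinuousOnInterval x s t)
    (hd : ∀ᵐ τ : ℝ, τ ∈ Ioo s t → HasDerivAt x (M (x τ) + c) τ)
    (hy : ∀ τ, HasDerivAt y (M (y τ) + c) τ) (h0 : x s = y s) :
    EqOn x y (Icc s t) := by
  set v : ℝ → E := fun τ => M (x τ) + c with hv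
  have hvc : Continuous v := by fun_prop
  set X : ℝ → E := fun τ => ∫ r in s..τ, v r with hX
  have hXd : ∀ τ, HasDerivAt X (v τ) τ := fun τ => hvc.integral_hasStrictDerivAt s τ |>.hasDerivAt
  have hXc : ContDiff ℝ 1 X := by
    rw [contDiff_one_iff_deriv]
    refine ⟨fun τ => (hXd τ).differentiableAt, ?_⟩
    rwa [show deriv X = v from funext fun τ => (hXd τ).deriv]
  -- The difference `x - X` is absolutely continuous with derivative zero almost everywhere, hence
  -- constant. So `x` has the prescribed right derivative at every point of the interval and
  -- classical uniqueness applies.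
  obtain ⟨C, hC⟩ := (hac.sub (hXc.contDiffOn.absolutelyContinuousOnInterval)).const_of_ae_hasDerivAt_zero
    (by
      filter_upwards [hd, Measure.ae_ne volume s, Measure.ae_ne volume t] with τ h1 h2 h3 h4
      rw [uIcc_of_le hst] at h4
      have := (h1 ⟨lt_of_le_of_ne h4.1 (Ne.symm h2), lt_of_le_of_ne h4.2 h3⟩).sub (hXd τ)
      simpa [hv] using this)
  have hC' : ∀ τ ∈ Icc s t, x τ = C + X τ := fun τ hτ => by
    have := hC τ (by rwa [uIcc_of_le hst])
    simp only [Pi.sub_apply] at this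
    rw [← this]; abel
  refine ODE_solution_unique (v := fun _ v => M v + c) (fun _ => lipschitzWith_affine M c)
    hx.continuousOn (fun τ hτ => ?_)
    (fun τ _ => (hy τ).continuousAt.continuousWithinAt)
    (fun τ hτ => (hy τ).hasDerivWithinAt) h0
  have h1 : HasDerivWithinAt (fun r => C + X r) (v τ) (Icc τ t) τ :=
    ((hXd τ).const_add C).hasDerivWithinAt
  have h2 : HasDerivWithinAt x (v τ) (Icc τ t) τ :=
    h1.congr (fun r hr => hC' r ⟨hτ.1.trans hr.1, hr.2⟩) (hC' τ ⟨hτ.1, hτ.2.le⟩)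
  exact (h2.mono_of_mem_nhdsWithin (Icc_mem_nhdsGE hτ.2))

end LinearODE

/-! ### The flow of the linear center -/

noncomputable section

open NormedSpace

variable {n : ℕ}

/-- A square matrix as a continuous linear map of the phase space. -/
def lin (A : SqMatrix n) : Phase n →L[ℝ] Phase n := LinearMap.toContinuousLinearMap A.mulVecLin

@[simp] lemma lin_apply (A : SqMatrix n) (x : Phase n) : lin A x = A.mulVec x := rfl

/-- The coordinates in the plane of index `j` as a complex number. -/
def blk (j : Fin n) : Phase n →L[ℝ] ℂ :=
  Complex.ofRealCLM.comp (ContinuousLinearMap.proj (0, j)) +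
    Complex.I • Complex.ofRealCLM.comp (ContinuousLinearMap.proj (1, j))

lemma blk_apply (j : Fin n) (x : Phase n) : blk j x = x (0, j) + Complex.I * x (1, j) := rfl

@[simp] lemma blk_re (j : Fin n) (x : Phase n) : (blk j x).re = x (0, j) := by simp [blk_apply]

@[simp] lemma blk_im (j : Fin n) (x : Phase n) : (blk j x).im = x (1, j) := by simp [blk_apply]

lemma phase_ext {x y : Phase n} (h : ∀ j, blk j x = blk j y) : x = y := by
  ext ⟨i, j⟩
  fin_cases i
  · simpa using congrArg Complex.re (h j)
  · simpa using congrArg Complex.im (h j)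

/-- The frequency `2j + 1` of the plane of index `j`. -/
def freq (j : Fin n) : ℝ := 2 * (j : ℝ) + 1

lemma freq_pos (j : Fin n) : 0 < freq j := by unfold freq; positivity

lemma A₀_mulVec_zero (x : Phase n) (j : Fin n) :
    (A₀ n).mulVec x (0, j) = -freq j * x (1, j) := by
  simp only [Matrix.mulVec, dotProduct, A₀, Matrix.blockDiagonal_apply, Fintype.sum_prod_type]
  simp [freq]

lemma A₀_mulVec_one (x : Phase n) (j : Fin n) :
    (A₀ n).mulVec x (1, j) = freq j * x (0, j) := by
  simp only [Matrix.mulVec, dotProduct, A₀, Matrix.blockDiagonal_apply, Fintype.sum_prod_type]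
  simp [freq]

lemma blk_A₀ (j : Fin n) (x : Phase n) :
    blk j ((A₀ n).mulVec x) = freq j * Complex.I * blk j x := by
  apply Complex.ext <;> simp [A₀_mulVec_zero, A₀_mulVec_one]

/-- The flow of the linear center. -/
def rot (n : ℕ) (t : ℝ) : Phase n →L[ℝ] Phase n := exp (t • lin (A₀ n))

lemma hasDerivAt_rot (t : ℝ) : HasDerivAt (rot n) (lin (A₀ n) * rot n t) t :=
  hasDerivAt_exp_smul_const' (lin (A₀ n)) t

@[fun_prop]
lemma continuous_rot : Continuous (rot n) :=
  continuous_iff_continuousAt.2 fun t => (hasDerivAt_rot t).continuousAt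

lemma hasDerivAt_rot_apply (x : Phase n) (t : ℝ) :
    HasDerivAt (fun s => rot n s x) ((A₀ n).mulVec (rot n t x)) t := by
  simpa using (hasDerivAt_rot t).clm_apply (hasDerivAt_const t x)

@[simp] lemma rot_zero : rot n 0 = 1 := by simp [rot]

lemma blk_rot (j : Fin n) (t : ℝ) (x : Phase n) :
    blk j (rot n t x) = Complex.exp (freq j * t * Complex.I) * blk j x := by
  have h1 : ∀ t : ℝ, HasDerivAt (fun t => blk j (rot n t x))
      (freq j * Complex.I * blk j (rot n t x)) t := fun t => by
    rw [← blk_A₀]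
    exact (blk j).hasFDerivAt.comp_hasDerivAt t (hasDerivAt_rot_apply x t)
  have h2 : ∀ t : ℝ, HasDerivAt (fun t : ℝ => Complex.exp (freq j * t * Complex.I) * blk j x)
      (freq j * Complex.I * (Complex.exp (freq j * t * Complex.I) * blk j x)) t := fun t => by
    have h3 : HasDerivAt (fun t : ℝ => (freq j * t * Complex.I : ℂ)) (freq j * Complex.I) t := by
      simpa using (((hasDerivAt_id t).ofReal_comp.const_mul (freq j : ℂ)).mul_const Complex.I)
    exact (h3.cexp.mul_const (blk j x)).congr_deriv (by ring)
  have h4 := affineODE_unique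
    (M := ((ContinuousLinearMap.mul ℝ ℂ) (freq j * Complex.I : ℂ))) (c := 0) (t₀ := 0)
    (f := fun t => blk j (rot n t x))
    (g := fun t : ℝ => Complex.exp (freq j * t * Complex.I) * blk j x)
    (fun t => by simpa using h1 t) (fun t => by simpa using h2 t) (by simp)
  exact congrFun h4 t

lemma rot_add (s t : ℝ) (x : Phase n) : rot n (s + t) x = rot n s (rot n t x) := by
  refine phase_ext fun j => ?_
  simp only [blk_rot, ← mul_assoc, ← Complex.exp_add]
  push_cast
  ring_nf

/-- Each frequency 2j+1 is odd, so half a turn of the slowest plane multiplies every plane by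
exp((2j+1)πi) = -1. Together with the oddness of the perturbation this reduces full turns to half
turns. -/
lemma rot_pi (x : Phase n) : rot n Real.pi x = -x := by
  refine phase_ext fun j => ?_
  rw [blk_rot, map_neg]
  have : (freq j * Real.pi * Complex.I : ℂ) = Real.pi * Complex.I + (j : ℕ) * (2 * Real.pi * Complex.I) := by
    simp only [freq]; push_cast; ring
  rw [this, Complex.exp_add, Complex.exp_nat_mul_two_pi_mul_I, Complex.exp_pi_mul_I]
  ring

lemma rot_add_pi (t : ℝ) (x : Phase n) : rot n (t + Real.pi) x = -rot n t x := by
  rw [rot_add, rot_pi, map_neg]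

lemma rot_A₀ (t : ℝ) (x : Phase n) :
    rot n t ((A₀ n).mulVec x) = (A₀ n).mulVec (rot n t x) := by
  refine phase_ext fun j => ?_
  rw [blk_rot, blk_A₀, blk_A₀, blk_rot]
  ring

lemma rot_apply_zero (t : ℝ) (x : Phase n) (j : Fin n) :
    rot n t x (0, j) = Real.cos (freq j * t) * x (0, j) - Real.sin (freq j * t) * x (1, j) := by
  rw [← blk_re j (rot n t x), blk_rot, ← Complex.ofReal_mul, Complex.mul_re, Complex.exp_ofReal_mul_I_re,
    Complex.exp_ofReal_mul_I_im]
  simp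

lemma rot_apply_one (t : ℝ) (x : Phase n) (j : Fin n) :
    rot n t x (1, j) = Real.cos (freq j * t) * x (1, j) + Real.sin (freq j * t) * x (0, j) := by
  rw [← blk_im j (rot n t x), blk_rot, ← Complex.ofReal_mul, Complex.mul_im, Complex.exp_ofReal_mul_I_re,
    Complex.exp_ofReal_mul_I_im]
  simp

end

end ControlCenter

/-! ### Variation of constants and the half-return map -/

namespace ControlCenter

section Duhamel

open NormedSpace

variable {E : Type*} [NormedAddCommGroup E] [NormedSpace ℝ E] [CompleteSpace E]

lemma continuous_exp_clm : Continuous (exp : (E →L[ℝ] E) → E →L[ℝ] E) :=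
  continuous_iff_continuousAt.2 fun M => (exp_analytic (𝕂 := ℝ) M).continuousAt

lemma hasDerivAt_exp_smul_apply (M : E →L[ℝ] E) (v : E) (t : ℝ) :
    HasDerivAt (fun s : ℝ => exp (s • M) v) (M (exp (t • M) v)) t := by
  simpa using (hasDerivAt_exp_smul_const' M t).clm_apply (hasDerivAt_const t v)

/-- Variation of constants for the exponential of a sum. -/
lemma exp_add_smul_sub (N M : E →L[ℝ] E) (ε T : ℝ) (v : E) :
    exp (T • (N + ε • M)) v - exp (T • N) v =
      ε • ∫ s in (0 : ℝ)..T, exp ((T - s) • N) (M (exp (s • (N + ε • M)) v)) := by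
  have hd : ∀ s : ℝ, HasDerivAt (fun s : ℝ => exp ((T - s) • N) (exp (s • (N + ε • M)) v))
      (ε • exp ((T - s) • N) (M (exp (s • (N + ε • M)) v))) s := fun s => by
    have h1 : HasDerivAt (fun s : ℝ => exp ((T - s) • N)) (-(exp ((T - s) • N) * N)) s := by
      have := (hasDerivAt_exp_smul_const N (T - s)).scomp s ((hasDerivAt_id s).const_sub T)
      simpa [Function.comp_def] using this
    have := h1.clm_apply (hasDerivAt_exp_smul_apply (N + ε • M) v s)
    refine this.congr_deriv ?_
    simp
  have hc : Continuous fun s : ℝ => exp ((T - s) • N) (M (exp (s • (N + ε • M)) v)) := by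
    have h1 : Continuous fun s : ℝ => exp ((T - s) • N) := continuous_exp_clm.comp (by fun_prop)
    have h2 : Continuous fun s : ℝ => exp (s • (N + ε • M)) :=
      continuous_exp_clm.comp (by fun_prop)
    fun_prop
  rw [← intervalIntegral.integral_smul, intervalIntegral.integral_eq_sub_of_hasDerivAt
    (fun s _ => hd s) ((hc.const_smul ε).intervalIntegrable _ _)]
  simp

/-- Smoothness of the exponential gives joint strict differentiability in (ε, t). Strictness is what
later allows two families with different flight times to be compared. -/
lemma hasStrictFDerivAt_exp_perturbed (N M : E →L[ℝ] E) (T : ℝ) :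
    ∃ D : ℝ × ℝ →L[ℝ] (E →L[ℝ] E),
      HasStrictFDerivAt (fun q : ℝ × ℝ => exp (q.2 • (N + q.1 • M))) D (0, T) ∧
      D (0, 1) = N * exp (T • N) ∧
      ∀ v, D (1, 0) v = ∫ s in (0 : ℝ)..T, exp ((T - s) • N) (M (exp (s • N) v)) := by
  obtain ⟨D, hs⟩ : ∃ D : ℝ × ℝ →L[ℝ] (E →L[ℝ] E),
      HasStrictFDerivAt (fun q : ℝ × ℝ => exp (q.2 • (N + q.1 • M))) D (0, T) := by
    have h1 : ContDiff ℝ 1 fun q : ℝ × ℝ => q.2 • (N + q.1 • M) :=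
      contDiff_snd.smul (contDiff_const.add (contDiff_fst.smul contDiff_const))
    have h2 : ContDiff ℝ 1 (exp : (E →L[ℝ] E) → E →L[ℝ] E) :=
      contDiff_iff_contDiffAt.2 fun L => (exp_analytic (𝕂 := ℝ) L).contDiffAt
    exact ⟨_, (h2.comp h1).contDiffAt.hasStrictFDerivAt one_ne_zero⟩
  refine ⟨D, hs, ?_, fun v => ?_⟩
  · have h1 : HasDerivAt (fun t : ℝ => ((0 : ℝ), t)) (0, 1) T :=
      (hasDerivAt_const T _).prodMk (hasDerivAt_id T)
    have h2 := hs.hasFDerivAt.comp_hasDerivAt T h1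
    have h3 := hasDerivAt_exp_smul_const' N T
    refine h2.unique ?_
    simpa [Function.comp_def] using h3
  · have h1 : HasDerivAt (fun t : ℝ => (t, T)) (1, 0) 0 :=
      (hasDerivAt_id _).prodMk (hasDerivAt_const _ T)
    have h2 : HasDerivAt (fun ε : ℝ => exp (T • (N + ε • M))) (D (1, 0)) 0 :=
      HasFDerivAt.comp_hasDerivAt_of_eq (0 : ℝ)
        (l := fun q : ℝ × ℝ => exp (q.2 • (N + q.1 • M))) (f := fun t : ℝ => (t, T))
        hs.hasFDerivAt h1 rfl
    have h3 : HasDerivAt (fun ε : ℝ => exp (T • (N + ε • M)) v) (D (1, 0) v) 0 :=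
      (ContinuousLinearMap.apply ℝ E v).hasFDerivAt.comp_hasDerivAt 0 h2
    refine h3.unique ?_
    -- By variation of constants the difference quotient in ε is exactly `J ε`, so the derivative at
    -- 0 follows from the continuity of `J`.
    set J : ℝ → E := fun ε => ∫ s in (0 : ℝ)..T,
      exp ((T - s) • N) (M (exp (s • (N + ε • M)) v)) with hJ
    have hJc : Continuous J := by
      apply intervalIntegral.continuous_parametric_intervalIntegral_of_continuous'
      have h1 : Continuous fun p : ℝ × ℝ => exp ((T - p.2) • N) :=
        continuous_exp_clm.comp (by fun_prop)
      have h2 : Continuous fun p : ℝ × ℝ => exp (p.2 • (N + p.1 • M)) :=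
        continuous_exp_clm.comp (by fun_prop)
      simp only [Function.uncurry_def]
      fun_prop
    have hJ0 : (∫ s in (0 : ℝ)..T, exp ((T - s) • N) (M (exp (s • N) v))) = J 0 := by
      simp [hJ]
    rw [hJ0, hasDerivAt_iff_tendsto_slope]
    refine ((hJc.tendsto 0).mono_left nhdsWithin_le_nhds).congr' ?_
    filter_upwards [self_mem_nhdsWithin] with ε hε
    have h3 := exp_add_smul_sub N M ε T v
    rw [slope_def_module]
    simp only [sub_zero, zero_smul, add_zero]
    rw [h3, inv_smul_smul₀ hε]

end Duhamel

noncomputable section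

open NormedSpace

variable {n : ℕ} 

/-- The generator of the linear center on the extended phase space `ℝ²ⁿ × ℝ`. -/
def freeGen (n : ℕ) : (Phase n × ℝ) →L[ℝ] (Phase n × ℝ) :=
  ((lin (A₀ n)).comp (ContinuousLinearMap.fst ℝ _ _)).prod 0

/-- The perturbation `(x, r) ↦ (A x + r b, 0)` on the extended phase space. -/
def pertGen (A : SqMatrix n) (b : Phase n) : (Phase n × ℝ) →L[ℝ] (Phase n × ℝ) :=
  ((lin A).comp (ContinuousLinearMap.fst ℝ _ _) +
    (ContinuousLinearMap.snd ℝ (Phase n) ℝ).smulRight b).prod 0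

@[simp] lemma freeGen_apply (v : Phase n × ℝ) : freeGen n v = ((A₀ n).mulVec v.1, 0) := rfl

@[simp] lemma pertGen_apply (A : SqMatrix n) (b : Phase n) (v : Phase n × ℝ) :
    pertGen A b v = (A.mulVec v.1 + v.2 • b, 0) := rfl

/-- The flow of `ẋ = A₀ x + ε (A x + r b)`, `ṙ = 0` at time `q.2` for the parameter `q.1`. -/
def flowMap (A : SqMatrix n) (b : Phase n) (q : ℝ × ℝ) : (Phase n × ℝ) →L[ℝ] (Phase n × ℝ) :=
  exp (q.2 • (freeGen n + q.1 • pertGen A b))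

/-- The solution of `ẋ = A₀ x + ε (A x + b)` that starts at `ξ`. -/
def flow (A : SqMatrix n) (b : Phase n) (ε : ℝ) (ξ : Phase n) (t : ℝ) : Phase n :=
  (flowMap A b (ε, t) (ξ, 1)).1

lemma hasDerivAt_flowMap (A : SqMatrix n) (b : Phase n) (ε t : ℝ) (v : Phase n × ℝ) :
    HasDerivAt (fun t => flowMap A b (ε, t) v)
      ((freeGen n + ε • pertGen A b) (flowMap A b (ε, t) v)) t :=
  hasDerivAt_exp_smul_apply (freeGen n + ε • pertGen A b) v t

@[simp] lemma flowMap_zero (A : SqMatrix n) (b : Phase n) (ε : ℝ) : flowMap A b (ε, 0) = 1 := by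
  simp [flowMap]

lemma flowMap_snd (A : SqMatrix n) (b : Phase n) (ε t : ℝ) (v : Phase n × ℝ) :
    (flowMap A b (ε, t) v).2 = v.2 := by
  have h : ∀ t, HasDerivAt (fun t => (flowMap A b (ε, t) v).2) 0 t := fun t => by
    exact ((ContinuousLinearMap.snd ℝ (Phase n) ℝ).hasFDerivAt.comp_hasDerivAt t
      (hasDerivAt_flowMap A b ε t v)).congr_deriv (by simp)
  have := is_const_of_deriv_eq_zero (fun t => (h t).differentiableAt) (fun t => (h t).deriv) t 0
  simpa using this

lemma flowMap_apply_one (A : SqMatrix n) (b : Phase n) (ε t : ℝ) (ξ : Phase n) :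
    flowMap A b (ε, t) (ξ, 1) = (flow A b ε ξ t, 1) :=
  Prod.ext rfl (flowMap_snd A b ε t (ξ, 1))

/-- The linear part of the vector field `A₀ x + ε (A x + b)`. -/
def field (A : SqMatrix n) (ε : ℝ) : Phase n →L[ℝ] Phase n := lin (A₀ n) + ε • lin A

lemma field_apply (A : SqMatrix n) (b : Phase n) (ε : ℝ) (x : Phase n) :
    field A ε x + ε • b = (A₀ n).mulVec x + ε • (A.mulVec x + b) := by
  simp [field, smul_add, add_assoc]

lemma hasDerivAt_flow (A : SqMatrix n) (b : Phase n) (ε : ℝ) (ξ : Phase n) (t : ℝ) :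
    HasDerivAt (flow A b ε ξ) (field A ε (flow A b ε ξ t) + ε • b) t := by
  have := (ContinuousLinearMap.fst ℝ (Phase n) ℝ).hasFDerivAt.comp_hasDerivAt t
    (hasDerivAt_flowMap A b ε t (ξ, 1))
  rw [flowMap_apply_one] at this
  refine this.congr_deriv ?_
  rw [field_apply]
  simp

@[simp] lemma flow_zero (A : SqMatrix n) (b : Phase n) (ε : ℝ) (ξ : Phase n) :
    flow A b ε ξ 0 = ξ := by simp [flow]

@[fun_prop]
lemma continuous_flow (A : SqMatrix n) (b : Phase n) (ε : ℝ) (ξ : Phase n) :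
    Continuous (flow A b ε ξ) :=
  continuous_iff_continuousAt.2 fun t => (hasDerivAt_flow A b ε ξ t).continuousAt

lemma eq_flow {A : SqMatrix n} {b : Phase n} {ε : ℝ} {y : ℝ → Phase n}
    (hy : ∀ t, HasDerivAt y (field A ε (y t) + ε • b) t) : y = flow A b ε (y 0) :=
  affineODE_unique hy (hasDerivAt_flow A b ε (y 0)) (t₀ := 0) (by simp)

lemma flowMap_zero_left (A : SqMatrix n) (b : Phase n) (t : ℝ) (v : Phase n × ℝ) :
    flowMap A b (0, t) v = (rot n t v.1, v.2) := by
  have h := affineODE_unique (M := freeGen n) (c := 0) (t₀ := 0)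
    (f := fun t => flowMap A b (0, t) v) (g := fun t => (rot n t v.1, v.2))
    (fun t => by simpa using hasDerivAt_flowMap A b 0 t v)
    (fun t => by simpa using (hasDerivAt_rot_apply v.1 t).prodMk (hasDerivAt_const t v.2))
    (by simp)
  exact congrFun h t

lemma exp_freeGen (t : ℝ) (v : Phase n × ℝ) :
    exp (t • freeGen n) v = (rot n t v.1, v.2) := by
  rw [← flowMap_zero_left 0 0 t v]
  simp [flowMap]

/-- The map `(x, r) ↦ (-x, r)`. -/
def reflect (n : ℕ) : (Phase n × ℝ) →L[ℝ] (Phase n × ℝ) :=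
  (-ContinuousLinearMap.fst ℝ _ _).prod (ContinuousLinearMap.snd ℝ _ _)

@[simp] lemma reflect_apply (v : Phase n × ℝ) : reflect n v = (-v.1, v.2) := rfl

/-- The map from one crossing to the next one, up to the symmetry `x ↦ -x`. -/
def halfMap (A : SqMatrix n) (b : Phase n) (q : ℝ × ℝ) : (Phase n × ℝ) →L[ℝ] (Phase n × ℝ) :=
  reflect n * flowMap A b q

/-- The average over half a period of the perturbation in the rotating frame, along a solution of
the linear center that starts on the discontinuity. -/
def halfAverage (A : SqMatrix n) (b : Phase n) (v : Phase n × ℝ) : Phase n :=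
  ∫ s in (0 : ℝ)..Real.pi, rot n (-s) (A.mulVec (rot n s v.1) + v.2 • b)

/-- The sign of the reflection cancels the sign of `rot n π`. Hence the base operator is the
identity, and the variation-of-constants integrand with π - s becomes the rotating-frame integrand
with -s. -/
lemma hasStrictFDerivAt_halfMap (A : SqMatrix n) (b : Phase n) :
    ∃ D : ℝ × ℝ →L[ℝ] ((Phase n × ℝ) →L[ℝ] (Phase n × ℝ)),
      HasStrictFDerivAt (halfMap A b) D (0, Real.pi) ∧ halfMap A b (0, Real.pi) = 1 ∧
      D (0, 1) = freeGen n ∧ ∀ v, D (1, 0) v = (halfAverage A b v, 0) := by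
  obtain ⟨D, hD, hD1, hD2⟩ := hasStrictFDerivAt_exp_perturbed (freeGen n) (pertGen A b) Real.pi
  refine ⟨_, hD.const_mul (reflect n), ?_, ?_, ?_⟩
  · ext v <;> simp [halfMap, flowMap_zero_left, rot_pi]
  · ext v <;> simp [hD1, exp_freeGen, rot_pi, ← Matrix.mulVec_neg]
  · intro v
    have hc : Continuous fun s : ℝ => rot n (Real.pi - s) (A.mulVec (rot n s v.1) + v.2 • b) := by
      have : Continuous fun s : ℝ => lin A (rot n s v.1) := by fun_prop
      simp only [lin_apply] at this
      fun_prop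
    have h1 : ∀ s : ℝ, exp ((Real.pi - s) • freeGen n) (pertGen A b (exp (s • freeGen n) v))
      = ((rot n (Real.pi - s) (A.mulVec (rot n s v.1) + v.2 • b)), (0 : ℝ)) := fun s => by
      rw [exp_freeGen, exp_freeGen]; simp
    have h2 : D (1, 0) v = (∫ s in (0 : ℝ)..Real.pi,
        rot n (Real.pi - s) (A.mulVec (rot n s v.1) + v.2 • b), 0) := by
      rw [hD2]
      simp_rw [h1]
      have := ContinuousLinearMap.intervalIntegral_comp_comm (μ := volume)
        (ContinuousLinearMap.inl ℝ (Phase n) ℝ) (hc.intervalIntegrable 0 Real.pi)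
      simpa using this
    change reflect n (D (1, 0) v) = _
    rw [h2, reflect_apply]
    refine Prod.ext ?_ rfl
    simp only [halfAverage]
    rw [← intervalIntegral.integral_neg]
    refine intervalIntegral.integral_congr fun s _ => ?_
    rw [show Real.pi - s = -s + Real.pi by ring, rot_add_pi, neg_neg]

end

end ControlCenter

/-! ### Filippov solutions and transversal crossings -/

namespace ControlCenter

section AbsolutelyContinuous

lemma AbsolutelyContinuousOnInterval.comp_lipschitz {X Y : Type*} [SeminormedAddCommGroup X]
    [SeminormedAddCommGroup Y] {f : ℝ → X} {g : X → Y} {s t : ℝ}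
    (hf : AbsolutelyContinuousOnInterval f s t) (hg : ∀ v w, dist (g v) (g w) ≤ dist v w) :
    AbsolutelyContinuousOnInterval (fun τ => g (f τ)) s t := by
  rw [absolutelyContinuousOnInterval_iff] at hf ⊢
  intro ε hε
  obtain ⟨δ, hδ, h⟩ := hf ε hε
  exact ⟨δ, hδ, fun E hE hEδ => (Finset.sum_le_sum fun i _ => hg _ _).trans_lt (h E hE hEδ)⟩

lemma AbsolutelyContinuousOnInterval.comp_add_const {X : Type*} [SeminormedAddCommGroup X]
    {f : ℝ → X} {s t : ℝ} (c : ℝ) (hf : AbsolutelyContinuousOnInterval f (s + c) (t + c)) :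
    AbsolutelyContinuousOnInterval (fun τ => f (τ + c)) s t := by
  rw [absolutelyContinuousOnInterval_iff] at hf ⊢
  intro ε hε
  obtain ⟨δ, hδ, h⟩ := hf ε hε
  refine ⟨δ, hδ, fun E hE hEδ => ?_⟩
  have hu : ∀ a b r : ℝ, r ∈ uIcc a b → r + c ∈ uIcc (a + c) (b + c) := fun a b r hr => by
    rw [mem_uIcc] at hr ⊢
    rcases hr with hr | hr
    · left; constructor <;> linarith
    · right; constructor <;> linarith
  refine h (E.1, fun i => ((E.2 i).1 + c, (E.2 i).2 + c)) ⟨fun i hi => ?_, ?_⟩ (by simpa using hEδ)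
  · exact ⟨hu _ _ _ (hE.1 i hi).1, hu _ _ _ (hE.1 i hi).2⟩
  · intro i hi j hj hij
    refine Set.disjoint_left.2 fun r hr hr' => ?_
    have hd : Disjoint (uIoc (E.2 i).1 (E.2 i).2) (uIoc (E.2 j).1 (E.2 j).2) := hE.2 hi hj hij
    refine absurd (Set.disjoint_left.1 hd (?_ : r - c ∈ _)) (not_not.2 ?_)
    · simp only [mem_uIoc] at hr ⊢
      rcases hr with hr | hr
      · left; constructor <;> linarith
      · right; constructor <;> linarith
    · simp only [mem_uIoc] at hr' ⊢
      rcases hr' with hr | hr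
      · left; constructor <;> linarith
      · right; constructor <;> linarith

/-- Mean value inequality for absolutely continuous functions. -/
lemma AbsolutelyContinuousOnInterval.le_sub_of_le_deriv {f : ℝ → ℝ} {s t c : ℝ} (hst : s ≤ t)
    (hf : AbsolutelyContinuousOnInterval f s t)
    (h : ∀ᵐ τ : ℝ, τ ∈ Ioo s t → c ≤ deriv f τ) : c * (t - s) ≤ f t - f s := by
  rw [← hf.integral_deriv_eq_sub]
  have h1 : ∫ _ in s..t, c = c * (t - s) := by simp [mul_comm]
  rw [← h1]
  refine intervalIntegral.integral_mono_ae_restrict hst (by simp) hf.intervalIntegrable_deriv ?_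
  rw [EventuallyLE, ae_restrict_iff' measurableSet_Icc]
  filter_upwards [h, Measure.ae_ne volume s, Measure.ae_ne volume t] with τ h1 h2 h3 h4
  exact h1 ⟨lt_of_le_of_ne h4.1 (Ne.symm h2), lt_of_le_of_ne h4.2 h3⟩

end AbsolutelyContinuous

noncomputable section

variable {n : ℕ} [NeZero n] {A : SqMatrix n} {b : Phase n} {ε : ℝ} {x : ℝ → Phase n}

namespace IsSolution

lemma continuous (hx : IsSolution A b ε x) : Continuous x := by
  refine continuous_iff_continuousAt.2 fun t => ?_
  refine ((hx.absolutelyContinuous (t - 1) (t + 1)).continuousOn).continuousAt ?_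
  rw [uIcc_of_le (by linarith)]
  exact Icc_mem_nhds (by linarith) (by linarith)

/-- The values of the sign function in Filippov's sense form an odd multifunction, so a pair (x, u)
is turned into (-x, -u). -/
lemma neg (hx : IsSolution A b ε x) : IsSolution A b ε fun t => -x t where
  absolutelyContinuous s t := (hx.absolutelyContinuous s t).neg
  inclusion := by
    filter_upwards [hx.inclusion] with t ⟨u, hu, hd⟩
    refine ⟨-u, ⟨fun h => ?_, fun h => ?_, fun h => ?_⟩, ?_⟩
    · simp only [Pi.neg_apply] at h
      rw [hu.2.1 (by linarith)]
    · simp only [Pi.neg_apply] at h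
      rw [hu.1 (by linarith), neg_neg]
    · simp only [Pi.neg_apply] at h
      have := hu.2.2 (by linarith)
      constructor <;> linarith [this.1, this.2]
    · refine hd.neg.congr_deriv ?_
      simp only [Matrix.mulVec_neg, neg_smul, neg_add, smul_add, smul_neg]

lemma comp_add_const (hx : IsSolution A b ε x) (c : ℝ) : IsSolution A b ε fun t => x (t + c) where
  absolutelyContinuous s t :=
    AbsolutelyContinuousOnInterval.comp_add_const c (hx.absolutelyContinuous _ _)
  inclusion := by
    have := (measurePreserving_add_right volume c).quasiMeasurePreserving.ae hx.inclusion
    filter_upwards [this] with t ⟨u, hu, hd⟩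
    exact ⟨u, hu, hd.comp_add_const t c⟩

lemma coord (hx : IsSolution A b ε x) (p : Fin 2 × Fin n) (s t : ℝ) :
    AbsolutelyContinuousOnInterval (fun τ => x τ p) s t :=
  AbsolutelyContinuousOnInterval.comp_lipschitz (g := fun v : Phase n => v p)
    (hx.absolutelyContinuous s t) fun v w => dist_le_pi_dist v w p

/-- On a time interval on which `x₁ > 0` a solution follows the affine flow. -/
lemma eq_flow (hx : IsSolution A b ε x) {s t : ℝ} (h : ∀ τ ∈ Ioo s t, 0 < x τ (0, 0)) :
    ∀ τ ∈ Icc s t, x τ = flow A b ε (x s) (τ - s) := by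
  intro τ hτ
  refine eqOn_of_ae_affineODE (M := field A ε) (c := ε • b) (hτ.1.trans hτ.2) hx.continuous
    (hx.absolutelyContinuous s t) ?_ (y := fun τ => flow A b ε (x s) (τ - s))
    (fun r => ?_) (by simp) hτ
  · filter_upwards [hx.inclusion] with r ⟨u, hu, hd⟩ hr
    rw [field_apply]
    rwa [hu.2.1 (h r hr), one_smul] at hd
  · simpa using (hasDerivAt_flow A b ε (x s) (r - s)).comp_sub_const r s

/-- For `ε = 0` the solutions are those of the linear center. -/
lemma eq_rot (hx : IsSolution A b 0 x) (s t : ℝ) : x t = rot n (t - s) (x s) := by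
  have key : ∀ s t, s ≤ t → x t = rot n (t - s) (x s) := fun s t hst => by
    refine eqOn_of_ae_affineODE (M := lin (A₀ n)) (c := 0) hst hx.continuous
      (hx.absolutelyContinuous s t) ?_ (y := fun τ => rot n (τ - s) (x s))
      (fun r => ?_) (by simp) ⟨hst, le_rfl⟩
    · filter_upwards [hx.inclusion] with r ⟨u, hu, hd⟩ hr
      simpa using hd
    · simpa using (hasDerivAt_rot_apply (x s) (r - s)).comp_sub_const r s
  rcases le_total s t with h | h
  · exact key s t h
  · rw [key t s h, ← rot_add]; simp

/-- A lower bound for the increase of `x₁`. -/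
lemma le_sub_coord (hx : IsSolution A b ε x) {s t c : ℝ} (hst : s ≤ t)
    (h : ∀ τ ∈ Ioo s t, c + |ε| * (|A.mulVec (x τ) (0, 0)| + |b (0, 0)|) ≤ -x τ (1, 0)) :
    c * (t - s) ≤ x t (0, 0) - x s (0, 0) := by
  refine AbsolutelyContinuousOnInterval.le_sub_of_le_deriv (f := fun τ => x τ (0, 0)) hst
    (hx.coord (0, 0) s t) ?_
  filter_upwards [hx.inclusion] with r ⟨u, hu, hd⟩ hr
  have h1 := (hasDerivAt_pi.1 hd (0, 0)).deriv
  rw [h1]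
  have hu1 : |u| ≤ 1 := by
    rcases lt_trichotomy (x r (0, 0)) 0 with h | h | h
    · rw [hu.1 h]; simp
    · exact abs_le.2 (hu.2.2 h)
    · rw [hu.2.1 h]; simp
  have h2 : |ε * (A.mulVec (x r) (0, 0) + u * b (0, 0))| ≤
      |ε| * (|A.mulVec (x r) (0, 0)| + |b (0, 0)|) := by
    rw [abs_mul]
    gcongr
    refine (abs_add_le _ _).trans ?_
    rw [abs_mul]
    gcongr
    exact mul_le_of_le_one_left (abs_nonneg _) hu1
  have h3 := h r hr
  simp only [Pi.add_apply, Pi.smul_apply, smul_eq_mul, A₀_mulVec_zero, freq]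
  have h4 := neg_abs_le (ε * (A.mulVec (x r) (0, 0) + u * b (0, 0)))
  simp only [Fin.val_zero]
  push_cast
  linarith

end IsSolution

/-- On `[-1, π - 1]` the solution `x` passes once through the discontinuity `x₁ = 0`, at time `T`
and with `x₁` increasing. -/
structure IsCrossing (x : ℝ → Phase n) (T : ℝ) : Prop where
  mem : T ∈ Ioo (-1 : ℝ) 1
  zero : x T (0, 0) = 0
  neg : ∀ t ∈ Ico (-1) T, x t (0, 0) < 0
  pos : ∀ t ∈ Ioc T (Real.pi - 1), 0 < x t (0, 0)

/-- The window [-1, π-1] has length π, so the windows of successive half turns abut; this bound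
keeps the crossing interval (-1, 1) away from its right end. -/
lemma pi_sub_one_gt : 2 < Real.pi - 1 := by linarith [Real.pi_gt_three]

lemma IsCrossing.unique {T t : ℝ} (h : IsCrossing x T) (ht : t ∈ Icc (-1 : ℝ) 1)
    (h0 : x t (0, 0) = 0) : t = T := by
  rcases lt_trichotomy t T with h1 | h1 | h1
  · exact absurd h0 (h.neg t ⟨ht.1, h1⟩).ne
  · exact h1
  · exact absurd h0 (h.pos t ⟨h1, by linarith [ht.2, pi_sub_one_gt]⟩).ne'

/-- Between two crossings the solution follows the affine flow. -/
lemma IsCrossing.eq_flow (hx : IsSolution A b ε x) {T T' : ℝ} (h : IsCrossing x T)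
    (h' : IsCrossing (fun t => -x (t + Real.pi)) T') :
    ∀ t ∈ Icc T (T' + Real.pi), x t = flow A b ε (x T) (t - T) := by
  refine hx.eq_flow fun t ht => ?_
  rcases le_or_gt t (Real.pi - 1) with h1 | h1
  · exact h.pos t ⟨ht.1, h1⟩
  · have := h'.neg (t - Real.pi) ⟨by linarith, by linarith [ht.2]⟩
    simpa using this

/-- Solutions that tend to a solution of the linear center starting transversally on the
discontinuity cross the discontinuity near time `0`. -/
lemma exists_crossing {l : Filter ℝ} (hl : l ≤ 𝓝 0) {x : ℝ → ℝ → Phase n} {ξ : Phase n}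
    (hx : ∀ᶠ ε in l, IsSolution A b ε (x ε))
    (hlim : TendstoLocallyUniformly x (fun t => rot n t ξ) l) (h0 : ξ (0, 0) = 0)
    (h1 : ξ (1, 0) < 0) :
    ∃ T : ℝ → ℝ, Tendsto T l (𝓝 0) ∧ ∀ᶠ ε in l, IsCrossing (x ε) (T ε) := by
  have hz : ∀ t, rot n t ξ (0, 0) = -ξ (1, 0) * Real.sin t := fun t => by
    rw [rot_apply_zero, h0]; simp [freq]; ring
  have ho : ∀ t, rot n t ξ (1, 0) = ξ (1, 0) * Real.cos t := fun t => by
    rw [rot_apply_one, h0]; simp [freq]; ring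
  have hunif : ∀ δ > 0, ∀ᶠ ε in l, ∀ t ∈ Icc (-1) (Real.pi - 1), dist (rot n t ξ) (x ε t) < δ :=
    fun δ hδ => Metric.tendstoUniformlyOn_iff.1
      ((tendstoLocallyUniformlyOn_iff_tendstoUniformlyOn_of_compact isCompact_Icc).1
        hlim.tendstoLocallyUniformlyOn) δ hδ
  have hpi := pi_sub_one_gt
  -- Since 1 < π/3, the limit has speed of x₁ greater than s/2 on all of [-1, 1].
  have hcos : (1 / 2 : ℝ) < Real.cos 1 := by
    have := Real.cos_lt_cos_of_nonneg_of_le_pi (x := 1) (y := Real.pi / 3) (by norm_num)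
      (by linarith [Real.pi_pos]) (by linarith [Real.pi_gt_three])
    rwa [Real.cos_pi_div_three] at this
  have hcos' : ∀ t ∈ Icc (-1 : ℝ) 1, 1 / 2 < Real.cos t := fun t ht => by
    rw [← Real.cos_abs]
    exact hcos.trans_le (Real.cos_le_cos_of_nonneg_of_le_pi (abs_nonneg t)
      (by linarith) (abs_le.2 ht))
  have hsin : 0 < Real.sin 1 := Real.sin_pos_of_pos_of_lt_pi one_pos (by linarith)
  have hsin' : ∀ t ∈ Icc 1 (Real.pi - 1), Real.sin 1 ≤ Real.sin t := fun t ht => by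
    rw [← Real.cos_pi_div_two_sub 1, ← Real.cos_pi_div_two_sub t, ← Real.cos_abs (_ - t)]
    refine Real.cos_le_cos_of_nonneg_of_le_pi (abs_nonneg _) (by linarith) (abs_le.2 ?_)
    constructor <;> linarith [ht.1, ht.2]
  set s := -ξ (1, 0) with hs
  have hspos : 0 < s := by linarith
  -- the coordinate `x₁` increases strictly on `[-1, 1]`
  have hvel : ∀ᶠ ε in l, ∀ t ∈ Icc (-1 : ℝ) 1,
      s / 8 + |ε| * (|A.mulVec (x ε t) (0, 0)| + |b (0, 0)|) ≤ -x ε t (1, 0) := by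
    obtain ⟨K, hK⟩ := (isCompact_Icc (a := (-1 : ℝ)) (b := Real.pi - 1)).exists_bound_of_continuousOn
      (f := fun t => rot n t ξ) (by fun_prop)
    set B := ‖lin A‖ * (K + 1) + |b (0, 0)| with hB
    have hεB : ∀ᶠ ε in l, |ε| * B < s / 8 := by
      have : Tendsto (fun ε : ℝ => |ε| * B) (𝓝 0) (𝓝 (|0| * B)) :=
        (continuous_abs.mul continuous_const).tendsto 0
      rw [abs_zero, zero_mul] at this
      exact (this.mono_left hl).eventually_lt_const (by linarith)
    -- Budget: -x₂ exceeds s/2 - s/4 = s/4; half of this is kept as speed and the other s/8 absorbs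
    -- the perturbation.
    filter_upwards [hunif (s / 4) (by linarith), hunif 1 one_pos, hεB] with ε h2 h3 h4 t ht
    have ht' : t ∈ Icc (-1) (Real.pi - 1) := ⟨ht.1, by linarith [ht.2]⟩
    have h5 : |A.mulVec (x ε t) (0, 0)| ≤ ‖lin A‖ * (K + 1) := by
      refine (norm_le_pi_norm (lin A (x ε t)) (0, 0)).trans ((lin A).le_of_opNorm_le_of_le le_rfl ?_)
      have := norm_sub_norm_le (x ε t) (rot n t ξ)
      have h6 := h3 t ht'
      rw [dist_comm, dist_eq_norm] at h6
      linarith [hK t ht']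
    have h6 : |ε| * (|A.mulVec (x ε t) (0, 0)| + |b (0, 0)|) ≤ |ε| * B := by
      rw [hB]; gcongr
    have h7 : |rot n t ξ (1, 0) - x ε t (1, 0)| < s / 4 :=
      (dist_le_pi_dist (rot n t ξ) (x ε t) (1, 0)).trans_lt (h2 t ht')
    rw [ho] at h7
    have h8 := abs_lt.1 h7
    have h9 := mul_lt_mul_of_pos_left (hcos' t ht) hspos
    have h10 : ξ (1, 0) * Real.cos t = -(s * Real.cos t) := by rw [hs]; ring
    linarith [h8.1, h8.2]
  have hmono : ∀ᶠ ε in l, ∀ t ∈ Icc (-1 : ℝ) 1, ∀ r ∈ Icc (-1 : ℝ) 1, t < r →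
      x ε t (0, 0) < x ε r (0, 0) := by
    filter_upwards [hvel, hx] with ε h2 h3 t ht r hr htr
    have := h3.le_sub_coord htr.le (c := s / 8)
      fun τ hτ => h2 τ ⟨ht.1.trans hτ.1.le, hτ.2.le.trans hr.2⟩
    have h4 : 0 < s / 8 * (r - t) := by
      have := sub_pos.2 htr
      positivity
    linarith
  have hpt : ∀ t ∈ Icc (-1) (Real.pi - 1), ∀ δ > 0, ∀ᶠ ε in l,
      |s * Real.sin t - x ε t (0, 0)| < δ := fun t ht δ hδ => by
    filter_upwards [hunif δ hδ] with ε h2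
    rw [← hz]
    exact (dist_le_pi_dist (rot n t ξ) (x ε t) (0, 0)).trans_lt (h2 t ht)
  -- The signs at ±δ yield a crossing when δ = 1, and for small δ they confine it to (-δ, δ).
  have hright : ∀ δ ∈ Ioc (0 : ℝ) 1, ∀ᶠ ε in l, x ε (-δ) (0, 0) < 0 ∧ 0 < x ε δ (0, 0) := by
    intro δ hδ
    have hsδ : 0 < s * Real.sin δ :=
      mul_pos hspos (Real.sin_pos_of_pos_of_lt_pi hδ.1 (by linarith [hδ.2]))
    filter_upwards [hpt δ ⟨by linarith [hδ.1], by linarith [hδ.2]⟩ _ hsδ,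
      hpt (-δ) ⟨by linarith [hδ.2], by linarith [hδ.1]⟩ _ hsδ] with ε h2 h3
    rw [Real.sin_neg] at h3
    have := abs_lt.1 h2
    have := abs_lt.1 h3
    constructor <;> linarith
  have hpos : ∀ᶠ ε in l, ∀ t ∈ Icc 1 (Real.pi - 1), 0 < x ε t (0, 0) := by
    have hp : 0 < s * Real.sin 1 := mul_pos hspos hsin
    filter_upwards [hunif (s * Real.sin 1) hp] with ε h2 t ht
    have ht' : t ∈ Icc (-1) (Real.pi - 1) := ⟨by linarith [ht.1], ht.2⟩
    have h3 : |rot n t ξ (0, 0) - x ε t (0, 0)| < s * Real.sin 1 :=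
      (dist_le_pi_dist (rot n t ξ) (x ε t) (0, 0)).trans_lt (h2 t ht')
    rw [hz] at h3
    have h4 := mul_le_mul_of_nonneg_left (hsin' t ht) hspos.le
    linarith [(abs_lt.1 h3).2]
  have hex : ∀ᶠ ε in l, ∃ T, IsCrossing (x ε) T := by
    filter_upwards [hmono, hright 1 ⟨one_pos, le_rfl⟩, hpos, hx] with ε h2 h3 h4 h5
    have hc : ContinuousOn (fun t => x ε t (0, 0)) (Icc (-1) 1) :=
      ((continuous_apply _).comp h5.continuous).continuousOn
    obtain ⟨T, hT, hT0⟩ := intermediate_value_Ioo (by norm_num) hc ⟨h3.1, h3.2⟩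
    refine ⟨T, hT, hT0, fun t ht => ?_, fun t ht => ?_⟩
    · have := h2 t ⟨ht.1, ht.2.le.trans hT.2.le⟩ T ⟨hT.1.le, hT.2.le⟩ ht.2
      simp only at hT0
      linarith
    · rcases le_or_gt t 1 with h6 | h6
      · have := h2 T ⟨hT.1.le, hT.2.le⟩ t ⟨hT.1.le.trans ht.1.le, h6⟩ ht.1
        simp only at hT0
        linarith
      · exact h4 t ⟨h6.le, ht.2⟩
  classical
  refine ⟨fun ε => if h : ∃ T, IsCrossing (x ε) T then h.choose else 0, ?_, ?_⟩
  · rw [Metric.tendsto_nhds]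
    intro δ hδ
    have hm : min δ 1 ∈ Ioc (0 : ℝ) 1 := ⟨lt_min hδ one_pos, min_le_right _ _⟩
    filter_upwards [hex, hright _ hm] with ε h2 h3
    rw [dif_pos h2]
    set T := h2.choose
    have hT : IsCrossing (x ε) T := h2.choose_spec
    rw [Real.dist_eq, sub_zero]
    refine (abs_lt.2 ⟨?_, ?_⟩ : |T| < min δ 1).trans_le (min_le_left _ _)
    · by_contra! h
      rcases h.eq_or_lt with h | h
      · rw [← h, hT.zero] at h3
        exact h3.1.false
      · have := hT.pos (-min δ 1) ⟨h, by linarith [hm.1]⟩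
        linarith [h3.1]
    · by_contra! h
      rcases h.eq_or_lt with h | h
      · rw [h, hT.zero] at h3
        exact h3.2.false
      · have := hT.neg (min δ 1) ⟨by linarith [hm.1], h⟩
        linarith [h3.2]
  · filter_upwards [hex] with ε h2
    rw [dif_pos h2]
    exact h2.choose_spec

end

end ControlCenter

/-! ### Asymptotic expansions along chains of crossing points -/

namespace ControlCenter

open Asymptotics

section StrictExpansion

variable {W : Type*} [NormedAddCommGroup W] [NormedSpace ℝ W] {ι : Type*} {l : Filter ι}

lemma IsLittleO.clm_apply_norm {F : ι → W →L[ℝ] W} {g : ι → ℝ} (hF : F =o[l] g) (v : ι → W) :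
    (fun i => F i (v i)) =o[l] fun i => g i * ‖v i‖ := by
  have h1 : (fun i => F i (v i)) =O[l] fun i => ‖F i‖ * ‖v i‖ :=
    IsBigO.of_bound 1 (Eventually.of_forall fun i => by
      rw [one_mul, norm_mul, norm_norm, norm_norm]; exact (F i).le_opNorm _)
  exact h1.trans_isLittleO (hF.norm_left.mul_isBigO (isBigO_refl _ _))

lemma IsLittleO.clm_apply_of_tendsto {F : ι → W →L[ℝ] W} {g : ι → ℝ} (hF : F =o[l] g)
    {v : ι → W} {v₀ : W} (hv : Tendsto v l (𝓝 v₀)) : (fun i => F i (v i)) =o[l] g := by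
  have := (IsLittleO.clm_apply_norm hF v).trans_isBigO
    ((isBigO_refl g l).mul (hv.norm.isBigO_one ℝ))
  simpa using this

lemma IsBigO.clm_apply_of_tendsto_zero {F : ι → W →L[ℝ] W} {g : ι → ℝ} (hF : F =O[l] g)
    {v : ι → W} (hv : Tendsto v l (𝓝 0)) : (fun i => F i (v i)) =o[l] g := by
  have h1 : (fun i => F i (v i)) =O[l] fun i => ‖F i‖ * ‖v i‖ :=
    IsBigO.of_bound 1 (Eventually.of_forall fun i => by
      rw [one_mul, norm_mul, norm_norm, norm_norm]; exact (F i).le_opNorm _)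
  have h2 : (fun i => ‖v i‖) =o[l] fun _ => (1 : ℝ) := by
    rw [isLittleO_one_iff]; simpa using hv.norm
  simpa using h1.trans_isLittleO (hF.norm_left.mul_isLittleO h2)

variable {Θ : ℝ × ℝ → W →L[ℝ] W} {D : ℝ × ℝ →L[ℝ] (W →L[ℝ] W)} {q₀ : ℝ × ℝ} {q q' : ι → ℝ × ℝ}
  {v : ι → W} {v₀ : W}

lemma strict_sub_isLittleO (hD : HasStrictFDerivAt Θ D q₀) (hq : Tendsto q l (𝓝 q₀))
    (hq' : Tendsto q' l (𝓝 q₀)) :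
    (fun i => Θ (q i) - Θ (q' i) - D (q i - q' i)) =o[l] fun i => ‖q i - q' i‖ :=
  (hD.isLittleO.comp_tendsto (hq.prodMk_nhds hq')).norm_right

/-- Expansion of a difference of operators, applied to a convergent family of vectors. -/
lemma strict_sub_apply_isLittleO (hD : HasStrictFDerivAt Θ D q₀) (hq : Tendsto q l (𝓝 q₀))
    (hq' : Tendsto q' l (𝓝 q₀)) (hv : Tendsto v l (𝓝 v₀)) :
    (fun i => Θ (q i) (v i) - Θ (q' i) (v i) - D (q i - q' i) v₀) =o[l]
      fun i => ‖q i - q' i‖ := by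
  have h1 := IsLittleO.clm_apply_of_tendsto (strict_sub_isLittleO hD hq hq') hv
  have h2 : (fun i => D (q i - q' i)) =O[l] fun i => ‖q i - q' i‖ :=
    (D.isBigO_comp _ l).norm_right
  have h3 := IsBigO.clm_apply_of_tendsto_zero h2 (v := fun i => v i - v₀)
    (by simpa using hv.sub_const v₀)
  refine (h1.add h3).congr_left fun i => ?_
  simp only [sub_apply, map_sub]
  abel

/-- Expansion of an operator at a point where it is the identity, with an error relative to the
size of the vector. -/
lemma strict_apply_isLittleO (hD : HasStrictFDerivAt Θ D q₀) (h1 : Θ q₀ = 1)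
    (hq : Tendsto q l (𝓝 q₀)) (v : ι → W) :
    (fun i => Θ (q i) (v i) - v i - D (q i - q₀) (v i)) =o[l] fun i => ‖q i - q₀‖ * ‖v i‖ := by
  refine (IsLittleO.clm_apply_norm (strict_sub_isLittleO hD hq tendsto_const_nhds) v).congr_left
    fun i => ?_
  simp [h1]

end StrictExpansion

noncomputable section

variable {n : ℕ} {A : SqMatrix n} {b : Phase n}

/-- The perturbation averaged over half a period, as a linear map. -/
lemma halfAverage_linear (A : SqMatrix n) (b : Phase n) :
    ∃ G : (Phase n × ℝ) →L[ℝ] Phase n, ∀ v, G v = halfAverage A b v := by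
  obtain ⟨D, -, -, -, h⟩ := hasStrictFDerivAt_halfMap A b
  exact ⟨(ContinuousLinearMap.fst ℝ _ _).comp (D (1, 0)), fun v => by simp [h]⟩

variable [NeZero n]

/-- The sequences `ξ ε 0, …, ξ ε K` of successive crossing points (up to sign) and `τ ε k` of the
times between them, for periodic solutions that tend to a solution of the linear center which
starts at `ξ₀`. -/
structure CrossingData (A : SqMatrix n) (b : Phase n) (l : Filter ℝ) (ξ₀ : Phase n) (K : ℕ)
    (ξ : ℕ → ℝ → Phase n) (τ : ℕ → ℝ → ℝ) : Prop where
  step : ∀ k < K, ∀ᶠ ε in l, (ξ (k + 1) ε, (1 : ℝ)) = halfMap A b (ε, τ k ε) (ξ k ε, 1)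
  zero : ∀ k ≤ K, ∀ᶠ ε in l, ξ k ε (0, 0) = 0
  tendsto_time : ∀ k < K, Tendsto (τ k) l (𝓝 Real.pi)
  tendsto : ∀ k ≤ K, Tendsto (ξ k) l (𝓝 ξ₀)
  periodic : ∀ᶠ ε in l, ξ K ε = ξ 0 ε

/-- Absorption argument: the remainder may contain `f` itself, but with a factor below ‖s‖/2, so
that part moves to the left-hand side. In use `f` is a change of flight time, `s` the speed of x₁ at
the crossing, and the equation is the x₁-coordinate of an expansion. -/
lemma isBigO_of_near {ι E : Type*} [NormedAddCommGroup E] {l : Filter ι} {f : ι → ℝ} {g : ι → ℝ}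
    {h : ι → ℝ} {R : ι → E} {s : ℝ} (hs : s ≠ 0) (hR : R =o[l] fun i => ‖g i‖ + ‖f i‖)
    (hh : h =O[l] g) (heq : ∀ᶠ i in l, ‖h i + f i * s‖ ≤ ‖R i‖) : f =O[l] g := by
  obtain ⟨C, hC⟩ := hh.bound
  have hs' := norm_pos_iff.2 hs
  refine IsBigO.of_bound ((C + ‖s‖ / 2) / (‖s‖ / 2)) ?_
  filter_upwards [hC, heq, hR.bound (half_pos hs')] with i h1 h2 h3
  rw [div_mul_eq_mul_div, le_div_iff₀ (by positivity)]
  have h4 : ‖f i‖ * ‖s‖ ≤ ‖h i + f i * s‖ + ‖h i‖ := by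
    rw [← norm_mul]
    calc ‖f i * s‖ = ‖(h i + f i * s) - h i‖ := by ring_nf
      _ ≤ _ := norm_sub_le _ _
  rw [Real.norm_of_nonneg (by positivity : 0 ≤ ‖g i‖ + ‖f i‖)] at h3
  nlinarith

variable {l : Filter ℝ} {ξ₀ : Phase n} {K : ℕ} {ξ η : ℕ → ℝ → Phase n} {τ τ' : ℕ → ℝ → ℝ}

/-- The speed at which the crossing times depend on the parameter. -/
def timeSlope (A : SqMatrix n) (b : Phase n) (ξ₀ : Phase n) : ℝ :=
  halfAverage A b (ξ₀, 1) (0, 0) / ξ₀ (1, 0)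

namespace CrossingData

/-- This is the strict derivative of the half-return at (0, π), applied to the convergent vectors (ξ
k ε, 1). -/
lemma expansion (h : CrossingData A b l ξ₀ K ξ τ) (hl : l ≤ 𝓝 0) {k : ℕ} (hk : k < K) :
    (fun ε => ξ (k + 1) ε - ξ k ε - (ε • halfAverage A b (ξ₀, 1) +
      (τ k ε - Real.pi) • (A₀ n).mulVec ξ₀)) =o[l] fun ε => ‖ε‖ + ‖τ k ε - Real.pi‖ := by
  obtain ⟨D, hD, h1, hD1, hD2⟩ := hasStrictFDerivAt_halfMap A b
  have hq : Tendsto (fun ε => (ε, τ k ε)) l (𝓝 (0, Real.pi)) :=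
    (tendsto_id.mono_left hl).prodMk_nhds (h.tendsto_time k hk)
  have h2 := strict_sub_apply_isLittleO hD hq tendsto_const_nhds
    ((h.tendsto k hk.le).prodMk_nhds (tendsto_const_nhds (x := (1 : ℝ))))
  have h3 := ((ContinuousLinearMap.fst ℝ (Phase n) ℝ).isBigO_comp _ l).trans_isLittleO h2
  have h4 : (fun ε : ℝ => ‖((ε, τ k ε) - (0, Real.pi) : ℝ × ℝ)‖) =O[l]
      fun ε => ‖ε‖ + ‖τ k ε - Real.pi‖ := by
    refine IsBigO.of_bound 1 (Eventually.of_forall fun ε => ?_)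
    rw [one_mul, norm_norm, Real.norm_of_nonneg (by positivity : 0 ≤ ‖ε‖ + ‖τ k ε - Real.pi‖)]
    simp [Prod.norm_def]
  refine (h3.trans_isBigO h4).congr' ?_ EventuallyEq.rfl
  filter_upwards [h.step k hk] with ε hε
  have h5 : D ((ε, τ k ε) - (0, Real.pi)) = ε • D (1, 0) + (τ k ε - Real.pi) • freeGen n := by
    rw [← hD1, ← map_smul, ← map_smul, ← map_add]; simp
  simp only [h1, ← hε, h5]
  simp [hD2]

/-- Both endpoints of a step lie on x₁ = 0, so the x₁-coordinate of the expansion can be solved for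
the time deviation; transversality makes its coefficient non-zero. -/
lemma time_isBigO (h : CrossingData A b l ξ₀ K ξ τ) (hl : l ≤ 𝓝 0) (hξ : ξ₀ (1, 0) ≠ 0) {k : ℕ}
    (hk : k < K) : (fun ε => τ k ε - Real.pi) =O[l] fun ε => ε := by
  refine isBigO_of_near (neg_ne_zero.2 hξ) (h.expansion hl hk)
    (h := fun ε => ε * halfAverage A b (ξ₀, 1) (0, 0))
    (by simpa [mul_comm] using (isBigO_refl (fun ε : ℝ => ε) l).const_mul_left _) ?_
  filter_upwards [h.zero k hk.le, h.zero (k + 1) hk] with ε h1 h2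
  refine le_trans (le_of_eq ?_) (norm_le_pi_norm _ (0, 0))
  rw [← norm_neg]
  simp [h1, h2, A₀_mulVec_zero, freq]

lemma time_expansion (h : CrossingData A b l ξ₀ K ξ τ) (hl : l ≤ 𝓝 0) (hξ : ξ₀ (1, 0) ≠ 0) {k : ℕ}
    (hk : k < K) :
    (fun ε => τ k ε - Real.pi - ε * timeSlope A b ξ₀) =o[l] fun ε => ε := by
  have h1 := (h.expansion hl hk).trans_isBigO
    ((isBigO_refl (fun ε : ℝ => ε) l).norm_left.add (h.time_isBigO hl hξ hk).norm_left)
  have h2 : (fun ε => (τ k ε - Real.pi - ε * timeSlope A b ξ₀) * ξ₀ (1, 0)) =o[l] fun ε => ε := by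
    refine IsLittleO.congr' (((ContinuousLinearMap.proj (R := ℝ) (φ := fun _ => ℝ)
      ((0, 0) : Fin 2 × Fin n)).isBigO_comp _ l).trans_isLittleO h1) ?_ EventuallyEq.rfl
    filter_upwards [h.zero k hk.le, h.zero (k + 1) hk] with ε h1 h2
    simp only [ContinuousLinearMap.proj_apply, Pi.sub_apply, Pi.add_apply, Pi.smul_apply, h1, h2,
      A₀_mulVec_zero, freq, timeSlope, smul_eq_mul, Fin.val_zero]
    field_simp
    simp
    ring
  have h3 := h2.mul_isBigO (isBigO_refl (fun _ => (ξ₀ (1, 0))⁻¹) l)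
  refine (h3.congr_left fun ε => by field_simp).trans_isBigO ?_
  simpa [mul_comm] using (isBigO_refl (fun ε : ℝ => ε) l).const_mul_left (ξ₀ (1, 0))⁻¹

/-- The limit of the crossing points of periodic solutions is an equilibrium of the averaged
equation. -/
lemma halfAverage_eq (h : CrossingData A b l ξ₀ K ξ τ) (hl : l ≤ 𝓝[≠] 0) [l.NeBot] (hK : 0 < K)
    (hξ : ξ₀ (1, 0) ≠ 0) :
    halfAverage A b (ξ₀, 1) + timeSlope A b ξ₀ • (A₀ n).mulVec ξ₀ = 0 := by
  have hl' := hl.trans nhdsWithin_le_nhds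
  set V := halfAverage A b (ξ₀, 1) + timeSlope A b ξ₀ • (A₀ n).mulVec ξ₀ with hV
  have h1 : ∀ k ∈ Finset.range K, (fun ε => ξ (k + 1) ε - ξ k ε - ε • V) =o[l] fun ε => ε := by
    intro k hk
    have hk' := Finset.mem_range.1 hk
    have h1 := (h.expansion hl' hk').trans_isBigO
      ((isBigO_refl (fun ε : ℝ => ε) l).norm_left.add (h.time_isBigO hl' hξ hk').norm_left)
    have h2 := (h.time_expansion hl' hξ hk').smul_isBigO
      (isBigO_refl (fun _ => (A₀ n).mulVec ξ₀) l)
    have h3 : (fun ε : ℝ => ε • (A₀ n).mulVec ξ₀) =O[l] fun ε => ε :=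
      IsBigO.of_bound ‖(A₀ n).mulVec ξ₀‖ (Eventually.of_forall fun ε => by
        rw [norm_smul, mul_comm])
    refine (h1.add (h2.trans_isBigO h3)).congr_left fun ε => ?_
    rw [hV]
    module
  -- The increments telescope to zero around the closed chain, leaving ε K V = o(ε). As ε ≠ 0 along
  -- the filter, V = 0.
  have h2 := IsLittleO.sum h1
  have h3 : (fun ε : ℝ => ε • ((K : ℝ) • V)) =o[l] fun ε => ε := by
    refine h2.neg_left.congr' ?_ EventuallyEq.rfl
    filter_upwards [h.periodic] with ε hε
    rw [Finset.sum_apply, Finset.sum_sub_distrib, Finset.sum_range_sub (fun k => ξ k ε), hε]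
    simp [← Nat.cast_smul_eq_nsmul ℝ, smul_smul, mul_comm]
  have h4 : (K : ℝ) • V = 0 := by
    by_contra hne
    have h5 : (fun ε : ℝ => ε) =O[l] fun ε => ε • ((K : ℝ) • V) :=
      IsBigO.of_bound ‖(K : ℝ) • V‖⁻¹ (Eventually.of_forall fun ε => by
        rw [norm_smul ε, mul_comm, mul_assoc, mul_inv_cancel₀ (norm_ne_zero_iff.2 hne), mul_one])
    have h6 := h5.trans_isLittleO h3
    have h7 : ∀ᶠ ε in l, ε ≠ 0 := hl self_mem_nhdsWithin
    exact absurd h6 (isLittleO_irrefl h7.frequently)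
  exact (smul_eq_zero.1 h4).resolve_left (by positivity)

/-- The linearization of the averaged equation. -/
def linearized (A : SqMatrix n) (b : Phase n) (ξ₀ Δ : Phase n) : Phase n :=
  halfAverage A b (Δ, 0) + timeSlope A b ξ₀ • (A₀ n).mulVec Δ

lemma linearized_isBigO (A : SqMatrix n) (b : Phase n) (ξ₀ : Phase n) (Δ : ℝ → Phase n) :
    (fun ε => linearized A b ξ₀ (Δ ε)) =O[l] Δ := by
  obtain ⟨G, hG⟩ := halfAverage_linear A b
  have h1 := (G.comp (ContinuousLinearMap.inl ℝ (Phase n) ℝ) +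
    timeSlope A b ξ₀ • lin (A₀ n)).isBigO_comp Δ l
  simpa [hG, linearized] using h1

/-- The step is split in two: the same point η flown for the times τ and τ', and the operator with
time τ applied to (ξ - η, 0), where the affine part has cancelled. The second error is relative to
‖ξ - η‖ because the base operator is the identity; finally τ - π is replaced by its first-order
value. -/
lemma diff_expansion (h : CrossingData A b l ξ₀ K ξ τ) (h' : CrossingData A b l ξ₀ K η τ')
    (hl : l ≤ 𝓝 0) (hξ : ξ₀ (1, 0) ≠ 0) {k : ℕ} (hk : k < K) :
    (fun ε => (ξ (k + 1) ε - η (k + 1) ε) - (ξ k ε - η k ε) -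
      (ε • linearized A b ξ₀ (ξ k ε - η k ε) + (τ k ε - τ' k ε) • (A₀ n).mulVec ξ₀)) =o[l]
      fun ε => ‖ε * ‖ξ k ε - η k ε‖‖ + ‖τ k ε - τ' k ε‖ := by
  obtain ⟨D, hD, h1, hD1, hD2⟩ := hasStrictFDerivAt_halfMap A b
  have hq : Tendsto (fun ε => (ε, τ k ε)) l (𝓝 (0, Real.pi)) :=
    (tendsto_id.mono_left hl).prodMk_nhds (h.tendsto_time k hk)
  have hq' : Tendsto (fun ε => (ε, τ' k ε)) l (𝓝 (0, Real.pi)) :=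
    (tendsto_id.mono_left hl).prodMk_nhds (h'.tendsto_time k hk)
  have hadd1 : (fun ε => ε * ‖ξ k ε - η k ε‖) =O[l]
      fun ε => ‖ε * ‖ξ k ε - η k ε‖‖ + ‖τ k ε - τ' k ε‖ :=
    IsBigO.of_bound 1 (Eventually.of_forall fun ε => by
      rw [one_mul, Real.norm_of_nonneg (by positivity :
        0 ≤ ‖ε * ‖ξ k ε - η k ε‖‖ + ‖τ k ε - τ' k ε‖)]
      exact le_add_of_nonneg_right (norm_nonneg _))
  have hadd2 : (fun ε => ‖τ k ε - τ' k ε‖) =O[l]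
      fun ε => ‖ε * ‖ξ k ε - η k ε‖‖ + ‖τ k ε - τ' k ε‖ :=
    IsBigO.of_bound 1 (Eventually.of_forall fun ε => by
      rw [one_mul, norm_norm, Real.norm_of_nonneg (by positivity :
        0 ≤ ‖ε * ‖ξ k ε - η k ε‖‖ + ‖τ k ε - τ' k ε‖)]
      exact le_add_of_nonneg_left (norm_nonneg _))
  have e1 := strict_sub_apply_isLittleO hD hq hq'
    ((h'.tendsto k hk.le).prodMk_nhds (tendsto_const_nhds (x := (1 : ℝ))))
  have e1' := e1.trans_isBigO ((hadd2.congr_left fun ε => by simp [Prod.norm_def]))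
  have hqO : (fun ε => ‖((ε, τ k ε) - (0, Real.pi) : ℝ × ℝ)‖) =O[l] fun ε => ε := by
    have := (isBigO_refl (fun ε : ℝ => ε) l).prod_left (h.time_isBigO hl hξ hk)
    simpa using this.norm_left
  have e2 := strict_apply_isLittleO hD h1 hq (fun ε => (ξ k ε - η k ε, (0 : ℝ)))
  have e2' := e2.trans_isBigO (hqO.mul (isBigO_refl _ l))
  have hn : ∀ w : Phase n, ‖(w, (0 : ℝ))‖ = ‖w‖ := fun w => by simp [Prod.norm_def]
  simp only [hn] at e2'
  have e3 := (h.time_expansion hl hξ hk).smul_isBigO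
    ((lin (A₀ n)).isBigO_comp (fun ε => ξ k ε - η k ε) l)
  have e3' : (fun ε => (τ k ε - Real.pi - ε * timeSlope A b ξ₀) •
      (A₀ n).mulVec (ξ k ε - η k ε)) =o[l] fun ε => ε * ‖ξ k ε - η k ε‖ := by
    have := e3.norm_right
    refine this.trans_isBigO (IsBigO.of_bound 1 (Eventually.of_forall fun ε => ?_))
    simp [norm_smul]
  have e4 := ((ContinuousLinearMap.fst ℝ (Phase n) ℝ).isBigO_comp _ l).trans_isLittleO
    (e1'.add (e2'.trans_isBigO hadd1))
  refine (e4.add (e3'.trans_isBigO hadd1)).congr' ?_ EventuallyEq.rfl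
  filter_upwards [h.step k hk, h'.step k hk] with ε hε hε'
  have h5 : D ((ε, τ k ε) - (0, Real.pi)) = ε • D (1, 0) + (τ k ε - Real.pi) • freeGen n := by
    rw [← hD1, ← map_smul, ← map_smul, ← map_add]; simp
  have h6 : D ((ε, τ k ε) - (ε, τ' k ε)) = (τ k ε - τ' k ε) • freeGen n := by
    rw [← hD1, ← map_smul]; simp
  have h7 : halfMap A b (ε, τ k ε) (ξ k ε - η k ε, 0) =
      (ξ (k + 1) ε, 1) - halfMap A b (ε, τ k ε) (η k ε, 1) := by
    rw [hε, ← map_sub]; simp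
  simp only [h5, h6, ← hε', h7]
  simp only [linearized, add_apply, smul_apply, freeGen_apply, hD2, map_add, map_sub, map_smul,
    ContinuousLinearMap.coe_fst']
  module

/-- All four crossing points lie on x₁ = 0, so absorption in the x₁-coordinate bounds the time
difference by ε times the distance of the points. -/
lemma time_diff_isBigO (h : CrossingData A b l ξ₀ K ξ τ) (h' : CrossingData A b l ξ₀ K η τ')
    (hl : l ≤ 𝓝 0) (hξ : ξ₀ (1, 0) ≠ 0) {k : ℕ} (hk : k < K) :
    (fun ε => τ k ε - τ' k ε) =O[l] fun ε => ε * ‖ξ k ε - η k ε‖ := by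
  refine isBigO_of_near (neg_ne_zero.2 hξ) (diff_expansion h h' hl hξ hk)
    (h := fun ε => ε * linearized A b ξ₀ (ξ k ε - η k ε) (0, 0)) ?_ ?_
  · refine (isBigO_refl _ l).mul ?_
    refine IsBigO.trans ?_ (linearized_isBigO A b ξ₀ fun ε => ξ k ε - η k ε).norm_right
    exact IsBigO.of_bound 1 (Eventually.of_forall fun ε => by
      rw [one_mul]; exact norm_le_pi_norm _ (0, 0))
  · filter_upwards [h.zero k hk.le, h.zero (k + 1) hk, h'.zero k hk.le, h'.zero (k + 1) hk]
      with ε h1 h2 h3 h4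
    refine le_trans (le_of_eq ?_) (norm_le_pi_norm _ (0, 0))
    rw [← norm_neg]
    simp [h1, h2, h3, h4, A₀_mulVec_zero, freq]

/-- Two families of crossing data with the same limit coincide if the averaged equation is
non-degenerate there. -/
lemma eventually_eq (h : CrossingData A b l ξ₀ K ξ τ) (h' : CrossingData A b l ξ₀ K η τ')
    (hl : l ≤ 𝓝[≠] 0) (hK : 0 < K) (hξ : ξ₀ (1, 0) ≠ 0)
    (hnd : ∀ (Δ : Phase n) (μ : ℝ), Δ (0, 0) = 0 →
      linearized A b ξ₀ Δ + μ • (A₀ n).mulVec ξ₀ = 0 → Δ = 0) :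
    ∀ᶠ ε in l, (∀ k ≤ K, ξ k ε = η k ε) ∧ ∀ k < K, τ k ε = τ' k ε := by
  have hl' := hl.trans nhdsWithin_le_nhds
  have hε0 : (fun ε : ℝ => ε) =o[l] fun _ => (1 : ℝ) := by
    rw [isLittleO_one_iff]; exact tendsto_id.mono_left hl'
  set Δ : ℕ → ℝ → Phase n := fun k ε => ξ k ε - η k ε with hΔ
  -- one step
  have hstep : ∀ k < K, (fun ε => Δ (k + 1) ε - Δ k ε - (ε • linearized A b ξ₀ (Δ k ε) +
      (τ k ε - τ' k ε) • (A₀ n).mulVec ξ₀)) =o[l] fun ε => ε * ‖Δ k ε‖ := fun k hk =>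
    (diff_expansion h h' hl' hξ hk).trans_isBigO ((isBigO_refl _ l).norm_left.add
      (time_diff_isBigO h h' hl' hξ hk).norm_left)
  have hlinO : ∀ (w : ℝ → Phase n), (fun ε => ε • linearized A b ξ₀ (w ε)) =O[l]
      fun ε => ε * ‖w ε‖ := fun w =>
    ((isBigO_refl (fun ε : ℝ => ε) l).smul (linearized_isBigO A b ξ₀ w).norm_right)
  have hstepO : ∀ k < K, (fun ε => Δ (k + 1) ε - Δ k ε) =O[l] fun ε => ε * ‖Δ k ε‖ := by
    intro k hk
    have h1 : (fun ε => (τ k ε - τ' k ε) • (A₀ n).mulVec ξ₀) =O[l] fun ε => ε * ‖Δ k ε‖ := by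
      have := (time_diff_isBigO h h' hl' hξ hk).smul
        (isBigO_const_const ((A₀ n).mulVec ξ₀) (one_ne_zero (α := ℝ)) l)
      simpa using this
    refine ((hstep k hk).isBigO.add ((hlinO (Δ k)).add h1)).congr_left fun ε => ?_
    abel
  -- Each step changes Δ only by O(ε‖Δ‖), so all the `Δ k` agree with `Δ 0` to leading order and may
  -- be replaced by it in the sum.
  have hdiff : ∀ k ≤ K, (fun ε => Δ k ε - Δ 0 ε) =O[l] fun ε => ε * ‖Δ 0 ε‖ := by
    intro k
    induction k with
    | zero => intro _; simpa using isBigO_zero _ l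
    | succ k ih =>
      intro hk
      have h1 := ih (by omega)
      have h2 : Δ k =O[l] Δ 0 := by
        have h3 : (fun ε => Δ k ε - Δ 0 ε) =O[l] Δ 0 := by
          have := (h1.trans (hε0.isBigO.mul (isBigO_refl (fun ε => ‖Δ 0 ε‖) l)))
          simpa using this
        simpa using h3.add (isBigO_refl (Δ 0) l)
      have h3 := (hstepO k (by omega)).trans ((isBigO_refl (fun ε : ℝ => ε) l).mul h2.norm_norm)
      simpa using h3.add h1
  have hO : ∀ k ≤ K, Δ k =O[l] Δ 0 := fun k hk => by
    have h3 : (fun ε => Δ k ε - Δ 0 ε) =O[l] Δ 0 := by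
      have := ((hdiff k hk).trans (hε0.isBigO.mul (isBigO_refl (fun ε => ‖Δ 0 ε‖) l)))
      simpa using this
    simpa using h3.add (isBigO_refl (Δ 0) l)
  have ho : ∀ k ≤ K, (fun ε => Δ k ε - Δ 0 ε) =o[l] Δ 0 := fun k hk => by
    have := ((hdiff k hk).trans_isLittleO (hε0.mul_isBigO (isBigO_refl (fun ε => ‖Δ 0 ε‖) l)))
    simpa using this
  obtain ⟨G, hG⟩ := halfAverage_linear A b
  set B : Phase n →L[ℝ] Phase n := G.comp (ContinuousLinearMap.inl ℝ (Phase n) ℝ) +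
    timeSlope A b ξ₀ • lin (A₀ n) with hBdef
  have hB : ∀ w, B w = linearized A b ξ₀ w := fun w => by simp [hBdef, hG, linearized]
  -- summation over one period
  have hsum : ∀ k ∈ Finset.range K, (fun ε => Δ (k + 1) ε - Δ k ε -
      (ε • B (Δ 0 ε) + (τ k ε - τ' k ε) • (A₀ n).mulVec ξ₀)) =o[l] fun ε => ε * ‖Δ 0 ε‖ := by
    intro k hk
    have hk' := Finset.mem_range.1 hk
    have h1 := (hstep k hk').trans_isBigO
      ((isBigO_refl (fun ε : ℝ => ε) l).mul (hO k hk'.le).norm_norm)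
    have h2 := (hlinO fun ε => Δ k ε - Δ 0 ε).trans_isLittleO
      ((isBigO_refl (fun ε : ℝ => ε) l).mul_isLittleO (ho k hk'.le).norm_norm)
    refine (h1.add h2).congr_left fun ε => ?_
    simp only [← hB, map_sub, smul_sub]
    abel
  have hS := IsLittleO.sum hsum
  -- Both chains are closed, so the increments of Δ telescope to zero and only the linear terms
  -- remain.
  have hS' : (fun ε => (K * ε) • B (Δ 0 ε) +
      (∑ k ∈ Finset.range K, (τ k ε - τ' k ε)) • (A₀ n).mulVec ξ₀) =o[l]
      fun ε => ε * ‖Δ 0 ε‖ := by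
    refine hS.neg_left.congr' ?_ EventuallyEq.rfl
    filter_upwards [h.periodic, h'.periodic] with ε h1 h2
    rw [Finset.sum_apply, Finset.sum_sub_distrib, Finset.sum_range_sub (fun k => Δ k ε), Finset.sum_add_distrib]
    simp [hΔ, h1, h2, ← Nat.cast_smul_eq_nsmul ℝ]
    rw [← Finset.sum_sub_distrib, Finset.sum_smul, smul_smul]
  -- non-degeneracy
  obtain ⟨c, hc, hbound⟩ : ∃ c > 0, ∀ (w : Phase n) (μ : ℝ), w (0, 0) = 0 →
      ‖w‖ ≤ c * ‖B w + μ • (A₀ n).mulVec ξ₀‖ := by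
    -- The section condition becomes an extra component of `L`; the map is then injective on a
    -- finite-dimensional space, hence bounded below.
    set L : (Phase n × ℝ) →ₗ[ℝ] (Phase n × ℝ) :=
      ((B.comp (ContinuousLinearMap.fst ℝ _ _) +
        (ContinuousLinearMap.snd ℝ (Phase n) ℝ).smulRight ((A₀ n).mulVec ξ₀)).prod
        ((ContinuousLinearMap.proj (R := ℝ) (φ := fun _ => ℝ) ((0, 0) : Fin 2 × Fin n)).comp
          (ContinuousLinearMap.fst ℝ _ _))).toLinearMap with hL
    have hLv : ∀ v, L v = (B v.1 + v.2 • (A₀ n).mulVec ξ₀, v.1 (0, 0)) := fun v => rfl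
    have hker : LinearMap.ker L = ⊥ := by
      rw [LinearMap.ker_eq_bot']
      rintro ⟨w, μ⟩ hw
      rw [hLv, Prod.mk_eq_zero] at hw
      have hw0 := hnd w μ hw.2 (by rw [← hB]; exact hw.1)
      have h1 := hw.1
      simp only [hw0, map_zero, zero_add] at h1
      rcases smul_eq_zero.1 h1 with h2 | h2
      · exact Prod.ext hw0 h2
      · have := congrFun h2 (0, 0)
        rw [A₀_mulVec_zero] at this
        exact absurd this (mul_ne_zero (neg_ne_zero.2 (freq_pos _).ne') hξ)
    obtain ⟨c, hc, hanti⟩ := L.exists_antilipschitzWith hker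
    refine ⟨c, by exact_mod_cast hc, fun w μ hw => ?_⟩
    have h1 := hanti.le_mul_dist (w, μ) 0
    rw [dist_zero_right, map_zero, dist_zero_right, hLv] at h1
    simp only [hw] at h1
    have h2 : ‖((B w + μ • (A₀ n).mulVec ξ₀, (0 : ℝ)) : Phase n × ℝ)‖ =
        ‖B w + μ • (A₀ n).mulVec ξ₀‖ := by simp [Prod.norm_def]
    rw [h2] at h1
    exact (norm_fst_le (w, μ)).trans h1
  have hKpos : (0 : ℝ) < K := by exact_mod_cast hK
  have hzero : ∀ᶠ ε in l, Δ 0 ε = 0 := by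
    -- The constant K/(2c) is chosen so that the lower bound yields ‖Δ 0‖ ≤ ‖Δ 0‖/2, which forces Δ
    -- 0 = 0.
    filter_upwards [hS'.bound (show 0 < K / (2 * c) by positivity), hl self_mem_nhdsWithin,
      h.zero 0 (Nat.zero_le _), h'.zero 0 (Nat.zero_le _)] with ε h1 hε h2 h3
    by_contra hne
    have hε' : (0 : ℝ) < ‖ε‖ := norm_pos_iff.2 hε
    have hpos := norm_pos_iff.2 hne
    have hKε : (K : ℝ) * ε ≠ 0 := mul_ne_zero hKpos.ne' hε
    set μ := ∑ k ∈ Finset.range K, (τ k ε - τ' k ε)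
    have h4 := hbound (Δ 0 ε) (((K : ℝ) * ε)⁻¹ * μ) (by simp [hΔ, h2, h3])
    have h5 : (K * ε) • B (Δ 0 ε) + μ • (A₀ n).mulVec ξ₀ =
        (K * ε) • (B (Δ 0 ε) + (((K : ℝ) * ε)⁻¹ * μ) • (A₀ n).mulVec ξ₀) := by
      rw [smul_add, smul_smul, mul_inv_cancel_left₀ hKε]
    rw [h5, norm_smul, norm_mul, norm_mul, norm_norm, Real.norm_of_nonneg hKpos.le] at h1
    set X := ‖B (Δ 0 ε) + (((K : ℝ) * ε)⁻¹ * μ) • (A₀ n).mulVec ξ₀‖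
    have h6 : X ≤ 1 / (2 * c) * ‖Δ 0 ε‖ := by
      have : (K * ‖ε‖) * X ≤ (K * ‖ε‖) * (1 / (2 * c) * ‖Δ 0 ε‖) := by
        calc _ ≤ _ := h1
          _ = _ := by ring
      exact le_of_mul_le_mul_left this (by positivity)
    have h7 : ‖Δ 0 ε‖ ≤ 1 / 2 * ‖Δ 0 ε‖ := by
      calc _ ≤ c * X := h4
        _ ≤ c * (1 / (2 * c) * ‖Δ 0 ε‖) := by gcongr
        _ = _ := by field_simp
    linarith
  have hall : ∀ᶠ ε in l, ∀ k ∈ Finset.range (K + 1), Δ k ε = 0 := by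
    rw [Filter.eventually_all_finset]
    intro k hk
    filter_upwards [hzero, (hO k (by simpa [Nat.lt_succ_iff] using hk)).eq_zero_imp] with ε h1 h2
    exact h2 h1
  have htime : ∀ᶠ ε in l, ∀ k ∈ Finset.range K, Δ k ε = 0 → τ k ε - τ' k ε = 0 := by
    rw [Filter.eventually_all_finset]
    intro k hk
    filter_upwards [(time_diff_isBigO h h' hl' hξ (Finset.mem_range.1 hk)).eq_zero_imp] with ε h1 h2
    exact h1 (by simp only [hΔ] at h2; simp [h2])
  filter_upwards [hall, htime] with ε h1 h2
  refine ⟨fun k hk => sub_eq_zero.1 (h1 k (by simpa [Nat.lt_succ_iff] using hk)), fun k hk => ?_⟩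
  exact sub_eq_zero.1 (h2 k (by simpa using hk) (h1 k (by simp; omega)))

end CrossingData

end

end ControlCenter

/-! ### Decoupling of the average and its polar form -/

namespace ControlCenter

noncomputable section

section Blocks

variable {n : ℕ}

/-- The vector whose only component is `w`, in the plane of index `k`. -/
def emb (k : Fin n) (w : ℂ) : Phase n :=
  fun p => if p.2 = k then (if p.1 = 0 then w.re else w.im) else 0

lemma blk_emb (j k : Fin n) (w : ℂ) : blk j (emb k w) = if j = k then w else 0 := by
  by_cases h : j = k
  · apply Complex.ext <;> simp [emb, h]
  · apply Complex.ext <;> simp [emb, h]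

lemma sum_emb (v : Phase n) : ∑ k, emb k (blk k v) = v := by
  refine phase_ext fun j => ?_
  rw [map_sum]
  simp [blk_emb]

lemma A₀_emb (k : Fin n) (w : ℂ) : (A₀ n).mulVec (emb k w) = emb k (freq k * Complex.I * w) := by
  refine phase_ext fun j => ?_
  rw [blk_A₀, blk_emb, blk_emb]
  split_ifs with h
  · rw [h]
  · simp

lemma freq_injective {j k : Fin n} (h : freq j = freq k) : j = k := by
  simp only [freq] at h
  exact Fin.ext (by exact_mod_cast (by linarith : (j : ℝ) = k))

/-- A linear map that commutes with the linear center acts on each plane as the multiplication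
by a complex number. -/
lemma exists_blk_eq_mul (G : Phase n →L[ℝ] Phase n)
    (hG : ∀ v, G ((A₀ n).mulVec v) = (A₀ n).mulVec (G v)) :
    ∃ c : Fin n → ℂ, ∀ v j, blk j (G v) = c j * blk j v := by
  have h1 : ∀ j k w, blk j (G (emb k (freq k * Complex.I * w))) =
      freq j * Complex.I * blk j (G (emb k w)) := fun j k w => by
    rw [← A₀_emb, hG, blk_A₀]
  have hsmul : ∀ (k : Fin n) (r : ℝ) (w : ℂ), emb k (r * w) = r • emb k w := fun k r w => by
    refine phase_ext fun j => ?_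
    rw [map_smul, blk_emb, blk_emb]
    split_ifs <;> simp
  have hadd : ∀ (k : Fin n) (w z : ℂ), emb k (w + z) = emb k w + emb k z := fun k w z => by
    refine phase_ext fun j => ?_
    rw [map_add, blk_emb, blk_emb, blk_emb]
    split_ifs <;> simp
  -- Commuting twice with A₀ compares its squares: on planes j and k these are -(2j+1)² and
  -- -(2k+1)², so the off-diagonal blocks vanish.
  have h0 : ∀ j k w, j ≠ k → blk j (G (emb k w)) = 0 := by
    intro j k w hjk
    have h2 := h1 j k (freq k * Complex.I * w)
    rw [h1 j k w, show (freq k * Complex.I * (freq k * Complex.I * w) : ℂ) =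
      ((-(freq k) ^ 2 : ℝ) : ℂ) * w by push_cast; linear_combination (freq k ^ 2 * w : ℂ) * Complex.I_sq,
      hsmul, map_smul, map_smul, Complex.real_smul] at h2
    have h3 : ((freq j ^ 2 - freq k ^ 2 : ℝ) : ℂ) * blk j (G (emb k w)) = 0 := by
      push_cast at h2 ⊢
      linear_combination h2 + (freq j ^ 2 * blk j (G (emb k w)) : ℂ) * Complex.I_sq
    refine (mul_eq_zero.1 h3).resolve_left fun h => hjk (freq_injective ?_)
    have h4 : freq j ^ 2 = freq k ^ 2 := by exact_mod_cast sub_eq_zero.1 (by exact_mod_cast h)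
    exact (pow_left_inj₀ (freq_pos j).le (freq_pos k).le two_ne_zero).1 h4
  -- On a diagonal block, commuting with A₀ means commuting with multiplication by i, so the block
  -- is complex linear.
  have hI : ∀ j w, blk j (G (emb j (Complex.I * w))) = Complex.I * blk j (G (emb j w)) := by
    intro j w
    have h2 := h1 j j w
    rw [mul_assoc, hsmul, map_smul, map_smul, Complex.real_smul, mul_assoc] at h2
    exact mul_left_cancel₀ (by exact_mod_cast (freq_pos j).ne') h2
  refine ⟨fun j => blk j (G (emb j 1)), fun v j => ?_⟩
  conv_lhs => rw [← sum_emb v, map_sum, map_sum]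
  rw [Finset.sum_eq_single j (fun k _ hk => h0 j k _ hk.symm) (by simp)]
  have h2 : blk j v = ((blk j v).re : ℂ) * 1 + ((blk j v).im : ℂ) * (Complex.I * 1) := by
    rw [mul_one, mul_one, Complex.re_add_im]
  conv_lhs => rw [h2, hadd, hsmul, hsmul, map_add, map_add, map_smul, map_smul, map_smul, map_smul,
    hI, Complex.real_smul, Complex.real_smul]
  conv_rhs => rw [h2]
  ring

/-- The commutator is the integral over [0, π] of the derivative of s ↦ rot(-s) A rot(s) v. The
endpoint values agree, since the two signs from `rot_pi` cancel. -/
lemma halfAverage_A₀ (A : SqMatrix n) (b v : Phase n) :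
    halfAverage A b ((A₀ n).mulVec v, 0) = (A₀ n).mulVec (halfAverage A b (v, 0)) := by
  have hcl : ∀ v, Continuous fun s : ℝ => rot n (-s) (A.mulVec (rot n s v)) := fun v => by
    have : Continuous fun s : ℝ => lin A (rot n s v) := by fun_prop
    simp only [lin_apply] at this
    fun_prop
  have hc : Continuous fun s : ℝ => (A₀ n).mulVec (rot n (-s) (A.mulVec (rot n s v))) :=
    (lin (A₀ n)).continuous.comp (hcl v)
  have hd : ∀ s : ℝ, HasDerivAt (fun s : ℝ => rot n (-s) (A.mulVec (rot n s v)))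
      (rot n (-s) (A.mulVec (rot n s ((A₀ n).mulVec v))) -
        (A₀ n).mulVec (rot n (-s) (A.mulVec (rot n s v)))) s := fun s => by
    have h1 : HasDerivAt (fun s : ℝ => rot n (-s)) (-(lin (A₀ n) * rot n (-s))) s := by
      simpa [Function.comp_def] using (hasDerivAt_rot (n := n) (-s)).scomp s (hasDerivAt_neg s)
    have h2 := h1.clm_apply ((lin A).hasFDerivAt.comp_hasDerivAt s (hasDerivAt_rot_apply v s))
    refine h2.congr_deriv ?_
    rw [rot_A₀]
    simp [sub_eq_neg_add]
  have h1 := intervalIntegral.integral_eq_sub_of_hasDerivAt (a := 0) (b := Real.pi)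
    (fun s _ => hd s) (((hcl _).sub hc).intervalIntegrable _ _)
  have hpi : ∀ x, rot n (-Real.pi) x = -x := fun x => by
    have := rot_add_pi (-Real.pi) x
    rw [neg_add_cancel, rot_zero] at this
    simpa using congrArg Neg.neg this.symm
  rw [intervalIntegral.integral_sub ((hcl _).intervalIntegrable _ _)
    (hc.intervalIntegrable _ _)] at h1
  simp only [rot_pi, hpi, Matrix.mulVec_neg, neg_neg, neg_zero, rot_zero,
    one_apply_eq_self, sub_self] at h1
  rw [sub_eq_zero] at h1
  simp only [halfAverage, zero_smul, add_zero]
  rw [h1]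
  exact (lin (A₀ n)).intervalIntegral_comp_comm ((hcl v).intervalIntegrable _ _)

/-- The averaged equation decouples into scalar complex equations. -/
lemma exists_blk_halfAverage (A : SqMatrix n) (b : Phase n) :
    ∃ c d : Fin n → ℂ, ∀ v r j, blk j (halfAverage A b (v, r)) = c j * blk j v + r * d j := by
  obtain ⟨G, hG⟩ := halfAverage_linear A b
  obtain ⟨c, hc⟩ := exists_blk_eq_mul (G.comp (ContinuousLinearMap.inl ℝ (Phase n) ℝ))
    (fun v => by simpa [hG] using halfAverage_A₀ A b v)
  refine ⟨c, fun j => blk j (G (0, 1)), fun v r j => ?_⟩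
  rw [← hc, ← hG, show ((v, r) : Phase n × ℝ) = (v, 0) + r • (0, 1) by simp, map_add, map_smul,
    map_add, map_smul]
  simp

end Blocks

section Averaged

variable {n : ℕ} [NeZero n] {A : SqMatrix n} {b : Phase n}

lemma blk_polarMap (θ : ℝ) (z : Polar n) (j : Fin n) :
    blk j (polarMap θ z) = z.1 j * Complex.exp (angle θ z j * Complex.I) := by
  apply Complex.ext
  · rw [Complex.re_ofReal_mul, Complex.exp_ofReal_mul_I_re]; simp [polarMap]
  · rw [Complex.im_ofReal_mul, Complex.exp_ofReal_mul_I_im]; simp [polarMap]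

lemma angle_add (θ t : ℝ) (z : Polar n) (j : Fin n) :
    angle (t + θ) z j = freq j * t + angle θ z j := by
  simp only [angle, freq]; ring

lemma polarMap_add (θ t : ℝ) (z : Polar n) : polarMap (t + θ) z = rot n t (polarMap θ z) := by
  refine phase_ext fun j => ?_
  rw [blk_rot, blk_polarMap, blk_polarMap, angle_add]
  push_cast
  rw [add_mul, Complex.exp_add]
  ring

lemma polarMap_zero_zero (θ : ℝ) (z : Polar n) :
    polarMap θ z (0, 0) = z.1 0 * Real.cos θ := by
  simp [polarMap, angle]

/-- The perturbation in the rotating frame. -/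
def rotPerturbation (A : SqMatrix n) (b : Phase n) (z : Polar n) (θ : ℝ) : Phase n :=
  rot n (-θ) (perturbation A b θ z)

/-- The rotation by -θ removes the moving phase (2j+1)θ, so the polar components can be read off
with the fixed phase `angle 0 z j` and the integral can be taken before projecting. -/
lemma blk_rotPerturbation (z : Polar n) (θ : ℝ) (j : Fin n) :
    Complex.exp (-(angle 0 z j * Complex.I)) * blk j (rotPerturbation A b z θ) =
      Complex.exp (-(angle θ z j * Complex.I)) * blk j (perturbation A b θ z) := by
  have h1 := angle_add 0 θ z j
  rw [add_zero] at h1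
  rw [rotPerturbation, blk_rot, h1, ← mul_assoc, ← Complex.exp_add]
  push_cast
  ring_nf

lemma radialPart_eq (z : Polar n) (θ : ℝ) (j : Fin n) :
    radialPart A b θ z j =
      (Complex.exp (-(angle 0 z j * Complex.I)) * blk j (rotPerturbation A b z θ)).re := by
  rw [blk_rotPerturbation, ← neg_mul, ← Complex.ofReal_neg, Complex.mul_re,
    Complex.exp_ofReal_mul_I_re, Complex.exp_ofReal_mul_I_im]
  simp [radialPart]
  ring

lemma angularPart_eq (z : Polar n) (θ : ℝ) (j : Fin n) :
    angularPart A b θ z j =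
      (Complex.exp (-(angle 0 z j * Complex.I)) * blk j (rotPerturbation A b z θ)).im / z.1 j := by
  rw [blk_rotPerturbation, ← neg_mul, ← Complex.ofReal_neg, Complex.mul_im,
    Complex.exp_ofReal_mul_I_re, Complex.exp_ofReal_mul_I_im]
  simp [angularPart]
  ring

/-- Half a turn reverses the sign of the perturbation, by oddness, and also that of the rotation;
the two signs cancel. -/
lemma rotPerturbation_periodic (A : SqMatrix n) (b : Phase n) (z : Polar n) :
    Function.Periodic (rotPerturbation A b z) Real.pi := fun θ => by
  have h1 : polarMap (θ + Real.pi) z = -polarMap θ z := by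
    rw [add_comm, polarMap_add, rot_pi]
  have h2 : perturbation A b (θ + Real.pi) z = -perturbation A b θ z := by
    simp only [perturbation, h1, Matrix.mulVec_neg, Pi.neg_apply, Real.sign_neg, neg_smul]
    abel
  have h3 := rot_add_pi (-(θ + Real.pi)) (-perturbation A b θ z)
  rw [show -(θ + Real.pi) + Real.pi = -θ by ring, map_neg, map_neg, neg_neg] at h3
  simp only [rotPerturbation, h2, map_neg]
  rw [← h3, neg_neg]

/-- By π-periodicity the full average is twice the one over (-π/2, π/2), where cos θ > 0 and the
sign function equals 1. Starting at θ = -π/2, on the discontinuity, explains the shift by π/2. -/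
lemma integral_rotPerturbation {z : Polar n} (hz : 0 < z.1 0) :
    IntervalIntegrable (rotPerturbation A b z) volume 0 (2 * Real.pi) ∧
    ∫ θ in (0 : ℝ)..(2 * Real.pi), rotPerturbation A b z θ =
      (2 : ℝ) • rot n (Real.pi / 2) (halfAverage A b (polarMap (-(Real.pi / 2)) z, 1)) := by
  have hpi := Real.pi_pos
  set g : ℝ → Phase n := fun s =>
    rot n (-s) (A.mulVec (rot n s (polarMap (-(Real.pi / 2)) z)) + b) with hg
  have hgc : Continuous g := by
    have : Continuous fun s : ℝ => lin A (rot n s (polarMap (-(Real.pi / 2)) z)) := by fun_prop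
    simp only [lin_apply] at this
    fun_prop
  have hEq : ∀ s ∈ Ioo 0 Real.pi,
      rot n (Real.pi / 2) (g s) = rotPerturbation A b z (s - Real.pi / 2) := fun s hs => by
    have h1 : 0 < polarMap (s - Real.pi / 2) z (0, 0) := by
      rw [polarMap_zero_zero]
      exact mul_pos hz (Real.cos_pos_of_mem_Ioo ⟨by linarith [hs.1], by linarith [hs.2]⟩)
    rw [rotPerturbation, perturbation, Real.sign_of_pos h1, one_smul, hg]
    simp only
    rw [← rot_add, ← polarMap_add]
    ring_nf
  have hae : ∀ᵐ s, s ∈ uIoc 0 Real.pi →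
      rot n (Real.pi / 2) (g s) = rotPerturbation A b z (s - Real.pi / 2) := by
    filter_upwards [Measure.ae_ne volume Real.pi] with s hs hs'
    rw [uIoc_of_le hpi.le] at hs'
    exact hEq s ⟨hs'.1, lt_of_le_of_ne hs'.2 hs⟩
  have hGg : IntervalIntegrable (fun s => rotPerturbation A b z (s - Real.pi / 2)) volume 0 Real.pi :=
    (((rot n (Real.pi / 2)).continuous.comp hgc).intervalIntegrable 0 Real.pi).congr_ae
      ((ae_restrict_iff' measurableSet_uIoc).2 hae)
  have hper := rotPerturbation_periodic A b z
  have hper' : Function.Periodic (fun s => rotPerturbation A b z (s - Real.pi / 2)) Real.pi :=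
    hper.sub_const _
  have hint : ∀ s t, IntervalIntegrable (fun s => rotPerturbation A b z (s - Real.pi / 2)) volume s t :=
    fun s t => hper'.intervalIntegrable hpi.ne' (t := 0) (by simpa using hGg) s t
  have hint' : ∀ s t, IntervalIntegrable (rotPerturbation A b z) volume s t := fun s t => by
    have := (hint (s + Real.pi / 2) (t + Real.pi / 2)).comp_add_right (Real.pi / 2)
    simpa using this
  refine ⟨hint' _ _, ?_⟩
  have h1 : ∀ t, ∫ θ in t..t + Real.pi, rotPerturbation A b z θ =
      rot n (Real.pi / 2) (halfAverage A b (polarMap (-(Real.pi / 2)) z, 1)) := fun t => by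
    rw [hper.intervalIntegral_add_eq t (0 - Real.pi / 2),
      show 0 - Real.pi / 2 + Real.pi = Real.pi - Real.pi / 2 by ring,
      ← intervalIntegral.integral_comp_sub_right (rotPerturbation A b z) (Real.pi / 2),
      ← intervalIntegral.integral_congr_ae hae,
      (rot n (Real.pi / 2)).intervalIntegral_comp_comm (hgc.intervalIntegrable _ _)]
    simp [halfAverage, hg]
  have h2 := intervalIntegral.integral_add_adjacent_intervals (hint' 0 Real.pi)
    (hint' Real.pi (2 * Real.pi))
  have h3 := h1 0
  have h4 := h1 Real.pi
  rw [zero_add] at h3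
  rw [← two_mul] at h4
  rw [← h2, h3, h4, two_smul]

/-- The average of the perturbation in the rotating frame, in the plane of index `j` and with
respect to the radial direction. -/
def polarAverage (A : SqMatrix n) (b : Phase n) (z : Polar n) (j : Fin n) : ℂ :=
  Complex.exp (-(angle 0 z j * Complex.I)) * blk j ((2 : ℝ) • rot n (Real.pi / 2)
    (halfAverage A b (polarMap (-(Real.pi / 2)) z, 1)))

/-- In the radial frame the real part of the complex average is the radial drift and the imaginary
part divided by the radius is the angular drift; subtracting 2j+1 times the drift of plane 0
accounts for θ being the new time. -/
lemma averaged_eq {z : Polar n} (hz : 0 < z.1 0) :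
    averaged A b z = (fun j => (polarAverage A b z j).re, fun j : {j : Fin n // j ≠ 0} =>
      (polarAverage A b z j).im / z.1 j - freq (j : Fin n) *
        ((polarAverage A b z 0).im / z.1 0)) := by
  obtain ⟨hint, hval⟩ := integral_rotPerturbation (A := A) (b := b) hz
  have hc : ∀ j, ∫ θ in (0 : ℝ)..(2 * Real.pi),
      Complex.exp (-(angle 0 z j * Complex.I)) * blk j (rotPerturbation A b z θ) =
      polarAverage A b z j := fun j => by
    have h1 := ((ContinuousLinearMap.mul ℝ ℂ (Complex.exp (-(angle 0 z j * Complex.I)))).comp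
      (blk j)).intervalIntegral_comp_comm hint
    simp only [ContinuousLinearMap.comp_apply, ContinuousLinearMap.mul_apply'] at h1
    rw [h1, hval, polarAverage]
  have hci : ∀ j, IntervalIntegrable (fun θ => Complex.exp (-(angle 0 z j * Complex.I)) *
      blk j (rotPerturbation A b z θ)) volume 0 (2 * Real.pi) := fun j =>
    ⟨((ContinuousLinearMap.mul ℝ ℂ (Complex.exp (-(angle 0 z j * Complex.I)))).comp
      (blk j)).integrable_comp hint.1,
      ((ContinuousLinearMap.mul ℝ ℂ (Complex.exp (-(angle 0 z j * Complex.I)))).comp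
      (blk j)).integrable_comp hint.2⟩
  have hrad : ∀ j, ∫ θ in (0 : ℝ)..(2 * Real.pi), radialPart A b θ z j =
      (polarAverage A b z j).re := fun j => by
    rw [← hc]
    simp only [radialPart_eq]
    exact Complex.reCLM.intervalIntegral_comp_comm (hci j)
  have hang : ∀ j, IntervalIntegrable (fun θ => angularPart A b θ z j) volume 0 (2 * Real.pi) ∧
      ∫ θ in (0 : ℝ)..(2 * Real.pi), angularPart A b θ z j =
        (polarAverage A b z j).im / z.1 j := fun j => by
    simp only [angularPart_eq]
    refine ⟨IntervalIntegrable.div_const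
      ⟨Complex.imCLM.integrable_comp (hci j).1, Complex.imCLM.integrable_comp (hci j).2⟩ _, ?_⟩
    rw [intervalIntegral.integral_div, ← hc]
    exact congrArg (· / z.1 j) (Complex.imCLM.intervalIntegral_comp_comm (hci j))
  refine Prod.ext (funext fun j => hrad j) (funext fun j => ?_)
  simp only [averaged, firstOrder]
  rw [intervalIntegral.integral_sub (hang _).1 ((hang _).1.const_mul _),
    intervalIntegral.integral_const_mul, (hang _).2, (hang _).2]
  rfl

/-- The equilibria of the averaged equation in Cartesian form are zeros of the averaged
function. -/
lemma averaged_eq_zero {z : Polar n} (hz : z ∈ polarDomain n) {σ : ℝ}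
    (h : halfAverage A b (polarMap (-(Real.pi / 2)) z, 1) +
      σ • (A₀ n).mulVec (polarMap (-(Real.pi / 2)) z) = 0) : averaged A b z = 0 := by
  have hval : (2 : ℝ) • rot n (Real.pi / 2) (halfAverage A b (polarMap (-(Real.pi / 2)) z, 1)) =
      (-(2 * σ)) • (A₀ n).mulVec (polarMap 0 z) := by
    rw [eq_neg_of_add_eq_zero_left h, map_neg, map_smul, rot_A₀, ← polarMap_add,
      add_neg_cancel]
    module
  have hc : ∀ j, polarAverage A b z j = ((-(2 * σ * freq j * z.1 j) : ℝ) : ℂ) * Complex.I :=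
      fun j => by
    rw [polarAverage, hval, map_smul, blk_A₀, blk_polarMap, Complex.real_smul]
    have h2 : Complex.exp (-(angle 0 z j * Complex.I)) * Complex.exp (angle 0 z j * Complex.I) = 1 := by
      rw [← Complex.exp_add]; simp
    push_cast
    linear_combination (-(2 * σ) * freq j * Complex.I * z.1 j : ℂ) * h2
  -- At an equilibrium there is no radial drift, and all planes drift in phase proportionally to
  -- their frequencies; this is a pure time shift and disappears in the relative angles.
  have him : ∀ j, (polarAverage A b z j).im / z.1 j = -(2 * σ * freq j) := fun j => by
    have := (hz j).ne'
    rw [hc, Complex.im_ofReal_mul, Complex.I_im]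
    field_simp
  rw [averaged_eq (hz 0)]
  simp only [him]
  refine Prod.ext (funext fun j => ?_) (funext fun j => ?_)
  · simp only [hc]
    simp
  · simp [freq]
    ring

end Averaged

end

end ControlCenter

/-! ### Isolated zeros are non-degenerate and unique -/

namespace ControlCenter

noncomputable section

variable {n : ℕ} {A : SqMatrix n} {b : Phase n}

/-- `ξ` is an equilibrium of the averaged equation, up to the phase shift with rate `σ`. -/
def IsEquilibrium (A : SqMatrix n) (b ξ : Phase n) (σ : ℝ) : Prop :=
  halfAverage A b (ξ, 1) + σ • (A₀ n).mulVec ξ = 0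

section Scalar

variable {c d : Fin n → ℂ}

lemma isEquilibrium_iff
    (hcd : ∀ v r j, blk j (halfAverage A b (v, r)) = c j * blk j v + (r : ℝ) * d j)
    {ξ : Phase n} {σ : ℝ} :
    IsEquilibrium A b ξ σ ↔ ∀ j, (c j + σ * freq j * Complex.I) * blk j ξ + d j = 0 := by
  have h : ∀ j, blk j (halfAverage A b (ξ, 1) + σ • (A₀ n).mulVec ξ) =
      (c j + σ * freq j * Complex.I) * blk j ξ + d j := fun j => by
    rw [map_add, map_smul, hcd, blk_A₀, Complex.real_smul]
    push_cast
    ring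
  constructor
  · intro h1 j
    rw [← h, h1, map_zero]
  · intro h1
    exact phase_ext fun j => by rw [h, h1, map_zero]

variable [NeZero n]

lemma freq_zero : freq (0 : Fin n) = 1 := by simp [freq]

lemma blk_section (z : Polar n) :
    blk 0 (polarMap (-(Real.pi / 2)) z) = -Complex.I * z.1 0 := by
  rw [blk_polarMap]
  have : angle (-(Real.pi / 2)) z 0 = -(Real.pi / 2) := by simp [angle]
  rw [this]
  push_cast
  rw [neg_mul, Complex.exp_neg, Complex.exp_pi_div_two_mul_I, Complex.inv_I]
  ring

lemma isOpen_polarDomain : IsOpen (polarDomain n) := by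
  rw [polarDomain, Set.ofPred_forall]
  exact isOpen_iInter_of_finite fun j =>
    isOpen_lt continuous_const ((continuous_apply j).comp continuous_fst)

/-- The rate σ may vary along the curve: whatever it is, each of its points is a zero of the
averaged function. -/
lemma not_curve_of_isolated {a : Polar n} (ha : a ∈ polarDomain n)
    (hiso : ∀ᶠ z in 𝓝 a, z ≠ a → averaged A b z ≠ 0) {γ : ℝ → Polar n}
    (hγ : ContinuousAt γ 0) (h0 : γ 0 = a)
    (h : ∀ᶠ t in 𝓝 (0 : ℝ), t ≠ 0 →
      γ t ≠ a ∧ ∃ σ, IsEquilibrium A b (polarMap (-(Real.pi / 2)) (γ t)) σ) : False := by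
  have h1 : Tendsto γ (𝓝 0) (𝓝 a) := by rw [← h0]; exact hγ
  have h2 : ∀ᶠ t in 𝓝[≠] (0 : ℝ), False := by
    filter_upwards [nhdsWithin_le_nhds (h1.eventually hiso),
      nhdsWithin_le_nhds (h1.eventually (isOpen_polarDomain.mem_nhds ha)),
      nhdsWithin_le_nhds h, self_mem_nhdsWithin] with t h2 h3 h4 h5
    obtain ⟨h6, σ, h7⟩ := h4 h5
    exact h2 h6 (averaged_eq_zero h3 h7)
  exact h2.exists.choose_spec

/-- At an isolated zero of the averaged function, the averaged equation is non-degenerate. -/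
lemma nondegenerate_of_isolated
    (hcd : ∀ v r j, blk j (halfAverage A b (v, r)) = c j * blk j v + (r : ℝ) * d j)
    {a : Polar n} (ha : a ∈ polarDomain n)
    (hiso : ∀ᶠ z in 𝓝 a, z ≠ a → averaged A b z ≠ 0) {σ : ℝ}
    (hσ : IsEquilibrium A b (polarMap (-(Real.pi / 2)) a) σ) :
    (c 0).re ≠ 0 ∧ ∀ j ≠ 0, c j + σ * freq j * Complex.I ≠ 0 := by
  have hsec : ∀ j, blk j (polarMap (-(Real.pi / 2)) a) =
    a.1 j * Complex.exp (angle (-(Real.pi / 2)) a j * Complex.I) := fun j => blk_polarMap _ _ j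
  have heq := (isEquilibrium_iff hcd).1 hσ
  have hnz : ∀ j ≠ 0, c j + σ * freq j * Complex.I ≠ 0 := by
    intro j hj hzero
    have hd : d j = 0 := by simpa [hzero] using heq j
    -- With the coefficient and `d j` both zero the equation of plane j is void, so its radius can
    -- be scaled freely.
    refine not_curve_of_isolated ha hiso
      (γ := fun t => (Function.update a.1 j (a.1 j * (1 + t)), a.2)) ?_ (by simp) ?_
    · exact ((continuous_const.update j (by fun_prop)).prodMk continuous_const).continuousAt
    · refine Eventually.of_forall fun t ht => ⟨fun h => ?_, σ, (isEquilibrium_iff hcd).2 fun k => ?_⟩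
      · have := congrFun (congrArg Prod.fst h) j
        simp only [Function.update_self] at this
        exact ht (by simpa [(ha j).ne'] using (show a.1 j * t = 0 by linarith))
      · by_cases hk : k = j
        · rw [hk, hzero, hd]; simp
        · rw [← heq k, blk_polarMap, hsec k]
          simp only [angle, Function.update_of_ne hk]
  refine ⟨fun hre => ?_, hnz⟩
  set β := (c 0).im with hβ
  have hc0 : c 0 = β * Complex.I := by apply Complex.ext <;> simp [hre, hβ]
  -- With c₀ = iβ and w₀ = -ir the equation of plane 0 reads (β + σ) r + d₀ = 0. Changing r to r(1 +
  -- t) is compensated by the rate `s t`, which keeps that product constant.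
  set s : ℝ → ℝ := fun t => (β + σ) / (1 + t) - β with hs
  -- In every other plane the changed rate is compensated by multiplying w_j by `ρ j t`; its modulus
  -- and argument give the polar curve, continuous at t = 0 because `ρ j 0 = 1` lies off the cut of
  -- `arg`.
  set ρ : Fin n → ℝ → ℂ := fun j t =>
    (c j + σ * freq j * Complex.I) / (c j + s t * freq j * Complex.I) with hρ
  have hs0 : s 0 = σ := by simp [hs]
  have hscont : ContinuousAt s 0 := by
    simp only [hs]
    exact (continuousAt_const.div (by fun_prop) (by norm_num)).sub continuousAt_const
  have hdcont : ∀ j, ContinuousAt (fun t => c j + s t * freq j * Complex.I) 0 := fun j =>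
    continuousAt_const.add (((Complex.continuous_ofReal.continuousAt.comp hscont).mul
      continuousAt_const).mul continuousAt_const)
  have hρ0 : ∀ j ≠ 0, ρ j 0 = 1 := fun j hj => by
    simp only [hρ, hs0]; exact div_self (hnz j hj)
  have hρcont : ∀ j ≠ 0, ContinuousAt (ρ j) 0 := fun j hj =>
    continuousAt_const.div (hdcont j) (by rw [hs0]; exact hnz j hj)
  refine not_curve_of_isolated ha hiso
    (γ := fun t => (fun j => if j = 0 then a.1 0 * (1 + t) else a.1 j * ‖ρ j t‖,
      fun j => a.2 j + (ρ j t).arg)) ?_ ?_ ?_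
  · refine ContinuousAt.prodMk (continuousAt_pi.2 fun j => ?_) (continuousAt_pi.2 fun j => ?_)
    · by_cases hj : j = 0
      · simp only [hj, if_true]; fun_prop
      · simp only [hj, if_false]
        exact continuousAt_const.mul (hρcont j hj).norm
    · refine continuousAt_const.add ((Complex.continuousAt_arg ?_).comp (hρcont j j.2))
      rw [hρ0 j j.2]; exact Complex.one_mem_slitPlane
  · refine Prod.ext (funext fun j => ?_) (funext fun j => ?_)
    · by_cases hj : j = 0
      · simp [hj]
      · simp [hj, hρ0 j hj]
    · simp [hρ0 j j.2]
  · have hne : ∀ᶠ t in 𝓝 (0 : ℝ), ∀ j, j ≠ 0 → c j + s t * freq j * Complex.I ≠ 0 := by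
      refine eventually_all.2 fun j => ?_
      by_cases hj : j = 0
      · simp [hj]
      · exact ((hdcont j).eventually_ne (by rw [hs0]; exact hnz j hj)).mono fun t h _ => h
    have h1t : ∀ᶠ t in 𝓝 (0 : ℝ), 1 + t ≠ 0 :=
      ContinuousAt.eventually_ne (by fun_prop) (by norm_num)
    filter_upwards [hne, h1t] with t h1 h2 ht
    refine ⟨fun h => ?_, s t, (isEquilibrium_iff hcd).2 fun j => ?_⟩
    · have := congrFun (congrArg Prod.fst h) 0
      simp only [if_true] at this
      exact ht (by simpa [(ha 0).ne'] using (show a.1 0 * t = 0 by linarith))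
    · by_cases hj : j = 0
      · rw [hj, blk_section]
        have h3 := heq 0
        rw [blk_section, hc0, freq_zero] at h3
        rw [hc0, freq_zero]
        have h4 : ((s t + β) * (1 + t) : ℂ) = β + σ := by
          have : (s t + β) * (1 + t) = β + σ := by
            simp only [hs]; field_simp; ring
          exact_mod_cast this
        simp only [if_true]
        push_cast at h3 ⊢
        linear_combination h3 - (a.1 0 : ℂ) * Complex.I ^ 2 * h4
      · rw [← heq j, blk_polarMap, hsec j]
        have h3 : angle (-(Real.pi / 2)) ((fun j => if j = 0 then a.1 0 * (1 + t) else
            a.1 j * ‖ρ j t‖, fun j => a.2 j + (ρ j t).arg) : Polar n) j =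
            angle (-(Real.pi / 2)) a j + (ρ j t).arg := by
          simp only [angle, hj, dite_false]; ring
        rw [h3]
        simp only [hj, if_false]
        have h4 : (‖ρ j t‖ * Complex.exp ((ρ j t).arg * Complex.I) : ℂ) = ρ j t :=
          Complex.norm_mul_exp_arg_mul_I _
        have h5 : (c j + s t * freq j * Complex.I) * ρ j t = c j + σ * freq j * Complex.I :=
          mul_div_cancel₀ _ (h1 j hj)
        push_cast
        rw [add_mul (angle (-(Real.pi / 2)) a j : ℂ), Complex.exp_add]
        linear_combination (a.1 j : ℂ) * Complex.exp (angle (-(Real.pi / 2)) a j * Complex.I) *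
          ((c j + s t * freq j * Complex.I) * h4 + h5)

/-- In plane 0 both Δ and ξ are purely imaginary. The imaginary part of the equation gives Re c₀ ·
Δ₂ = 0, then the real part gives μ = 0, and the other planes are solved by division. -/
lemma linearized_injective
    (hcd : ∀ v r j, blk j (halfAverage A b (v, r)) = c j * blk j v + (r : ℝ) * d j)
    {ξ : Phase n} (h0 : ξ (0, 0) = 0) (h1 : ξ (1, 0) ≠ 0) (hre : (c 0).re ≠ 0)
    (hnz : ∀ j ≠ 0, c j + timeSlope A b ξ * freq j * Complex.I ≠ 0) (Δ : Phase n) (μ : ℝ)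
    (hΔ : Δ (0, 0) = 0)
    (h : CrossingData.linearized A b ξ Δ + μ • (A₀ n).mulVec ξ = 0) : Δ = 0 := by
  have heq : ∀ j, (c j + timeSlope A b ξ * freq j * Complex.I) * blk j Δ +
      μ * (freq j * Complex.I * blk j ξ) = 0 := fun j => by
    have := congrArg (blk j) h
    rw [map_zero, CrossingData.linearized, map_add, map_add, map_smul, map_smul, hcd, blk_A₀,
      blk_A₀, Complex.real_smul, Complex.real_smul] at this
    push_cast at this
    linear_combination this
  have h2 := heq 0
  rw [blk_apply 0 Δ, blk_apply 0 ξ, hΔ, h0, freq_zero] at h2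
  have him := congrArg Complex.im h2
  have hrel := congrArg Complex.re h2
  simp at him hrel
  have hy : Δ (1, 0) = 0 := him.resolve_left hre
  have hμ : μ = 0 := by
    rw [hy] at hrel
    simpa [h1] using hrel
  refine phase_ext fun j => ?_
  rw [map_zero]
  by_cases hj : j = 0
  · rw [hj, blk_apply, hΔ, hy]; simp
  · have := heq j
    rw [hμ] at this
    simpa [hnz j hj] using this

/-- On the section the imaginary part of the equation of plane 0 determines x₂, its real part
determines σ, and the remaining planes follow by division. -/
lemma equilibrium_unique
    (hcd : ∀ v r j, blk j (halfAverage A b (v, r)) = c j * blk j v + (r : ℝ) * d j)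
    {ξ ξ' : Phase n} {σ σ' : ℝ} (h : IsEquilibrium A b ξ σ) (h' : IsEquilibrium A b ξ' σ')
    (h0 : ξ (0, 0) = 0) (h0' : ξ' (0, 0) = 0) (h1 : ξ (1, 0) ≠ 0) (hre : (c 0).re ≠ 0)
    (hnz : ∀ j ≠ 0, c j + σ * freq j * Complex.I ≠ 0) : ξ = ξ' := by
  rw [isEquilibrium_iff hcd] at h h'
  have h2 := h 0
  have h3 := h' 0
  rw [blk_apply, h0, freq_zero] at h2
  rw [blk_apply, h0', freq_zero] at h3
  have hi2 := congrArg Complex.im h2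
  have hi3 := congrArg Complex.im h3
  have hr2 := congrArg Complex.re h2
  have hr3 := congrArg Complex.re h3
  simp at hi2 hi3 hr2 hr3
  have hy : ξ (1, 0) = ξ' (1, 0) := mul_left_cancel₀ hre (by linarith)
  rw [← hy] at hr3
  have hσ : σ = σ' := by
    have : (σ - σ') * ξ (1, 0) = 0 := by linarith
    exact sub_eq_zero.1 ((mul_eq_zero.1 this).resolve_right h1)
  refine phase_ext fun j => ?_
  by_cases hj : j = 0
  · rw [hj, blk_apply, blk_apply, h0, h0', hy]
  · refine mul_left_cancel₀ (hnz j hj) ?_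
    have h4 := h j
    have h5 := h' j
    rw [← hσ] at h5
    linear_combination h4 - h5

end Scalar

end

end ControlCenter

/-! ### From bifurcating cycles to chains of crossings; uniqueness -/

namespace ControlCenter

noncomputable section

variable {n : ℕ} [NeZero n] {A : SqMatrix n} {b : Phase n} {l : Filter ℝ}

/-- The solution `x` seen after `k` half turns of duration `P`, up to the symmetry. -/
def halfTurns (P : ℝ) (x : ℝ → Phase n) (k : ℕ) (t : ℝ) : Phase n := (-1 : ℝ) ^ k • x (t + k * P)

omit [NeZero n] in
lemma halfTurns_zero (P : ℝ) (x : ℝ → Phase n) : halfTurns P x 0 = x := by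
  funext t; simp [halfTurns]

omit [NeZero n] in
lemma halfTurns_succ (P : ℝ) (x : ℝ → Phase n) (k : ℕ) :
    halfTurns P x (k + 1) = fun t => -halfTurns P x k (t + P) := by
  funext t
  simp only [halfTurns, pow_succ]
  push_cast
  rw [show t + (k + 1) * P = t + P + k * P by ring]
  simp

omit [NeZero n] in
lemma smul_halfTurns (P : ℝ) (x : ℝ → Phase n) (k : ℕ) (t : ℝ) :
    (-1 : ℝ) ^ k • halfTurns P x k (t - k * P) = x t := by
  rw [halfTurns, smul_smul, ← mul_pow]; simp

lemma IsSolution.halfTurns {ε : ℝ} {x : ℝ → Phase n} (hx : IsSolution A b ε x) (P : ℝ) (k : ℕ) :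
    IsSolution A b ε (halfTurns P x k) := by
  induction k with
  | zero => rwa [halfTurns_zero]
  | succ k ih =>
    rw [halfTurns_succ]
    exact (ih.comp_add_const P).neg

omit [NeZero n] in
-- The limit is invariant under a reflected half turn, so every half turn of the family falls under
-- the same crossing lemma.
lemma tendsto_halfTurns {x : ℝ → ℝ → Phase n} {ξ : Phase n}
    (h : TendstoLocallyUniformly x (fun t => rot n t ξ) l) (k : ℕ) :
    TendstoLocallyUniformly (fun ε => halfTurns Real.pi (x ε) k) (fun t => rot n t ξ) l := by
  induction k with
  | zero => simpa only [halfTurns_zero] using h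
  | succ k ih =>
    simp only [halfTurns_succ]
    have h1 := uniformContinuous_neg.comp_tendstoLocallyUniformly
      (ih.comp (fun t => t + Real.pi) (continuous_add_const Real.pi))
    have h2 : (fun t => rot n t ξ) = Neg.neg ∘ (fun t => rot n t ξ) ∘ fun t => t + Real.pi := by
      funext t; simp [rot_add_pi]
    rw [h2]
    exact h1

lemma exists_index_of_lt {g : ℕ → ℝ} {t : ℝ} (h0 : g 0 ≤ t) :
    ∀ K, t < g K → ∃ k < K, g k ≤ t ∧ t < g (k + 1) := by
  intro K
  induction K with
  | zero => intro h; exact absurd h0 (not_le.2 h)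
  | succ K ih =>
    intro h
    rcases lt_or_ge t (g K) with h1 | h1
    · obtain ⟨k, hk, hk'⟩ := ih h1
      exact ⟨k, hk.trans (Nat.lt_succ_self K), hk'⟩
    · exact ⟨K, Nat.lt_succ_self K, h1, h⟩

/-- The set of points of the trajectory that consists of the pieces of the affine flow which start
at the crossing points `ξ k` and last for the times `τ k`. -/
def orbitPieces (A : SqMatrix n) (b : Phase n) (ε : ℝ) (K : ℕ) (ξ : ℕ → Phase n) (τ : ℕ → ℝ) :
    Set (Phase n) :=
  {p | ∃ k < K, ∃ s ∈ Icc 0 (τ k), p = (-1 : ℝ) ^ k • flow A b ε (ξ k) s}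

omit [NeZero n] in
lemma orbitPieces_congr {ε : ℝ} {K : ℕ} {ξ ξ' : ℕ → Phase n} {τ τ' : ℕ → ℝ}
    (hξ : ∀ k < K, ξ k = ξ' k) (hτ : ∀ k < K, τ k = τ' k) :
    orbitPieces A b ε K ξ τ = orbitPieces A b ε K ξ' τ' := by
  ext p
  refine exists_congr fun k => and_congr_right fun hk => ?_
  rw [hξ k hk, hτ k hk]

/-- Periodic solutions that tend to a solution of the linear center give rise to crossing data. -/
lemma exists_crossingData (hl : l ≤ 𝓝 0) {x : ℝ → ℝ → Phase n} {T : ℝ → ℝ} {ξ₀ : Phase n} {M : ℕ}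
    (hM : 0 < M) (hx : ∀ᶠ ε in l, IsSolution A b ε (x ε) ∧ Function.Periodic (x ε) (T ε))
    (hT : Tendsto T l (𝓝 (2 * M * Real.pi)))
    (hlim : TendstoLocallyUniformly x (fun t => rot n t ξ₀) l)
    (h0 : ξ₀ (0, 0) = 0) (h1 : ξ₀ (1, 0) < 0) :
    ∃ (ξ : ℕ → ℝ → Phase n) (τ : ℕ → ℝ → ℝ), CrossingData A b l ξ₀ (2 * M) ξ τ ∧
      ∀ᶠ ε in l, range (x ε) = orbitPieces A b ε (2 * M) (fun k => ξ k ε) (fun k => τ k ε) := by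
  have hex : ∀ k, ∃ S : ℝ → ℝ, Tendsto S l (𝓝 0) ∧
      ∀ᶠ ε in l, IsCrossing (halfTurns Real.pi (x ε) k) (S ε) := fun k =>
    exists_crossing hl (hx.mono fun ε h => h.1.halfTurns Real.pi k) (tendsto_halfTurns hlim k) h0 h1
  choose S hS0 hS using hex
  have hflow : ∀ k, ∀ᶠ ε in l, ∀ t ∈ Icc (S k ε) (S (k + 1) ε + Real.pi),
      halfTurns Real.pi (x ε) k t = flow A b ε (halfTurns Real.pi (x ε) k (S k ε)) (t - S k ε) := fun k => by
    filter_upwards [hx, hS k, hS (k + 1)] with ε h2 h3 h4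
    exact h3.eq_flow (h2.1.halfTurns Real.pi k) (by rwa [halfTurns_succ] at h4)
  have hle : ∀ k, ∀ᶠ ε in l, S k ε ≤ S (k + 1) ε + Real.pi := fun k => by
    filter_upwards [hS k, hS (k + 1)] with ε h3 h4
    linarith [h3.mem.2, h4.mem.1, pi_sub_one_gt]
  -- After 2M half turns the sign is +1, and periodicity puts a zero of x₁ at the shifted time;
  -- uniqueness in the window identifies it with the crossing already chosen.
  have hper : ∀ᶠ ε in l, S (2 * M) ε = S 0 ε + T ε - 2 * M * Real.pi ∧
      halfTurns Real.pi (x ε) (2 * M) (S (2 * M) ε) = halfTurns Real.pi (x ε) 0 (S 0 ε) := by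
    have h2 : Tendsto (fun ε => S 0 ε + T ε - 2 * M * Real.pi) l (𝓝 0) := by
      simpa using ((hS0 0).add hT).sub_const (2 * M * Real.pi)
    filter_upwards [hx, hS 0, hS (2 * M), h2.eventually (Icc_mem_nhds (a := (-1 : ℝ)) (by norm_num) one_pos)]
      with ε h3 h4 h5 h6
    have h7 : halfTurns Real.pi (x ε) (2 * M) (S 0 ε + T ε - 2 * M * Real.pi) =
        halfTurns Real.pi (x ε) 0 (S 0 ε) := by
      simp only [halfTurns, pow_mul]
      have := h3.2 (S 0 ε)
      simp [this]
    have h8 := h5.unique (t := S 0 ε + T ε - 2 * M * Real.pi) h6 (by rw [h7]; exact h4.zero)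
    rw [← h8]
    exact ⟨rfl, h7⟩
  refine ⟨fun k ε => halfTurns Real.pi (x ε) k (S k ε), fun k ε => S (k + 1) ε + Real.pi - S k ε,
    ⟨fun k _ => ?_, fun k _ => ?_, fun k _ => ?_, fun k _ => ?_, ?_⟩, ?_⟩
  · filter_upwards [hflow k, hle k] with ε h2 h3
    have h4 := h2 _ (right_mem_Icc.2 h3)
    rw [halfMap, ContinuousLinearMap.mul_def, ContinuousLinearMap.comp_apply, flowMap_apply_one,
      ← h4, halfTurns_succ]
    simp
  · exact (hS k).mono fun ε h => h.zero
  · simpa using ((hS0 (k + 1)).add_const Real.pi).sub (hS0 k)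
  · have := (tendsto_halfTurns hlim k).tendsto_comp (x := 0)
      (by fun_prop : Continuous fun t => rot n t ξ₀).continuousAt (hS0 k)
    simpa using this
  · exact hper.mono fun ε h => h.2
  · have hTpos : ∀ᶠ ε in l, 0 < T ε := hT.eventually_const_lt (by positivity)
    have hflow' : ∀ᶠ ε in l, ∀ k ∈ Finset.range (2 * M), ∀ t ∈ Icc (S k ε) (S (k + 1) ε + Real.pi),
        halfTurns Real.pi (x ε) k t = flow A b ε (halfTurns Real.pi (x ε) k (S k ε)) (t - S k ε) := by
      rw [Filter.eventually_all_finset]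
      exact fun k _ => hflow k
    filter_upwards [hflow', hper, hx, hTpos] with ε h2 h3 h4 h5
    ext p
    constructor
    · rintro ⟨t, rfl⟩
      -- Any time is moved by the period into the interval between crossings 0 and 2M, where some
      -- pair of consecutive crossings encloses it.
      obtain ⟨t', ht', hxt⟩ := h4.2.exists_mem_Ico h5 t (S 0 ε)
      obtain ⟨k, hk, hk1, hk2⟩ := exists_index_of_lt (g := fun k => S k ε + k * Real.pi) (t := t')
        (by simpa using ht'.1) (2 * M) (by rw [h3.1]; push_cast; linarith [ht'.2])
      push_cast at hk2
      refine ⟨k, hk, t' - k * Real.pi - S k ε, ⟨by linarith, by linarith⟩, ?_⟩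
      rw [← h2 k (Finset.mem_range.2 hk) _ ⟨by linarith, by linarith⟩, smul_halfTurns, hxt]
    · rintro ⟨k, hk, s, hs, rfl⟩
      refine ⟨S k ε + s + k * Real.pi, ?_⟩
      have h6 := h2 k (Finset.mem_range.2 hk) (S k ε + s) ⟨by linarith [hs.1], by linarith [hs.2]⟩
      rw [add_sub_cancel_left] at h6
      simp only
      rw [← h6, ← smul_halfTurns Real.pi (x ε) k (S k ε + s + k * Real.pi), add_sub_cancel_right]

/-- A family of limit cycles that bifurcate from `C`, with the time shifted so that the limit
starts on the discontinuity. -/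
lemma BifurcatesFrom.exists_normalized {C : Set (Polar n)} (hC : C ⊆ polarDomain n) {T₀ : ℝ}
    {Γ : ℝ → Set (Phase n)} (h : BifurcatesFrom A b l C T₀ Γ) :
    ∃ a ∈ C, ∃ (M : ℕ) (x : ℝ → ℝ → Phase n) (T : ℝ → ℝ), 0 < M ∧
      (∀ᶠ ε in l, IsSolution A b ε (x ε) ∧ Function.Periodic (x ε) (T ε) ∧ range (x ε) = Γ ε) ∧
      Tendsto T l (𝓝 (2 * M * Real.pi)) ∧
      TendstoLocallyUniformly x (fun t => rot n t (polarMap (-(Real.pi / 2)) a)) l := by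
  obtain ⟨x₀, x, T, hx₀, ⟨a, haC, t₁, ht₁⟩, hx, hlim, hT⟩ := h
  have hrot : ∀ t, x₀ t = rot n (t - t₁) (polarMap 0 a) := fun t => by
    rw [hx₀.isSolution.eq_rot t₁ t, ht₁]
  -- Plane 0 has frequency 1 and positive radius, so a period of the limit satisfies cos T₀ = 1.
  obtain ⟨M, hM, hM'⟩ : ∃ M : ℕ, 0 < M ∧ T₀ = 2 * M * Real.pi := by
    have h1 := congrFun (hx₀.periodic t₁) (0, 0)
    rw [ht₁, hrot, ← polarMap_add, polarMap_zero_zero, polarMap_zero_zero] at h1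
    have h2 : Real.cos T₀ = 1 := by
      have := mul_left_cancel₀ (hC haC 0).ne' h1
      simpa using this
    obtain ⟨k, hk⟩ := (Real.cos_eq_one_iff _).1 h2
    have hk0 : 0 < k := by
      have := hx₀.period_pos
      rw [← hk] at this
      exact_mod_cast pos_of_mul_pos_left this Real.two_pi_pos.le
    lift k to ℕ using hk0.le
    exact ⟨k, by exact_mod_cast hk0, by rw [← hk]; push_cast; ring⟩
  -- The shift makes time 0 correspond to θ = -π/2, where x₁ = 0 and x₂ < 0.
  refine ⟨a, haC, M, fun ε t => x ε (t + (t₁ - Real.pi / 2)), T, hM, ?_, hM' ▸ hT, ?_⟩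
  · filter_upwards [hx] with ε h1
    refine ⟨h1.2.1.isSolution.comp_add_const _, h1.2.1.periodic.add_const _, ?_⟩
    rw [← h1.2.2]
    exact (Equiv.addRight (t₁ - Real.pi / 2)).surjective.range_comp (x ε)
  · have h1 := hlim.comp (fun t => t + (t₁ - Real.pi / 2)) (continuous_add_const _)
    have h2 : (fun t => rot n t (polarMap (-(Real.pi / 2)) a)) =
        x₀ ∘ fun t => t + (t₁ - Real.pi / 2) := by
      funext t
      simp only [Function.comp_apply]
      rw [hrot, ← polarMap_add, ← polarMap_add]
      ring_nf
    rw [h2]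
    exact h1

lemma section_coord {a : Polar n} (ha : a ∈ polarDomain n) :
    polarMap (-(Real.pi / 2)) a (0, 0) = 0 ∧ polarMap (-(Real.pi / 2)) a (1, 0) < 0 := by
  have h := blk_section a
  have h1 := congrArg Complex.re h
  have h2 := congrArg Complex.im h
  simp at h1 h2
  exact ⟨h1, by rw [h2]; linarith [ha 0]⟩

/-- At most one limit cycle bifurcates from a set on which the averaging conditions hold. -/
theorem eventually_eq_of_bifurcatesFrom {C : Set (Polar n)} (hC : AveragingConditions A b C)
    (hl : l ≤ 𝓝[≠] (0 : ℝ)) {T₁ T₂ : ℝ} {Γ₁ Γ₂ : ℝ → Set (Phase n)}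
    (h₁ : BifurcatesFrom A b l C T₁ Γ₁) (h₂ : BifurcatesFrom A b l C T₂ Γ₂) :
    ∀ᶠ ε in l, Γ₁ ε = Γ₂ ε := by
  rcases l.eq_or_neBot with rfl | hne
  · exact eventually_bot
  have hl' := hl.trans nhdsWithin_le_nhds
  obtain ⟨a₁, ha₁, M₁, x₁, P₁, hM₁, hx₁, hP₁, hlim₁⟩ := h₁.exists_normalized hC.subset_domain
  obtain ⟨a₂, ha₂, M₂, x₂, P₂, hM₂, hx₂, hP₂, hlim₂⟩ := h₂.exists_normalized hC.subset_domain
  obtain ⟨hs₁, hs₁'⟩ := section_coord (hC.subset_domain ha₁)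
  obtain ⟨hs₂, hs₂'⟩ := section_coord (hC.subset_domain ha₂)
  -- The limit periods may be different multiples of 2π. Passing to the common multiple 2πM₁M₂ gives
  -- both chains the same length.
  have hM : 0 < M₁ * M₂ := Nat.mul_pos hM₁ hM₂
  obtain ⟨ξ, τ, hξ, hrange₁⟩ := exists_crossingData hl' hM (T := fun ε => M₂ • P₁ ε)
    (hx₁.mono fun ε h => ⟨h.1, h.2.1.nsmul M₂⟩)
    (by
      have := hP₁.const_mul (M₂ : ℝ)
      simp only [nsmul_eq_mul]
      refine this.trans (le_of_eq ?_)
      push_cast; ring_nf) hlim₁ hs₁ hs₁'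
  obtain ⟨η, τ', hη, hrange₂⟩ := exists_crossingData hl' hM (T := fun ε => M₁ • P₂ ε)
    (hx₂.mono fun ε h => ⟨h.1, h.2.1.nsmul M₁⟩)
    (by
      have := hP₂.const_mul (M₁ : ℝ)
      simp only [nsmul_eq_mul]
      refine this.trans (le_of_eq ?_)
      push_cast; ring_nf) hlim₂ hs₂ hs₂'
  have hK : 0 < 2 * (M₁ * M₂) := by omega
  have e₁ : IsEquilibrium A b (polarMap (-(Real.pi / 2)) a₁) _ := hξ.halfAverage_eq hl hK hs₁'.ne
  have e₂ : IsEquilibrium A b (polarMap (-(Real.pi / 2)) a₂) _ := hη.halfAverage_eq hl hK hs₂'.ne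
  have hiso : ∀ᶠ z in 𝓝 a₁, z ≠ a₁ → averaged A b z ≠ 0 := by
    obtain ⟨U, hU, haU, -, hU', -⟩ := hC.zeros a₁ ha₁
      (averaged_eq_zero (hC.subset_domain ha₁) e₁)
    filter_upwards [hU.mem_nhds haU] with z hz
    exact hU' z (subset_closure hz)
  obtain ⟨c, d, hcd⟩ := exists_blk_halfAverage A b
  obtain ⟨hre, hnz⟩ := nondegenerate_of_isolated hcd (hC.subset_domain ha₁) hiso e₁
  have hpt := equilibrium_unique hcd e₁ e₂ hs₁ hs₂ hs₁'.ne hre hnz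
  -- Uniqueness of the equilibrium shows that both chains have the same limit, so they can be
  -- compared step by step.
  rw [← hpt] at hη
  have := hξ.eventually_eq hη hl hK hs₁'.ne
    fun Δ μ hΔ h => linearized_injective hcd hs₁ hs₁'.ne hre hnz Δ μ hΔ h
  filter_upwards [this, hx₁, hx₂, hrange₁, hrange₂] with ε h1 h2 h3 h4 h5
  rw [← h2.2.2, ← h3.2.2, h4, h5]
  exact orbitPieces_congr (fun k hk => h1.1 k hk.le) h1.2

end

end ControlCenter

/-! ### The example: averaged function and degree -/

namespace ControlCenter

noncomputable section

variable {n : ℕ}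

/-- A damping matrix for which every plane is a damped oscillator. -/
def dampingMatrix (n : ℕ) : SqMatrix n :=
  Matrix.diagonal fun p => if p.1 = 0 then -2 * freq p.2 else 0

/-- A forcing vector that excites every plane. -/
def forcingVector (n : ℕ) : Phase n :=
  fun p => if p.1 = 0 then (-1) ^ (p.2 : ℕ) * freq p.2 ^ 2 * (Real.pi / 2) else 0

lemma dampingMatrix_zero (x : Phase n) (j : Fin n) :
    (dampingMatrix n).mulVec x (0, j) = -2 * freq j * x (0, j) := by
  simp [dampingMatrix, Matrix.mulVec_diagonal]

lemma dampingMatrix_one (x : Phase n) (j : Fin n) : (dampingMatrix n).mulVec x (1, j) = 0 := by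
  simp [dampingMatrix, Matrix.mulVec_diagonal]

lemma blk_dampingMatrix (x : Phase n) (j : Fin n) :
    blk j ((dampingMatrix n).mulVec x) =
      -freq j * (blk j x + (starRingEnd ℂ) (blk j x)) := by
  rw [Complex.add_conj, blk_apply, dampingMatrix_zero, dampingMatrix_one, blk_re]
  push_cast
  ring

lemma blk_forcingVector (j : Fin n) :
    blk j (forcingVector n) = (-1) ^ (j : ℕ) * freq j ^ 2 * (Real.pi / 2) := by
  simp [blk_apply, forcingVector]

lemma exp_freq_pi (j : Fin n) : Complex.exp (freq j * Real.pi * Complex.I) = -1 := by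
  have h := blk_rot j Real.pi (emb j 1)
  rw [rot_pi, map_neg, blk_emb] at h
  simpa using h.symm

lemma exp_freq_pi_div_two (j : Fin n) :
    Complex.exp (freq j * (Real.pi / 2) * Complex.I) = (-1) ^ (j : ℕ) * Complex.I := by
  have h : (freq j * (Real.pi / 2) * Complex.I : ℂ) =
      (j : ℕ) * (Real.pi * Complex.I) + Real.pi / 2 * Complex.I := by
    simp only [freq]; push_cast; ring
  rw [h, Complex.exp_add, Complex.exp_nat_mul, Complex.exp_pi_mul_I, Complex.exp_pi_div_two_mul_I]

/-- In the rotating frame the conjugate part of the damping oscillates with frequency 2(2j+1) and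
averages out over [0, π], while the forcing contributes -2i/(2j+1) times its amplitude. -/
lemma blk_halfAverage_damping (v : Phase n) (j : Fin n) :
    blk j (halfAverage (dampingMatrix n) (forcingVector n) (v, 1)) =
      -freq j * Real.pi * blk j v - (-1) ^ (j : ℕ) * freq j * Real.pi * Complex.I := by
  set m : ℂ := ((freq j : ℝ) : ℂ) with hm
  have hm0 : m ≠ 0 := by rw [hm]; exact_mod_cast (freq_pos j).ne'
  set w := blk j v with hw
  set β : ℂ := blk j (forcingVector n) with hβ
  have hc : Continuous fun s : ℝ => rot n (-s) ((dampingMatrix n).mulVec (rot n s v) +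
      (1 : ℝ) • forcingVector n) := by
    have : Continuous fun s : ℝ => lin (dampingMatrix n) (rot n s v) := by fun_prop
    simp only [lin_apply] at this
    fun_prop
  have h1 := (blk j).intervalIntegral_comp_comm (μ := volume) (hc.intervalIntegrable 0 Real.pi)
  have hconj : ∀ s : ℝ, (starRingEnd ℂ) (Complex.exp (m * s * Complex.I) * w) =
      Complex.exp (-(m * s * Complex.I)) * (starRingEnd ℂ) w := fun s => by
    rw [map_mul, ← Complex.exp_conj]
    simp [hm]
  have hint : ∀ s : ℝ, blk j (rot n (-s) ((dampingMatrix n).mulVec (rot n s v) +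
      (1 : ℝ) • forcingVector n)) = -m * w - m * (starRingEnd ℂ) w * Complex.exp (-(2 * m * Complex.I) * s) +
      β * Complex.exp (-(m * Complex.I) * s) := fun s => by
    rw [blk_rot, map_add, map_smul, blk_dampingMatrix, blk_rot, ← hm, ← hw, hconj, ← hβ, one_smul]
    have e1 : Complex.exp (m * (-s : ℝ) * Complex.I) * Complex.exp (m * s * Complex.I) = 1 := by
      rw [← Complex.exp_add]; push_cast; ring_nf; simp
    have e2 : Complex.exp (m * (-s : ℝ) * Complex.I) * Complex.exp (-(m * s * Complex.I)) =
        Complex.exp (-(2 * m * Complex.I) * s) := by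
      rw [← Complex.exp_add]; push_cast; ring_nf
    have e3 : Complex.exp (m * (-s : ℝ) * Complex.I) = Complex.exp (-(m * Complex.I) * s) := by
      push_cast; ring_nf
    rw [← e3]
    linear_combination (-m * w) * e1 - m * (starRingEnd ℂ) w * e2
  have hexp : ∀ (c : ℂ) (s : ℝ), HasDerivAt (fun s : ℝ => Complex.exp (c * s))
      (c * Complex.exp (c * s)) s := fun c s => by
    have h2 : HasDerivAt (fun s : ℝ => c * (s : ℂ)) c s := by
      simpa using (hasDerivAt_id s).ofReal_comp.const_mul c
    simpa [mul_comm] using h2.cexp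
  have hF : ∀ s : ℝ, HasDerivAt (fun s : ℝ => -m * w * s -
      Complex.I / 2 * (starRingEnd ℂ) w * Complex.exp (-(2 * m * Complex.I) * s) +
      Complex.I * β / m * Complex.exp (-(m * Complex.I) * s))
      (-m * w - m * (starRingEnd ℂ) w * Complex.exp (-(2 * m * Complex.I) * s) +
      β * Complex.exp (-(m * Complex.I) * s)) s := fun s => by
    have h2 : HasDerivAt (fun s : ℝ => -m * w * (s : ℂ)) (-m * w) s := by
      simpa using (hasDerivAt_id s).ofReal_comp.const_mul (-m * w)
    refine ((h2.sub ((hexp _ s).const_mul _)).add ((hexp _ s).const_mul _)).congr_deriv ?_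
    field_simp
    ring_nf
    simp only [Complex.I_sq]
    ring
  rw [halfAverage, ← h1]
  simp only [hint]
  rw [intervalIntegral.integral_eq_sub_of_hasDerivAt (fun s _ => hF s)
    (Continuous.intervalIntegrable (by fun_prop) _ _)]
  have e1 : Complex.exp (-(m * Complex.I) * Real.pi) = -1 := by
    rw [show -(m * Complex.I) * Real.pi = -(m * Real.pi * Complex.I) by ring, Complex.exp_neg,
      exp_freq_pi]
    norm_num
  have e2 : Complex.exp (-(2 * m * Complex.I) * Real.pi) = 1 := by
    rw [show -(2 * m * Complex.I) * Real.pi =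
      -(m * Complex.I) * Real.pi + -(m * Complex.I) * Real.pi by ring, Complex.exp_add, e1]
    norm_num
  rw [e1, e2, hβ, blk_forcingVector, ← hm]
  simp
  field_simp
  ring

variable [NeZero n]

/-- The sign (-1)^j in the forcing cancels the one in exp((2j+1)πi/2), and its amplitude matches the
damping, so the zero sits at radius 1 and phase 0 in every plane. -/
lemma polarAverage_damping (z : Polar n) (j : Fin n) :
    polarAverage (dampingMatrix n) (forcingVector n) z j =
      2 * Real.pi * freq j * (Complex.exp (-(angle 0 z j * Complex.I)) - z.1 j) := by
  rw [polarAverage, map_smul, blk_rot, blk_halfAverage_damping, blk_polarMap, Complex.real_smul]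
  have h1 := angle_add 0 (-(Real.pi / 2)) z j
  rw [add_zero] at h1
  rw [h1]
  have e1 : Complex.exp (-(angle 0 z j * Complex.I)) *
      (Complex.exp (freq j * (Real.pi / 2) * Complex.I) *
      Complex.exp (((freq j * -(Real.pi / 2) + angle 0 z j : ℝ) : ℂ) * Complex.I)) = 1 := by
    rw [← Complex.exp_add, ← Complex.exp_add]; push_cast; ring_nf; simp
  have e2 := exp_freq_pi_div_two j
  have e3 : ((-1 : ℂ) ^ (j : ℕ)) * (-1) ^ (j : ℕ) = 1 := by rw [← mul_pow]; simp
  push_cast at e1 ⊢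
  rw [e2] at e1 ⊢
  linear_combination (-2 * freq j * Real.pi * z.1 j : ℂ) * e1 -
    (2 * freq j * Real.pi * Complex.exp (-(angle 0 z j * Complex.I)) : ℂ) * (Complex.I ^ 2 * e3 + Complex.I_sq)

/-- The averaged function of the damped system. -/
def dampedAverage (n : ℕ) [NeZero n] (z : Polar n) : Polar n :=
  (fun j => 2 * Real.pi * freq j * (Real.cos (angle 0 z j) - z.1 j),
    fun j : {j : Fin n // j ≠ 0} => -(2 * Real.pi * freq (j : Fin n)) * Real.sin (z.2 j) / z.1 j)

lemma averaged_damping {z : Polar n} (hz : 0 < z.1 0) :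
    averaged (dampingMatrix n) (forcingVector n) z = dampedAverage n z := by
  have hre : ∀ j, (polarAverage (dampingMatrix n) (forcingVector n) z j).re =
      2 * Real.pi * freq j * (Real.cos (angle 0 z j) - z.1 j) := fun j => by
    rw [polarAverage_damping, ← neg_mul, ← Complex.ofReal_neg,
      show (2 * Real.pi * freq j : ℂ) = ((2 * Real.pi * freq j : ℝ) : ℂ) by push_cast; ring,
      Complex.re_ofReal_mul, Complex.sub_re, Complex.exp_ofReal_mul_I_re]
    simp
  have him : ∀ j, (polarAverage (dampingMatrix n) (forcingVector n) z j).im =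
      -(2 * Real.pi * freq j) * Real.sin (angle 0 z j) := fun j => by
    rw [polarAverage_damping, ← neg_mul, ← Complex.ofReal_neg,
      show (2 * Real.pi * freq j : ℂ) = ((2 * Real.pi * freq j : ℝ) : ℂ) by push_cast; ring,
      Complex.im_ofReal_mul, Complex.sub_im, Complex.exp_ofReal_mul_I_im]
    simp
  rw [averaged_eq hz, dampedAverage]
  refine Prod.ext (funext fun j => hre j) (funext fun j => ?_)
  simp only [him]
  have h0 : angle 0 z 0 = 0 := by simp [angle]
  have hj : angle 0 z (j : Fin n) = z.2 j := by simp [angle, j.2]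
  rw [h0, hj]
  simp

/-- The polar variables of the orbit that persists. -/
def basePoint (n : ℕ) [NeZero n] : Polar n := (fun _ => 1, fun _ => 0)

/-- The set of polar variables from which the limit cycle bifurcates. -/
def baseBall (n : ℕ) [NeZero n] : Set (Polar n) := Metric.ball (basePoint n) (1 / 2)

lemma mem_closure_baseBall {z : Polar n} (hz : z ∈ closure (baseBall n)) :
    (∀ j, |z.1 j - 1| ≤ 1 / 2) ∧ ∀ j, |z.2 j| ≤ 1 / 2 := by
  have h := Metric.closure_ball_subset_closedBall hz
  rw [Metric.mem_closedBall, Prod.dist_eq, max_le_iff] at h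
  refine ⟨fun j => ?_, fun j => ?_⟩
  · simpa [basePoint, Real.dist_eq] using (dist_le_pi_dist z.1 (basePoint n).1 j).trans h.1
  · simpa [basePoint, Real.dist_eq] using (dist_le_pi_dist z.2 (basePoint n).2 j).trans h.2

lemma closure_baseBall_subset : closure (baseBall n) ⊆ polarDomain n := fun z hz j => by
  have := (abs_le.1 ((mem_closure_baseBall hz).1 j)).1
  linarith

/-- Phases are at most 1/2 < π in modulus, so sin θ_j = 0 forces θ_j = 0; the radial equation then
gives radius 1. -/
lemma dampedAverage_eq_zero {z : Polar n} (hz : z ∈ closure (baseBall n))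
    (h : dampedAverage n z = 0) : z = basePoint n := by
  have hpi := Real.pi_pos
  have h2 : ∀ j : {j : Fin n // j ≠ 0}, z.2 j = 0 := fun j => by
    have h3 := congrFun (congrArg Prod.snd h) j
    have h4 : Real.sin (z.2 j) = 0 := by
      have h5 := (freq_pos (j : Fin n)).ne'
      have h6 := (closure_baseBall_subset hz j).ne'
      simpa [dampedAverage, h5, h6, hpi.ne'] using h3
    have h5 := abs_le.1 ((mem_closure_baseBall hz).2 j)
    exact (Real.sin_eq_zero_iff_of_lt_of_lt (by linarith [Real.pi_gt_three])
      (by linarith [Real.pi_gt_three])).1 h4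
  refine Prod.ext (funext fun j => ?_) (funext h2)
  have h3 := congrFun (congrArg Prod.fst h) j
  have h4 : angle 0 z j = 0 := by
    by_cases hj : j = 0
    · simp [angle, hj]
    · simp [angle, hj, h2 ⟨j, hj⟩]
  have h5 := (freq_pos j).ne'
  have h6 : 1 - z.1 j = 0 := by simpa [dampedAverage, h4, h5, hpi.ne'] using h3
  simp only [basePoint]
  linarith

lemma dampedAverage_basePoint : dampedAverage n (basePoint n) = 0 := by
  refine Prod.ext (funext fun j => ?_) (funext fun j => ?_)
  · by_cases hj : j = 0 <;> simp [dampedAverage, basePoint, angle, hj]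
  · simp [dampedAverage, basePoint]

lemma contDiff_angle (j : Fin n) : ContDiff ℝ 1 fun z : Polar n => angle 0 z j := by
  by_cases hj : j = 0
  · simp only [angle, hj, dite_true]; exact contDiff_const
  · simp only [angle, hj, dite_false]
    exact contDiff_const.add ((contDiff_apply ℝ ℝ _).comp contDiff_snd)

lemma contDiffOn_dampedAverage : ContDiffOn ℝ 1 (dampedAverage n) (polarDomain n) := by
  have h1 : ∀ j, ContDiff ℝ 1 fun z : Polar n => z.1 j := fun j =>
    (contDiff_apply ℝ ℝ j).comp contDiff_fst
  have h2 : ∀ j, ContDiff ℝ 1 fun z : Polar n => z.2 j := fun j =>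
    (contDiff_apply ℝ ℝ j).comp contDiff_snd
  refine ContDiffOn.prodMk (contDiffOn_pi.2 fun j => ?_) (contDiffOn_pi.2 fun j => ?_)
  · exact (contDiff_const.mul ((contDiff_angle j).cos.sub (h1 j))).contDiffOn
  · exact (contDiff_const.mul (h2 j).sin).contDiffOn.div (h1 j).contDiffOn fun z hz => (hz j).ne'

/-- The derivative of the averaged function at its zero. -/
lemma hasFDerivAt_dampedAverage : ∃ D : Polar n →L[ℝ] Polar n,
    HasFDerivAt (dampedAverage n) D (basePoint n) ∧
    ∀ v, D v = (fun j => -(2 * Real.pi * freq j) * v.1 j,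
      fun j : {j : Fin n // j ≠ 0} => -(2 * Real.pi * freq (j : Fin n)) * v.2 j) := by
  set D₁ : Polar n →L[ℝ] (Fin n → ℝ) := ContinuousLinearMap.pi fun j =>
    (-(2 * Real.pi * freq j)) • (ContinuousLinearMap.proj j).comp (ContinuousLinearMap.fst ℝ _ _)
    with hD₁
  set D₂ : Polar n →L[ℝ] ({j : Fin n // j ≠ 0} → ℝ) := ContinuousLinearMap.pi fun j =>
    (-(2 * Real.pi * freq (j : Fin n))) • (ContinuousLinearMap.proj j).comp (ContinuousLinearMap.snd ℝ _ _)
    with hD₂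
  have h1 : ∀ j, HasFDerivAt (fun z : Polar n => z.1 j)
      ((ContinuousLinearMap.proj j).comp (ContinuousLinearMap.fst ℝ (Fin n → ℝ)
        ({j : Fin n // j ≠ 0} → ℝ))) (basePoint n) :=
    fun j => ((ContinuousLinearMap.proj (R := ℝ) (φ := fun _ => ℝ) j).comp
      (ContinuousLinearMap.fst ℝ (Fin n → ℝ) ({j : Fin n // j ≠ 0} → ℝ))).hasFDerivAt
  have h2 : ∀ j, HasFDerivAt (fun z : Polar n => z.2 j)
      ((ContinuousLinearMap.proj j).comp (ContinuousLinearMap.snd ℝ (Fin n → ℝ)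
        ({j : Fin n // j ≠ 0} → ℝ))) (basePoint n) :=
    fun j => ((ContinuousLinearMap.proj (R := ℝ) (φ := fun _ => ℝ) j).comp
      (ContinuousLinearMap.snd ℝ (Fin n → ℝ) ({j : Fin n // j ≠ 0} → ℝ))).hasFDerivAt
  have hangle : ∀ j, angle 0 (basePoint n) j = 0 := fun j => by
    by_cases hj : j = 0 <;> simp [basePoint, angle, hj]
  refine ⟨D₁.prod D₂, HasFDerivAt.prodMk (hasFDerivAt_pi.2 fun j => ?_)
    (hasFDerivAt_pi.2 fun j => ?_), fun v => rfl⟩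
  · have h3 := ((contDiff_angle j).differentiable one_ne_zero (basePoint n)).hasFDerivAt
    refine ((h3.cos.sub (h1 j)).const_mul (2 * Real.pi * freq j)).congr_fderiv ?_
    ext v <;> simp [hangle]
  · have h3 : HasFDerivAt (fun z : Polar n => (z.1 j)⁻¹) _ (basePoint n) :=
      HasDerivAt.comp_hasFDerivAt (h₂ := fun r : ℝ => r⁻¹) _ (hasDerivAt_inv one_ne_zero) (h1 j)
    refine (((h2 j).sin.const_mul (-(2 * Real.pi * freq (j : Fin n)))).mul h3).congr_fderiv ?_
    ext v <;> simp [basePoint]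

lemma averagingConditions_damping :
    AveragingConditions (dampingMatrix n) (forcingVector n) (baseBall n) := by
  have heq : EqOn (averaged (dampingMatrix n) (forcingVector n)) (dampedAverage n)
      (closure (baseBall n)) := fun z hz => averaged_damping (closure_baseBall_subset hz 0)
  have hbase : basePoint n ∈ baseBall n := Metric.mem_ball_self (by norm_num)
  have hopen : IsOpen (baseBall n) := Metric.isOpen_ball
  have hfr : ∀ w ∈ frontier (baseBall n), dampedAverage n w ≠ 0 := fun w hw h => by
    have := dampedAverage_eq_zero (frontier_subset_closure hw) h
    rw [hopen.frontier_eq] at hw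
    exact hw.2 (this ▸ hbase)
  refine ⟨hopen, Metric.isBounded_ball, subset_closure.trans closure_baseBall_subset, ?_⟩
  intro a ha haz
  have hab : a = basePoint n := dampedAverage_eq_zero (subset_closure ha)
    (by rw [← heq (subset_closure ha), haz])
  subst hab
  refine ⟨baseBall n, hopen, ha, Subset.rfl, fun z hz hne h => ?_, ?_⟩
  · exact hne (dampedAverage_eq_zero hz (by rw [← heq hz, h]))
  have hcont : ContinuousOn (dampedAverage n) (closure (baseBall n)) :=
    contDiffOn_dampedAverage.continuousOn.mono closure_baseBall_subset
  obtain ⟨D, hD, hDv⟩ := hasFDerivAt_dampedAverage (n := n)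
  have hdet : D.det ≠ 0 := by
    have hker : LinearMap.ker (D : Polar n →ₗ[ℝ] Polar n) = ⊥ := by
      rw [LinearMap.ker_eq_bot']
      intro v hv
      have hv' : D v = 0 := hv
      rw [hDv] at hv'
      have hpi := Real.pi_pos.ne'
      refine Prod.ext (funext fun j => ?_) (funext fun j => ?_)
      · have := congrFun (congrArg Prod.fst hv') j
        simpa [hpi, (freq_pos j).ne'] using this
      · have := congrFun (congrArg Prod.snd hv') j
        simpa [hpi, (freq_pos (j : Fin n)).ne'] using this
    exact fun h => (LinearMap.bot_lt_ker_of_det_eq_zero h).ne' hker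
  have hset : {z | z ∈ baseBall n ∧ dampedAverage n z = 0} = {basePoint n} := by
    ext z
    constructor
    · rintro ⟨h1, h2⟩
      exact dampedAverage_eq_zero (subset_closure h1) h2
    · rintro rfl
      exact ⟨hbase, dampedAverage_basePoint⟩
  -- The averaged function coincides with a smooth map having one regular zero in the ball; that map
  -- serves as its own approximation, and the degree is the sign of its Jacobian determinant.
  refine ⟨((SignType.sign D.det : SignType) : ℤ), ?_, hopen, Metric.isBounded_ball,
    hcont.congr heq, fun w hw h => hfr w hw (by rw [← heq (frontier_subset_closure hw), h]),
    dampedAverage n, contDiffOn_dampedAverage.mono (subset_closure.trans closure_baseBall_subset),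
    hcont, fun z hz w hw => ?_, fun z hz hz0 => ?_, ?_⟩
  · rcases lt_or_gt_of_ne hdet with h | h
    · simp [sign_neg h]
    · simp [sign_pos h]
  · rw [heq hz, sub_self, norm_zero, sub_zero, heq (frontier_subset_closure hw)]
    exact norm_pos_iff.2 (hfr w hw)
  · have : z = basePoint n := dampedAverage_eq_zero (subset_closure hz) hz0
    rw [this, hD.fderiv]
    exact hdet
  · rw [hset, finsum_mem_singleton, hD.fderiv]

end

end ControlCenter

/-! ### The example: explicit flow and fixed point of the half-return -/

namespace ControlCenter

noncomputable section

variable {n : ℕ} [NeZero n]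

section Extension

variable {A : SqMatrix n} {b : Phase n} {ε P : ℝ} {ξ : Phase n}

lemma neg_one_zpow_eq (k : ℤ) : (-1 : ℝ) ^ k = 1 ∨ (-1 : ℝ) ^ k = -1 := by
  rcases Int.even_or_odd k with h | h
  · exact Or.inl h.neg_one_zpow
  · exact Or.inr h.neg_one_zpow

/-- A piece of the affine flow between a point of the discontinuity and its antipode extends to an
antiperiodic solution. -/
lemma exists_antiperiodic_solution (hP : 0 < P) (hflip : flow A b ε ξ P = -ξ)
    (hpos : ∀ t ∈ Ioo 0 P, 0 < flow A b ε ξ t (0, 0)) :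
    ∃ g : ℝ → Phase n, IsSolution A b ε g ∧
      (∀ k : ℤ, ∀ t ∈ Icc (k * P) ((k + 1) * P), g t = (-1 : ℝ) ^ k • flow A b ε ξ (t - k * P)) ∧
      ∀ t, ∃ u ∈ Icc (-1 : ℝ) 1, HasDerivWithinAt g (field A ε (g t) + ε • u • b) (Ici t) t := by
  set f := flow A b ε ξ with hf
  set g : ℝ → Phase n := fun t => (-1 : ℝ) ^ ⌊t / P⌋ • f (t - ⌊t / P⌋ * P) with hg
  have hico : ∀ k : ℤ, ∀ t ∈ Ico (k * P) ((k + 1) * P), g t = (-1 : ℝ) ^ k • f (t - k * P) := by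
    intro k t ht
    have : ⌊t / P⌋ = k := by
      rw [Int.floor_eq_iff, le_div_iff₀ hP, div_lt_iff₀ hP]
      exact ht
    simp only [hg, this]
  have hicc : ∀ k : ℤ, ∀ t ∈ Icc (k * P) ((k + 1) * P), g t = (-1 : ℝ) ^ k • f (t - k * P) := by
    intro k t ht
    rcases ht.2.lt_or_eq with h | h
    · exact hico k t ⟨ht.1, h⟩
    -- At a common endpoint the two pieces agree because the flow arrives at the antipode of its
    -- starting point.
    · have h1 := hico (k + 1) t ⟨by push_cast; exact h.ge, by push_cast; linarith⟩
      rw [h1, h]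
      push_cast
      rw [sub_self, show (k + 1) * P - k * P = P by ring, hflip, show f 0 = ξ from flow_zero .., zpow_add_one₀ (by norm_num)]
      module
  have hfloor : ∀ t : ℝ, t ∈ Ico (⌊t / P⌋ * P) ((⌊t / P⌋ + 1) * P) := fun t => by
    constructor
    · rw [← le_div_iff₀ hP]; exact Int.floor_le _
    · rw [← div_lt_iff₀ hP]; exact Int.lt_floor_add_one _
  have hceil : ∀ t : ℝ, ∃ k : ℤ, t ∈ Ioc (k * P) ((k + 1) * P) := fun t => by
    refine ⟨⌈t / P⌉ - 1, ?_, ?_⟩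
    · rw [← lt_div_iff₀ hP]; push_cast; linarith [Int.ceil_lt_add_one (t / P)]
    · rw [← div_le_iff₀ hP]; push_cast; linarith [Int.le_ceil (t / P)]
  have hpiece : ∀ (k : ℤ) (t : ℝ), HasDerivAt (fun t => (-1 : ℝ) ^ k • f (t - k * P))
      (field A ε ((-1 : ℝ) ^ k • f (t - k * P)) + ε • (-1 : ℝ) ^ k • b) t := fun k t => by
    have h1 := ((hasDerivAt_flow A b ε ξ (t - k * P)).comp_sub_const t (k * P)).const_smul
      ((-1 : ℝ) ^ k)
    refine h1.congr_deriv ?_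
    rw [map_smul, smul_add, smul_comm _ ε]
  -- Right derivatives exist even at the crossing times, where the derivative may jump; they give
  -- the Lipschitz bound through the mean value inequality.
  have hright : ∀ t, HasDerivWithinAt g (field A ε (g t) + ε • (-1 : ℝ) ^ ⌊t / P⌋ • b) (Ici t) t := by
    intro t
    have ht := hfloor t
    have h1 : g =ᶠ[𝓝[≥] t] fun t' => (-1 : ℝ) ^ ⌊t / P⌋ • f (t' - ⌊t / P⌋ * P) := by
      filter_upwards [Ico_mem_nhdsGE ht.2] with t' ht'
      exact hico _ t' ⟨ht.1.trans ht'.1, ht'.2⟩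
    exact ((hpiece _ t).hasDerivWithinAt).congr_of_eventuallyEq h1 rfl
  have hcont : Continuous g := by
    refine continuous_iff_continuousAt.2 fun t => continuousAt_iff_continuous_left_right.2
      ⟨?_, (hright t).continuousWithinAt⟩
    obtain ⟨k, hk⟩ := hceil t
    have h1 : g =ᶠ[𝓝[≤] t] fun t' => (-1 : ℝ) ^ k • f (t' - k * P) := by
      filter_upwards [Ioc_mem_nhdsLE hk.1] with t' ht'
      exact hicc _ t' ⟨ht'.1.le, ht'.2.trans hk.2⟩
    exact ((hpiece k t).continuousAt.continuousWithinAt).congr_of_eventuallyEq h1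
      (hicc _ t ⟨hk.1.le, hk.2⟩)
  obtain ⟨C, hC⟩ := isCompact_Icc.exists_bound_of_continuousOn (s := Icc 0 P)
    (f := fun t => field A ε (f t) + ε • b)
    (((field A ε).continuous.comp (continuous_flow A b ε ξ)).add continuous_const).continuousOn
  have hbound : ∀ t, ‖field A ε (g t) + ε • (-1 : ℝ) ^ ⌊t / P⌋ • b‖ ≤ C := fun t => by
    have ht := hfloor t
    have h1 := hC (t - ⌊t / P⌋ * P) ⟨by linarith [ht.1], by linarith [ht.2]⟩
    simp only [hg]
    rw [map_smul, smul_comm ε, ← smul_add, norm_smul]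
    rcases neg_one_zpow_eq ⌊t / P⌋ with h | h <;> simpa [h] using h1
  have hLip : ∀ s t, s ≤ t → ‖g t - g s‖ ≤ C * (t - s) := fun s t hst =>
    norm_image_sub_le_of_norm_deriv_right_le_segment hcont.continuousOn
      (fun r _ => hright r) (fun r _ => hbound r) t ⟨hst, le_rfl⟩
  have hC0 : 0 ≤ C := (norm_nonneg _).trans (hbound 0)
  refine ⟨g, ⟨fun s t => ?_, ?_⟩, hicc, fun t => ⟨(-1 : ℝ) ^ ⌊t / P⌋, ?_, hright t⟩⟩
  · refine LipschitzOnWith.absolutelyContinuousOnInterval (K := ⟨C, hC0⟩) ?_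
    refine (LipschitzWith.of_dist_le_mul fun s t => ?_).lipschitzOnWith
    rw [dist_eq_norm, Real.dist_eq]
    change _ ≤ C * _
    rcases le_total s t with h | h
    · rw [norm_sub_rev, abs_sub_comm, abs_of_nonneg (sub_nonneg.2 h)]
      exact hLip s t h
    · rw [abs_of_nonneg (sub_nonneg.2 h)]
      exact hLip t s h
  -- The inclusion is checked off the countable set of crossing times kP, where the sign of x₁ is
  -- (-1)^k.
  · have hnull : ∀ᵐ t : ℝ, t ∉ range fun k : ℤ => k * P := (countable_range _).ae_notMem _
    filter_upwards [hnull] with t ht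
    have ht1 := hfloor t
    set k := ⌊t / P⌋ with hk
    have ht2 : t ∈ Ioo (k * P) ((k + 1) * P) :=
      ⟨lt_of_le_of_ne ht1.1 fun h => ht ⟨k, h⟩, ht1.2⟩
    have hgt := hico k t ht1
    have hfp := hpos (t - k * P) ⟨by linarith [ht2.1], by linarith [ht2.2]⟩
    refine ⟨(-1 : ℝ) ^ k, ⟨fun h => ?_, fun h => ?_, fun h => ?_⟩, ?_⟩
    · rcases neg_one_zpow_eq k with h1 | h1
      · rw [hgt, h1, one_smul] at h; linarith
      · exact h1
    · rcases neg_one_zpow_eq k with h1 | h1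
      · exact h1
      · rw [hgt, h1, neg_smul, one_smul, Pi.neg_apply] at h; linarith
    · rcases neg_one_zpow_eq k with h1 | h1 <;> rw [h1] <;> norm_num
    · have h1 : g =ᶠ[𝓝 t] fun t' => (-1 : ℝ) ^ k • f (t' - k * P) := by
        filter_upwards [Ioo_mem_nhds ht2.1 ht2.2] with t' ht'
        exact hico _ t' ⟨ht'.1.le, ht'.2⟩
      have h2 := (hpiece k t).congr_of_eventuallyEq h1
      rw [← hgt, field_apply] at h2
      exact h2
  · rcases neg_one_zpow_eq ⌊t / P⌋ with h | h <;> rw [h] <;> norm_num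

end Extension

section Oscillator

variable {ε : ℝ}

/-- The frequency of the damped oscillators. -/
def omega (ε : ℝ) : ℝ := Real.sqrt (1 - ε ^ 2)

/-- The time between two crossings. -/
def halfPeriod (ε : ℝ) : ℝ := Real.pi / omega ε

lemma omega_pos (hε : |ε| < 1) : 0 < omega ε :=
  Real.sqrt_pos.2 (by have := (sq_lt_one_iff_abs_lt_one ε).2 hε; linarith)

lemma omega_sq (hε : |ε| < 1) : omega ε ^ 2 = 1 - ε ^ 2 :=
  Real.sq_sqrt (by have := (sq_lt_one_iff_abs_lt_one ε).2 hε; linarith)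

lemma halfPeriod_pos (hε : |ε| < 1) : 0 < halfPeriod ε := div_pos Real.pi_pos (omega_pos hε)

/-- The height of the centers of the affine oscillators, for `ε = 1`. -/
def height (j : Fin n) : ℝ := (-1) ^ (j : ℕ) * freq j * (Real.pi / 2)

omit [NeZero n] in
lemma forcingVector_zero (j : Fin n) : forcingVector n (0, j) = freq j * height j := by
  simp [forcingVector, height]; ring

lemma height_zero : height (0 : Fin n) = Real.pi / 2 := by simp [height, freq]

/-- The explicit solution of the damped oscillators. -/
def oscillation (ε : ℝ) (ξ : Phase n) (t : ℝ) : Phase n := fun p =>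
  if p.1 = 0 then
    Real.exp (-(ε * freq p.2 * t)) * (ξ (0, p.2) * Real.cos (omega ε * freq p.2 * t) -
      (ε * ξ (0, p.2) + (ξ (1, p.2) - ε * height p.2)) / omega ε *
        Real.sin (omega ε * freq p.2 * t))
  else
    ε * height p.2 + Real.exp (-(ε * freq p.2 * t)) *
      ((ξ (1, p.2) - ε * height p.2) * Real.cos (omega ε * freq p.2 * t) +
      (ξ (0, p.2) + ε * (ξ (1, p.2) - ε * height p.2)) / omega ε *
        Real.sin (omega ε * freq p.2 * t))

omit [NeZero n] in
lemma flow_damping (hε : |ε| < 1) (ξ : Phase n) :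
    flow (dampingMatrix n) (forcingVector n) ε ξ = oscillation ε ξ := by
  have hω := (omega_pos hε).ne'
  have hω2 := omega_sq hε
  have h0 : oscillation ε ξ 0 = ξ := by
    ext ⟨i, j⟩
    fin_cases i <;> simp [oscillation]
  have key : ∀ t, HasDerivAt (oscillation ε ξ)
      (field (dampingMatrix n) ε (oscillation ε ξ t) + ε • forcingVector n) t := by
    intro t
    rw [field_apply]
    refine hasDerivAt_pi.2 fun p => ?_
    obtain ⟨i, j⟩ := p
    have he : HasDerivAt (fun t => Real.exp (-(ε * freq j * t)))
        (Real.exp (-(ε * freq j * t)) * (-(ε * freq j))) t := by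
      have := ((hasDerivAt_id t).const_mul (ε * freq j)).neg
      simpa using this.exp
    have hl : HasDerivAt (fun t => omega ε * freq j * t) (omega ε * freq j) t := by
      simpa using (hasDerivAt_id t).const_mul (omega ε * freq j)
    have hcos := hl.cos
    have hsin := hl.sin
    fin_cases i
    · have h1 := he.mul ((hcos.const_mul (ξ (0, j))).sub (hsin.const_mul
        ((ε * ξ (0, j) + (ξ (1, j) - ε * height j)) / omega ε)))
      refine h1.congr_deriv ?_
      simp only [Fin.zero_eta, Pi.add_apply, Pi.sub_apply, Pi.smul_apply, A₀_mulVec_zero, dampingMatrix_zero,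
        forcingVector_zero, smul_eq_mul, oscillation, one_ne_zero, if_false, if_true]
      field_simp
      ring_nf
      simp only [hω2]
      ring
    · have h1 := (he.mul ((hcos.const_mul (ξ (1, j) - ε * height j)).add (hsin.const_mul
        ((ξ (0, j) + ε * (ξ (1, j) - ε * height j)) / omega ε)))).const_add (ε * height j)
      refine h1.congr_deriv ?_
      have hb : forcingVector n (1, j) = 0 := by simp [forcingVector]
      simp only [Fin.mk_one, Pi.add_apply, Pi.smul_apply, A₀_mulVec_one, dampingMatrix_one,
        hb, smul_eq_mul, oscillation, if_true]
      field_simp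
      ring_nf
      simp only [hω2]
      ring
  have := eq_flow key
  rw [h0] at this
  exact this.symm

/-- The factor by which the distance to the fixed point changes during a half turn. -/
def multiplier (ε : ℝ) (j : Fin n) : ℝ := Real.exp (-(ε * freq j * halfPeriod ε))

omit [NeZero n] in
lemma multiplier_pow_ne_one (hε : |ε| < 1) (h0 : ε ≠ 0) (j : Fin n) {k : ℕ} (hk : 0 < k) :
    multiplier ε j ^ k ≠ 1 := by
  rw [multiplier, ← Real.exp_nat_mul, Ne, Real.exp_eq_one_iff]
  have h1 := (freq_pos j).ne'
  have h2 := (halfPeriod_pos hε).ne'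
  have h3 : (k : ℝ) ≠ 0 := by exact_mod_cast hk.ne'
  exact mul_ne_zero h3 (neg_ne_zero.2 (mul_ne_zero (mul_ne_zero h0 h1) h2))

/-- The crossing point of the limit cycle. -/
def fixedPoint (n : ℕ) (ε : ℝ) : Phase n := fun p =>
  if p.1 = 0 then 0 else -(ε * height p.2 * (1 + multiplier ε p.2) / (1 - multiplier ε p.2))

omit [NeZero n] in
-- At time π/ω plane j has turned by the odd multiple (2j+1)π, so its displacement from the center
-- is reversed and scaled by the exponential factor.
lemma flow_halfPeriod (hε : |ε| < 1) (h0 : ε ≠ 0) (ξ : Phase n) (p : Fin 2 × Fin n) :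
    -flow (dampingMatrix n) (forcingVector n) ε ξ (halfPeriod ε) p - fixedPoint n ε p =
      multiplier ε p.2 * (ξ p - fixedPoint n ε p) := by
  have hω := (omega_pos hε).ne'
  obtain ⟨i, j⟩ := p
  have h1 : omega ε * freq j * halfPeriod ε = freq j * Real.pi := by
    simp only [halfPeriod]; field_simp
  have hexp := exp_freq_pi j
  rw [← Complex.ofReal_mul] at hexp
  have hcos : Real.cos (freq j * Real.pi) = -1 := by
    rw [← Complex.exp_ofReal_mul_I_re, hexp]; simp
  have hsin : Real.sin (freq j * Real.pi) = 0 := by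
    rw [← Complex.exp_ofReal_mul_I_im, hexp]; simp
  have hm : 1 - multiplier ε j ≠ 0 := fun h => by
    refine multiplier_pow_ne_one hε h0 j one_pos ?_
    rw [pow_one]; linarith
  rw [flow_damping hε]
  fin_cases i
  · simp [oscillation, h1, hcos, hsin, fixedPoint, multiplier]
  · simp only [Fin.mk_one, oscillation, h1, hcos, hsin, fixedPoint, one_ne_zero, if_false]
    rw [← multiplier]
    field_simp
    ring

omit [NeZero n] in
lemma flow_fixedPoint (hε : |ε| < 1) (h0 : ε ≠ 0) :
    flow (dampingMatrix n) (forcingVector n) ε (fixedPoint n ε) (halfPeriod ε) =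
      -fixedPoint n ε := by
  funext p
  have := flow_halfPeriod hε h0 (fixedPoint n ε) p
  rw [sub_self, mul_zero] at this
  rw [Pi.neg_apply]
  linarith

/-- In plane 0 one has x₁ = e^(-εt) (επ/2 - ξ₂) ω⁻¹ sin ωt, and the condition on ξ₂ makes the
coefficient positive. -/
lemma flow_pos (hε : |ε| < 1) {ξ : Phase n} (h0 : ξ (0, 0) = 0)
    (h1 : |ε| * (Real.pi / 2) < -ξ (1, 0)) {t : ℝ} (ht : t ∈ Ioo 0 (halfPeriod ε)) :
    0 < flow (dampingMatrix n) (forcingVector n) ε ξ t (0, 0) := by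
  have hω := omega_pos hε
  rw [flow_damping hε]
  simp only [oscillation, if_true, h0, height_zero, freq_zero]
  have h2 : 0 < Real.sin (omega ε * 1 * t) := by
    refine Real.sin_pos_of_pos_of_lt_pi (by have := ht.1; positivity) ?_
    have := ht.2
    rw [halfPeriod, lt_div_iff₀ hω] at this
    linarith
  have h3 : 0 < -(ξ (1, 0) - ε * (Real.pi / 2)) := by
    have h4 : -(|ε| * (Real.pi / 2)) ≤ ε * (Real.pi / 2) := by
      rw [← neg_mul]
      exact mul_le_mul_of_nonneg_right (neg_abs_le ε) (by positivity)
    linarith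
  have h5 : 0 < Real.exp (-(ε * 1 * t)) * (-(ξ (1, 0) - ε * (Real.pi / 2)) / omega ε *
      Real.sin (omega ε * 1 * t)) := by positivity
  convert h5 using 1
  ring

/-- With Q the multiplier, (1 + Q)/(1 - Q) has the sign of ε and modulus greater than 1. -/
lemma fixedPoint_one_zero (hε : |ε| < 1) (h0 : ε ≠ 0) :
    |ε| * (Real.pi / 2) < -fixedPoint n ε (1, 0) := by
  have hP := halfPeriod_pos hε
  simp only [fixedPoint, one_ne_zero, if_false, neg_neg, height_zero]
  have hpos : 0 < multiplier ε (0 : Fin n) := Real.exp_pos _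
  set Q := multiplier ε (0 : Fin n) with hQ
  have hpi := Real.pi_pos
  rcases lt_or_gt_of_ne h0 with h | h
  · have h1 : 1 < Q := by
      rw [hQ, multiplier, Real.one_lt_exp_iff, freq_zero]
      nlinarith
    rw [abs_of_neg h, ← neg_div_neg_eq (ε * (Real.pi / 2) * (1 + Q)), lt_div_iff₀ (by linarith)]
    nlinarith [mul_pos (neg_pos.2 h) hpi]
  · have h1 : Q < 1 := by
      rw [hQ, multiplier, Real.exp_lt_one_iff, freq_zero]
      nlinarith
    rw [abs_of_pos h, lt_div_iff₀ (by linarith)]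
    nlinarith [mul_pos h hpi, mul_pos (mul_pos h hpi) hpos]

end Oscillator

end

end ControlCenter

/-! ### The example: isolation of the cycle -/

namespace ControlCenter

noncomputable section

variable {n : ℕ} [NeZero n] {ε : ℝ}

/-- A neighbourhood of the limit cycle whose points on the discontinuity are crossing points. -/
def crossingRegion (n : ℕ) [NeZero n] (ε : ℝ) : Set (Phase n) :=
  {x | x (0, 0) ≠ 0 ∨ |ε| * (Real.pi / 2) < |x (1, 0)|}

lemma isOpen_crossingRegion : IsOpen (crossingRegion n ε) :=
  (isOpen_ne_fun (continuous_apply (0, 0)) continuous_const).union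
    (isOpen_lt continuous_const (continuous_apply (1, 0)).abs)

lemma neg_mem_crossingRegion {x : Phase n} (h : x ∈ crossingRegion n ε) :
    -x ∈ crossingRegion n ε := by
  simpa [crossingRegion] using h

/-- Solutions in the crossing region that start at a crossing with `x₂ < 0`. -/
structure IsTransversal (ε : ℝ) (y : ℝ → Phase n) : Prop where
  isSolution : IsSolution (dampingMatrix n) (forcingVector n) ε y
  mem (t : ℝ) : y t ∈ crossingRegion n ε
  zero : y 0 (0, 0) = 0
  neg : y 0 (1, 0) < 0

omit [NeZero n] in
lemma fixedPoint_mul (hε : |ε| < 1) (h0 : ε ≠ 0) (j : Fin n) :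
    fixedPoint n ε (1, j) * (1 - multiplier ε j) = -(ε * height j * (1 + multiplier ε j)) := by
  have hm : 1 - multiplier ε j ≠ 0 := fun h => by
    refine multiplier_pow_ne_one hε h0 j one_pos ?_
    rw [pow_one]; linarith
  simp only [fixedPoint, one_ne_zero, if_false]
  field_simp

namespace IsTransversal

variable {y : ℝ → Phase n}

lemma lt_neg (hy : IsTransversal ε y) : |ε| * (Real.pi / 2) < -y 0 (1, 0) := by
  have := (hy.mem 0).resolve_left (not_not.2 hy.zero)
  rwa [abs_of_neg hy.neg] at this

/-- On x₁ = 0 the velocity of x₁ is -x₂ + εuπ/2 with |u| ≤ 1. The crossing region makes it positive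
for every admissible u, and a margin survives nearby by continuity. -/
lemma eventually_pos (hy : IsTransversal ε y) : ∃ δ > 0, ∀ t ∈ Ioo 0 δ, 0 < y t (0, 0) := by
  have hc := hy.isSolution.continuous
  set c := (-y 0 (1, 0) - |ε| * (Real.pi / 2)) / 2 with hcdef
  have hc0 : 0 < c := by have := hy.lt_neg; rw [hcdef]; linarith
  have hev : ∀ᶠ τ in 𝓝 (0 : ℝ), c + |ε| * (|-2 * y τ (0, 0)| + Real.pi / 2) < -y τ (1, 0) := by
    refine ContinuousAt.eventually_lt (by fun_prop) (by fun_prop) ?_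
    rw [hy.zero, mul_zero, abs_zero, zero_add, hcdef]
    have := hy.lt_neg
    linarith
  obtain ⟨δ, hδ, hball⟩ := Metric.eventually_nhds_iff.1 hev
  refine ⟨δ, hδ, fun t ht => ?_⟩
  have h1 := hy.isSolution.le_sub_coord (s := 0) (t := t) (c := c) ht.1.le fun τ hτ => by
    have h2 := hball (y := τ) (by
      rw [Real.dist_eq, sub_zero, abs_of_pos hτ.1]; exact hτ.2.trans ht.2)
    rw [dampingMatrix_zero, forcingVector_zero, height_zero, freq_zero, one_mul,
      abs_of_pos (a := Real.pi / 2) (by positivity)]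
    rw [mul_one]
    exact h2.le
  rw [hy.zero, sub_zero, sub_zero] at h1
  exact (mul_pos hc0 ht.1).trans_le h1

lemma pos (hy : IsTransversal ε y) (hε : |ε| < 1) {t : ℝ} (ht : t ∈ Ioo 0 (halfPeriod ε)) :
    0 < y t (0, 0) := by
  obtain ⟨δ, hδ, hpos⟩ := hy.eventually_pos
  by_contra hneg
  have hc : Continuous fun t => y t (0, 0) :=
    (continuous_apply (0, 0)).comp hy.isSolution.continuous
  have hδt : δ / 2 ≤ t := by
    by_contra h
    exact hneg (hpos t ⟨ht.1, by linarith⟩)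
  -- Before the first return `s` to x₁ ≤ 0 the solution follows the affine flow, whose x₁ is still
  -- positive at `s`: a contradiction.
  obtain ⟨s, hs, hmin⟩ : ∃ s, IsLeast (Icc (δ / 2) t ∩ {t | y t (0, 0) ≤ 0}) s :=
    (isCompact_Icc.inter_right (isClosed_le hc continuous_const)).exists_isLeast
      ⟨t, ⟨hδt, le_rfl⟩, not_lt.1 hneg⟩
  have hs0 : 0 < s := by linarith [hs.1.1]
  have h1 : ∀ τ ∈ Ioo 0 s, 0 < y τ (0, 0) := fun τ hτ => by
    by_contra h
    rcases lt_or_ge τ δ with h2 | h2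
    · exact h (hpos τ ⟨hτ.1, h2⟩)
    · exact absurd (hmin ⟨⟨by linarith, hτ.2.le.trans hs.1.2⟩, not_lt.1 h⟩) (not_le.2 hτ.2)
  have h2 := hy.isSolution.eq_flow h1 s ⟨hs0.le, le_rfl⟩
  have h3 := flow_pos hε hy.zero hy.lt_neg (t := s) ⟨hs0, hs.1.2.trans_lt ht.2⟩
  rw [sub_zero] at h2
  rw [← h2] at h3
  exact absurd h3 (not_lt.2 hs.2)

lemma eq_flow (hy : IsTransversal ε y) (hε : |ε| < 1) {t : ℝ} (ht : t ∈ Icc 0 (halfPeriod ε)) :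
    y t = flow (dampingMatrix n) (forcingVector n) ε (y 0) t := by
  have := hy.isSolution.eq_flow (fun τ hτ => hy.pos hε hτ) t ht
  rwa [sub_zero] at this

lemma neg_halfPeriod_sub (hy : IsTransversal ε y) (hε : |ε| < 1) (h0 : ε ≠ 0)
    (p : Fin 2 × Fin n) : -y (halfPeriod ε) p - fixedPoint n ε p =
      multiplier ε p.2 * (y 0 p - fixedPoint n ε p) := by
  rw [hy.eq_flow hε ⟨(halfPeriod_pos hε).le, le_rfl⟩]
  exact flow_halfPeriod hε h0 (y 0) p

lemma halfTurn (hy : IsTransversal ε y) (hε : |ε| < 1) (h0 : ε ≠ 0) :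
    IsTransversal ε fun t => -y (t + halfPeriod ε) := by
  have hz : y (halfPeriod ε) (0, 0) = 0 := by
    have := hy.neg_halfPeriod_sub hε h0 (0, 0)
    simp only [fixedPoint, if_true, hy.zero] at this
    linarith
  refine ⟨(hy.isSolution.comp_add_const _).neg, fun t => neg_mem_crossingRegion (hy.mem _), ?_, ?_⟩
  · simpa using hz
  · rw [zero_add, Pi.neg_apply, neg_lt_zero]
    have h1 := (hy.mem (halfPeriod ε)).resolve_left (not_not.2 hz)
    have h2 := hy.neg_halfPeriod_sub hε h0 (1, 0)
    have h3 := fixedPoint_mul hε h0 (0 : Fin n)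
    rw [height_zero] at h3
    have h4 := hy.lt_neg
    have h5 : 0 < multiplier ε (0 : Fin n) := Real.exp_pos _
    have h6 : -(|ε| * (Real.pi / 2)) ≤ ε * (Real.pi / 2) := by
      rw [← neg_mul]
      exact mul_le_mul_of_nonneg_right (neg_abs_le ε) (by positivity)
    have h7 : 0 < multiplier ε (0 : Fin n) * (-y 0 (1, 0) + ε * (Real.pi / 2)) :=
      mul_pos h5 (by linarith)
    -- The half-return formula gives y₂(P) = Q(επ/2 - y₂(0)) + επ/2 > -|ε|π/2, whereas a
    -- non-positive value in the crossing region would lie below -|ε|π/2.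
    by_contra h8
    rw [abs_of_nonpos (not_lt.1 h8)] at h1
    simp only at h2
    linarith

lemma halfTurns (hy : IsTransversal ε y) (hε : |ε| < 1) (h0 : ε ≠ 0) (k : ℕ) :
    IsTransversal ε (halfTurns (halfPeriod ε) y k) ∧ ∀ p,
      ControlCenter.halfTurns (halfPeriod ε) y k 0 p - fixedPoint n ε p =
        multiplier ε p.2 ^ k * (y 0 p - fixedPoint n ε p) := by
  induction k with
  | zero => rw [halfTurns_zero]; exact ⟨hy, fun p => by simp⟩
  | succ k ih =>
    rw [halfTurns_succ]
    refine ⟨ih.1.halfTurn hε h0, fun p => ?_⟩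
    simp only [zero_add, Pi.neg_apply]
    rw [ih.1.neg_halfPeriod_sub hε h0 p, ih.2 p]
    ring

end IsTransversal

/-- The limit cycle. -/
def cycle (n : ℕ) [NeZero n] (ε : ℝ) : Set (Phase n) :=
  {p | ∃ t ∈ Icc 0 (halfPeriod ε),
    p = flow (dampingMatrix n) (forcingVector n) ε (fixedPoint n ε) t ∨
    p = -flow (dampingMatrix n) (forcingVector n) ε (fixedPoint n ε) t}

lemma exists_nat_mul_add {P t : ℝ} (hP : 0 < P) (ht : 0 ≤ t) :
    ∃ k : ℕ, t - k * P ∈ Ico 0 P := by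
  refine ⟨⌊t / P⌋₊, ?_, ?_⟩
  · rw [sub_nonneg, ← le_div_iff₀ hP]; exact Nat.floor_le (by positivity)
  · have := Nat.lt_floor_add_one (t / P)
    rw [div_lt_iff₀ hP] at this
    linarith

namespace IsTransversal

variable {y : ℝ → Phase n} {T : ℝ}

/-- A period must be kP, as x₁ ≠ 0 between crossings, and k is even by the sign of x₂. The deviation
from the fixed point is then multiplied by a power different from 1 in every plane, hence is zero.
-/
lemma eq_fixedPoint (hy : IsTransversal ε y) (hε : |ε| < 1) (h0 : ε ≠ 0) (hT : 0 < T)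
    (hper : Function.Periodic y T) : y 0 = fixedPoint n ε := by
  have hP := halfPeriod_pos hε
  obtain ⟨k, hk⟩ := exists_nat_mul_add hP hT.le
  obtain ⟨hk1, hk2⟩ := hy.halfTurns hε h0 k
  have hyT : y T = y 0 := by simpa using hper 0
  have h1 := smul_halfTurns (halfPeriod ε) y k T
  have hTk : T - k * halfPeriod ε = 0 := by
    by_contra h
    have h2 := hk1.pos hε ⟨lt_of_le_of_ne hk.1 (Ne.symm h), hk.2⟩
    have h3 := congrFun h1 (0, 0)
    rw [hyT, hy.zero, Pi.smul_apply, smul_eq_mul] at h3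
    exact (mul_ne_zero (pow_ne_zero k (by norm_num)) h2.ne') h3
  rw [hTk, hyT] at h1
  have hk0 : 0 < k := Nat.pos_of_ne_zero fun h => by subst h; simp at hTk; linarith
  have hsign : (-1 : ℝ) ^ k = 1 := by
    refine (neg_one_pow_eq_or ℝ k).resolve_right fun h => ?_
    rw [h] at h1
    have h2 := congrFun h1 (1, 0)
    simp only [Pi.smul_apply, smul_eq_mul] at h2
    linarith [hk1.neg, hy.neg]
  rw [hsign, one_smul] at h1
  funext p
  have h2 := hk2 p
  rw [h1] at h2
  have h3 : (multiplier ε p.2 ^ k - 1) * (y 0 p - fixedPoint n ε p) = 0 := by linarith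
  exact sub_eq_zero.1
    ((mul_eq_zero.1 h3).resolve_left (sub_ne_zero.2 (multiplier_pow_ne_one hε h0 _ hk0)))

lemma range_eq_cycle (hy : IsTransversal ε y) (hε : |ε| < 1) (h0 : ε ≠ 0) (hT : 0 < T)
    (hper : Function.Periodic y T) : range y = cycle n ε := by
  have hP := halfPeriod_pos hε
  have hfix := hy.eq_fixedPoint hε h0 hT hper
  have hflow : ∀ k : ℕ, ∀ s ∈ Icc 0 (halfPeriod ε), y (s + k * halfPeriod ε) =
      (-1 : ℝ) ^ k • flow (dampingMatrix n) (forcingVector n) ε (fixedPoint n ε) s := by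
    intro k s hs
    obtain ⟨hk1, hk2⟩ := hy.halfTurns hε h0 k
    have h1 : ControlCenter.halfTurns (halfPeriod ε) y k 0 = fixedPoint n ε := by
      funext p
      have := hk2 p
      rw [hfix, sub_self, mul_zero] at this
      exact sub_eq_zero.1 this
    rw [← h1, ← hk1.eq_flow hε hs, ← smul_halfTurns (halfPeriod ε) y k, add_sub_cancel_right]
  refine Subset.antisymm ?_ ?_
  · rintro _ ⟨t, rfl⟩
    obtain ⟨t', ht', heq⟩ := hper.exists_mem_Ico₀ hT t
    obtain ⟨k, hk⟩ := exists_nat_mul_add hP ht'.1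
    refine ⟨_, Ico_subset_Icc_self hk, ?_⟩
    have h1 := hflow k _ (Ico_subset_Icc_self hk)
    rw [sub_add_cancel, ← heq] at h1
    rcases neg_one_pow_eq_or ℝ k with h | h
    · exact Or.inl (by rw [h1, h, one_smul])
    · exact Or.inr (by rw [h1, h, neg_smul, one_smul])
  · rintro p ⟨s, hs, rfl | rfl⟩
    · exact ⟨s, by simpa using hflow 0 s hs⟩
    · exact ⟨s + halfPeriod ε, by simpa using hflow 1 s hs⟩

end IsTransversal

/-- A solution in the crossing region cannot stay on one side of the discontinuity. -/
lemma exists_coord_nonpos {y : ℝ → Phase n} (hε : |ε| < 1) (h0 : ε ≠ 0)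
    (hy : IsSolution (dampingMatrix n) (forcingVector n) ε y) : ∃ t, y t (0, 0) ≤ 0 := by
  by_contra! h
  have h1 := hy.eq_flow (fun τ _ => h τ) (halfPeriod ε) ⟨(halfPeriod_pos hε).le, le_rfl⟩
  have h2 := flow_halfPeriod hε h0 (y 0) (0, 0)
  rw [sub_zero] at h1
  rw [← h1] at h2
  simp only [fixedPoint, if_true, sub_zero] at h2
  have h3 : 0 < multiplier ε (0 : Fin n) * y 0 (0, 0) := mul_pos (Real.exp_pos _) (h 0)
  linarith [h (halfPeriod ε)]

lemma exists_isTransversal {y : ℝ → Phase n} (hε : |ε| < 1) (h0 : ε ≠ 0)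
    (hy : IsSolution (dampingMatrix n) (forcingVector n) ε y)
    (hmem : ∀ t, y t ∈ crossingRegion n ε) : ∃ c, IsTransversal ε fun t => y (t + c) := by
  have hc : Continuous fun t => y t (0, 0) := (continuous_apply (0, 0)).comp hy.continuous
  obtain ⟨c, hc0⟩ : ∃ c, y c (0, 0) = 0 := by
    obtain ⟨s, hs⟩ := exists_coord_nonpos hε h0 hy
    obtain ⟨t, ht⟩ := exists_coord_nonpos hε h0 hy.neg
    simp only [Pi.neg_apply, Left.neg_nonpos_iff] at ht
    exact mem_range_of_exists_le_of_exists_ge hc ⟨s, hs⟩ ⟨t, ht⟩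
  rcases lt_trichotomy (y c (1, 0)) 0 with h | h | h
  · exact ⟨c, hy.comp_add_const c, fun t => hmem _, by simpa using hc0, by simpa using h⟩
  · have h1 := (hmem c).resolve_left (not_not.2 hc0)
    rw [h, abs_zero] at h1
    exact absurd h1 (not_lt.2 (by positivity))
  -- A crossing with x₂ > 0 is transversal for -y; the reflected half turn of -y is `y` itself,
  -- started half a period later.
  · have h1 : IsTransversal ε fun t => -y (t + c) :=
      ⟨(hy.comp_add_const c).neg, fun t => neg_mem_crossingRegion (hmem _), by simpa using hc0,
        by simpa using h⟩
    have h2 := h1.halfTurn hε h0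
    simp only [neg_neg, add_assoc] at h2
    exact ⟨_, h2⟩

lemma eq_cycle_of_isPeriodicOrbit {Γ : Set (Phase n)} (hε : |ε| < 1) (h0 : ε ≠ 0)
    (hΓ : IsPeriodicOrbit (dampingMatrix n) (forcingVector n) ε Γ) (hsub : Γ ⊆ crossingRegion n ε) :
    Γ = cycle n ε := by
  obtain ⟨T, y, hy, rfl⟩ := hΓ
  obtain ⟨c, hc⟩ := exists_isTransversal hε h0 hy.isSolution fun t => hsub (mem_range_self t)
  rw [← hc.range_eq_cycle hε h0 hy.period_pos fun t => ?_]
  swap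
  · rw [add_right_comm]; exact hy.periodic _
  exact ((Equiv.addRight c).surjective.range_comp y).symm

/-- The limit cycle of the damped oscillators, with the data for the passage to the limit. -/
lemma exists_cycle_solution (hε : |ε| < 1) (h0 : ε ≠ 0) :
    ∃ g : ℝ → Phase n,
      IsPeriodicSolution (dampingMatrix n) (forcingVector n) ε (2 * halfPeriod ε) g ∧
      range g = cycle n ε ∧ IsLimitCycle (dampingMatrix n) (forcingVector n) ε (cycle n ε) ∧
      g 0 = fixedPoint n ε ∧
      ∀ t, ∃ u ∈ Icc (-1 : ℝ) 1, HasDerivWithinAt g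
        (field (dampingMatrix n) ε (g t) + ε • u • forcingVector n) (Ici t) t := by
  have hP := halfPeriod_pos hε
  have h1z := fixedPoint_one_zero (n := n) hε h0
  have hz : fixedPoint n ε (0, 0) = 0 := by simp [fixedPoint]
  have hpos : ∀ t ∈ Ioo 0 (halfPeriod ε),
      0 < flow (dampingMatrix n) (forcingVector n) ε (fixedPoint n ε) t (0, 0) := fun t ht =>
    flow_pos hε hz h1z ht
  have hflip := flow_fixedPoint (n := n) hε h0
  obtain ⟨g, hg, hgflow, hgd⟩ := exists_antiperiodic_solution hP hflip hpos
  have hfloor : ∀ t, ∃ k : ℤ, t ∈ Icc (k * halfPeriod ε) ((k + 1) * halfPeriod ε) := fun t => by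
    refine ⟨⌊t / halfPeriod ε⌋, ?_, ?_⟩
    · rw [← le_div_iff₀ hP]; exact Int.floor_le _
    · rw [← div_le_iff₀ hP]; exact (Int.lt_floor_add_one _).le
  have hg0 : g 0 = fixedPoint n ε := by
    have := hgflow 0 0 ⟨by simp, by simpa using hP.le⟩
    simpa using this
  have hanti : ∀ t, g (t + halfPeriod ε) = -g t := fun t => by
    obtain ⟨k, hk⟩ := hfloor t
    rw [hgflow k t hk, hgflow (k + 1) (t + halfPeriod ε)
      ⟨by push_cast; linarith [hk.1], by push_cast; linarith [hk.2]⟩, zpow_add_one₀ (by norm_num)]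
    push_cast
    rw [show t + halfPeriod ε - (k + 1) * halfPeriod ε = t - k * halfPeriod ε by ring]
    simp
  have hper : Function.Periodic g (2 * halfPeriod ε) := fun t => by
    rw [two_mul, ← add_assoc, hanti, hanti, neg_neg]
  have hperiodic : IsPeriodicSolution (dampingMatrix n) (forcingVector n) ε (2 * halfPeriod ε) g := by
    refine ⟨hg, by positivity, hper, 0 + halfPeriod ε, 0, fun h => ?_⟩
    rw [hanti, hg0] at h
    have := congrFun h (1, 0)
    rw [Pi.neg_apply] at this
    have h3 : 0 ≤ |ε| * (Real.pi / 2) := by positivity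
    linarith
  have hmem : ∀ t, g t ∈ crossingRegion n ε := fun t => by
    obtain ⟨k, hk⟩ := hfloor t
    have hflow : flow (dampingMatrix n) (forcingVector n) ε (fixedPoint n ε)
        (t - k * halfPeriod ε) ∈ crossingRegion n ε := by
      have hfix : fixedPoint n ε ∈ crossingRegion n ε := Or.inr (h1z.trans_le (neg_le_abs _))
      rcases eq_or_lt_of_le (sub_nonneg.2 hk.1) with h | h
      · rw [← h, flow_zero]; exact hfix
      · rcases eq_or_lt_of_le (show t - k * halfPeriod ε ≤ halfPeriod ε by linarith [hk.2])
          with h' | h'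
        · rw [h', hflip]; exact neg_mem_crossingRegion hfix
        · exact Or.inl (hpos _ ⟨h, h'⟩).ne'
    rw [hgflow k t hk]
    rcases neg_one_zpow_eq k with h | h
    · rwa [h, one_smul]
    · rw [h, neg_smul, one_smul]; exact neg_mem_crossingRegion hflow
  have htrans : IsTransversal ε g := by
    refine ⟨hg, hmem, by rw [hg0, hz], ?_⟩
    rw [hg0]
    have h3 : 0 ≤ |ε| * (Real.pi / 2) := by positivity
    linarith
  have hrange := htrans.range_eq_cycle hε h0 (by positivity) hper
  refine ⟨g, hperiodic, hrange, ⟨⟨_, g, hperiodic, hrange⟩, crossingRegion n ε,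
    isOpen_crossingRegion, ?_, fun Γ' h1 h2 => eq_cycle_of_isPeriodicOrbit hε h0 h1 h2⟩, hg0, hgd⟩
  rw [← hrange]
  rintro _ ⟨t, rfl⟩
  exact hmem t

end

end ControlCenter

/-! ### The example: passage to the limit -/

namespace ControlCenter

noncomputable section

variable {n : ℕ}

lemma norm_rot_le (t : ℝ) (x : Phase n) : ‖rot n t x‖ ≤ 2 * ‖x‖ := by
  have key : ∀ c s v w : ℝ, |c| ≤ 1 → |s| ≤ 1 → |v| ≤ ‖x‖ → |w| ≤ ‖x‖ →
      |c * v| + |s * w| ≤ 2 * ‖x‖ := fun c s v w hc hs hv hw => by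
    rw [abs_mul, abs_mul]
    nlinarith [abs_nonneg c, abs_nonneg s, abs_nonneg v, abs_nonneg w]
  refine (pi_norm_le_iff_of_nonneg (by positivity)).2 fun p => ?_
  have hx : ∀ p, |x p| ≤ ‖x‖ := fun p => norm_le_pi_norm x p
  obtain ⟨i, j⟩ := p
  rw [Real.norm_eq_abs]
  have hcos := Real.abs_cos_le_one (freq j * t)
  have hsin := Real.abs_sin_le_one (freq j * t)
  fin_cases i
  · simp only [Fin.zero_eta, rot_apply_zero]
    exact (abs_sub _ _).trans (key _ _ _ _ hcos hsin (hx _) (hx _))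
  · simp only [Fin.mk_one, rot_apply_one]
    exact (abs_add_le _ _).trans (key _ _ _ _ hcos hsin (hx _) (hx _))

/-- Deviation of a bounded solution from the flow of the linear center. -/
lemma norm_sub_rot_le [NeZero n] {A : SqMatrix n} {b : Phase n} {ε C : ℝ} {g : ℝ → Phase n}
    (hg : Continuous g) (hC : ∀ t, ‖g t‖ ≤ C)
    (hd : ∀ t, ∃ u ∈ Icc (-1 : ℝ) 1, HasDerivWithinAt g (field A ε (g t) + ε • u • b) (Ici t) t)
    (t : ℝ) : ‖g t - rot n t (g 0)‖ ≤ 4 * (|ε| * (‖lin A‖ * C + ‖b‖)) * |t| := by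
  choose u hu hd using hd
  -- In the rotating frame only the perturbation of size O(ε) drives the motion; the factor 4 comes
  -- from two rotations, each costing 2 in the sup norm.
  set w : ℝ → Phase n := fun t => rot n (-t) (g t) with hw
  have hwc : Continuous w := by fun_prop
  have hwd : ∀ t, HasDerivWithinAt w (rot n (-t) (ε • (A.mulVec (g t) + u t • b))) (Ici t) t := by
    intro t
    have h1 : HasDerivAt (fun t => rot n (-t)) ((-1 : ℝ) • (lin (A₀ n) * rot n (-t))) t :=
      (hasDerivAt_rot (n := n) (-t)).scomp t (hasDerivAt_neg t)
    refine (h1.hasDerivWithinAt.clm_apply (hd t)).congr_deriv ?_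
    rw [field_apply, map_add, rot_A₀]
    simp
  have hbound : ∀ t, ‖rot n (-t) (ε • (A.mulVec (g t) + u t • b))‖ ≤
      2 * (|ε| * (‖lin A‖ * C + ‖b‖)) := fun t => by
    refine (norm_rot_le _ _).trans ?_
    rw [norm_smul, Real.norm_eq_abs]
    have h1 : ‖A.mulVec (g t)‖ ≤ ‖lin A‖ * C :=
      ((lin A).le_opNorm (g t)).trans (by gcongr; exact hC t)
    have h2 : ‖u t • b‖ ≤ ‖b‖ := by
      rw [norm_smul, Real.norm_eq_abs]
      exact mul_le_of_le_one_left (norm_nonneg b) (abs_le.2 (hu t))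
    gcongr
    exact norm_add_le_of_le h1 h2
  have hw1 : ∀ s t, s ≤ t → ‖w t - w s‖ ≤ 2 * (|ε| * (‖lin A‖ * C + ‖b‖)) * (t - s) :=
    fun s t hst => norm_image_sub_le_of_norm_deriv_right_le_segment hwc.continuousOn
      (fun r _ => hwd r) (fun r _ => hbound r) t ⟨hst, le_rfl⟩
  have hw2 : ‖w t - w 0‖ ≤ 2 * (|ε| * (‖lin A‖ * C + ‖b‖)) * |t| := by
    rcases le_total 0 t with h | h
    · simpa [abs_of_nonneg h] using hw1 0 t h
    · rw [norm_sub_rev]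
      simpa [abs_of_nonpos h] using hw1 t 0 h
  have h3 : g t - rot n t (g 0) = rot n t (w t - w 0) := by
    simp only [hw, map_sub, ← rot_add]
    simp
  rw [h3]
  refine (norm_rot_le _ _).trans ?_
  linarith

/-- The limit of the crossing points. -/
def startPoint (n : ℕ) [NeZero n] : Phase n := polarMap (-(Real.pi / 2)) (basePoint n)

lemma differentiableAt_halfPeriod : DifferentiableAt ℝ halfPeriod 0 := by
  unfold halfPeriod omega
  refine (differentiableAt_const _).div (DifferentiableAt.sqrt (by fun_prop) (by simp)) (by simp)

lemma halfPeriod_zero : halfPeriod 0 = Real.pi := by simp [halfPeriod, omega]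

lemma hasDerivAt_multiplier (j : Fin n) :
    HasDerivAt (fun ε => multiplier ε j) (-(freq j * Real.pi)) 0 := by
  have h := ((((hasDerivAt_id (0 : ℝ)).mul_const (freq j)).mul
    differentiableAt_halfPeriod.hasDerivAt).neg).exp
  refine h.congr_deriv ?_
  simp [halfPeriod_zero]

/-- The quotient ε/(1 - Q) is of the form 0/0, and the slope of the multiplier Q at ε = 0 gives its
limit 1/((2j+1)π). -/
lemma tendsto_fixedPoint [NeZero n] :
    Tendsto (fixedPoint n) (𝓝[≠] 0) (𝓝 (startPoint n)) := by
  refine tendsto_pi_nhds.2 fun ⟨i, j⟩ => ?_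
  have hexp := exp_freq_pi_div_two j
  have hcast : (freq j * (Real.pi / 2) * Complex.I : ℂ) =
      ((freq j * (Real.pi / 2) : ℝ) : ℂ) * Complex.I := by push_cast; ring
  rw [hcast] at hexp
  have hsgn : ((-1 : ℂ)) ^ (j : ℕ) = (((-1 : ℝ) ^ (j : ℕ) : ℝ) : ℂ) := by push_cast; rfl
  have hcos : Real.cos (freq j * (Real.pi / 2)) = 0 := by
    rw [← Complex.exp_ofReal_mul_I_re, hexp, hsgn, Complex.re_ofReal_mul]; simp
  have hsin : Real.sin (freq j * (Real.pi / 2)) = (-1) ^ (j : ℕ) := by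
    rw [← Complex.exp_ofReal_mul_I_im, hexp, hsgn, Complex.im_ofReal_mul]; simp
  have hangle : angle (-(Real.pi / 2)) (basePoint n) j = -(freq j * (Real.pi / 2)) := by
    simp [angle, basePoint, freq]
  fin_cases i
  · simp [fixedPoint, startPoint, polarMap, hangle, hcos]
  · have h1 : Tendsto (fun ε => multiplier ε j) (𝓝[≠] 0) (𝓝 1) := by
      have := (hasDerivAt_multiplier j).continuousAt.tendsto.mono_left (nhdsWithin_le_nhds (s := {0}ᶜ))
      simpa [multiplier] using this
    have h2 := (hasDerivAt_multiplier j).tendsto_slope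
    have hf := (freq_pos j).ne'
    have hpi := Real.pi_ne_zero
    have h3 := (((h1.const_add 1).mul_const (height j)).mul (h2.inv₀ (by
      exact neg_ne_zero.2 (mul_ne_zero hf hpi))))
    have hval : startPoint n (1, j) = (1 + 1) * height j * (-(freq j * Real.pi))⁻¹ := by
      simp only [startPoint, polarMap, one_ne_zero, if_false, hangle, Real.sin_neg, hsin]
      simp only [basePoint, height]
      field_simp
      norm_num
    simp only [Fin.mk_one]
    rw [hval]
    refine h3.congr' ?_
    filter_upwards [self_mem_nhdsWithin] with ε hε
    have hm0 : multiplier 0 j = 1 := by simp [multiplier]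
    rw [slope_def_field, hm0, sub_zero, inv_div, fixedPoint, if_neg one_ne_zero,
      ← neg_sub (multiplier ε j) 1, div_neg, neg_neg]
    ring

lemma tendsto_halfPeriod : Tendsto halfPeriod (𝓝[≠] 0) (𝓝 Real.pi) := by
  have := differentiableAt_halfPeriod.continuousAt.tendsto.mono_left (nhdsWithin_le_nhds (s := {0}ᶜ))
  rwa [halfPeriod_zero] at this

/-- The limit cycles stay in a bounded set. -/
lemma exists_bound_cycle [NeZero n] :
    ∃ C, ∀ᶠ ε in 𝓝[≠] (0 : ℝ), ∀ p ∈ cycle n ε, ‖p‖ ≤ C := by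
  have hc : Continuous fun q : ℝ × Phase n × ℝ =>
      flow (dampingMatrix n) (forcingVector n) q.1 q.2.1 q.2.2 := by
    unfold flow flowMap
    have := continuous_exp_clm (E := Phase n × ℝ)
    fun_prop
  -- Eventually the parameter, the starting point and the flight time lie in this compact set,
  -- because the half period tends to π < 4.
  have hK : IsCompact (Icc (-1 : ℝ) 1 ×ˢ Metric.closedBall (startPoint n) 1 ×ˢ Icc (0 : ℝ) 4) :=
    isCompact_Icc.prod ((isCompact_closedBall _ _).prod isCompact_Icc)
  obtain ⟨C, hC⟩ := hK.exists_bound_of_continuousOn hc.continuousOn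
  refine ⟨C, ?_⟩
  filter_upwards [tendsto_fixedPoint.eventually (Metric.closedBall_mem_nhds (startPoint n) one_pos),
    tendsto_halfPeriod.eventually_le_const Real.pi_lt_four,
    mem_nhdsWithin_of_mem_nhds (Icc_mem_nhds (show (-1 : ℝ) < 0 by norm_num) one_pos)]
    with ε h1 h2 h3
  rintro p ⟨t, ht, rfl | rfl⟩
  · exact hC (ε, fixedPoint n ε, t) ⟨h3, h1, ht.1, ht.2.trans h2⟩
  · rw [norm_neg]
    exact hC (ε, fixedPoint n ε, t) ⟨h3, h1, ht.1, ht.2.trans h2⟩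

lemma isPeriodicSolution_rot [NeZero n] (A : SqMatrix n) (b : Phase n) {ξ : Phase n} (hξ : ξ ≠ 0) :
    IsPeriodicSolution A b 0 (2 * Real.pi) fun t => rot n t ξ where
  isSolution := by
    have hlip : ∀ s t, s ≤ t → ‖rot n t ξ - rot n s ξ‖ ≤ ‖lin (A₀ n)‖ * (2 * ‖ξ‖) * (t - s) :=
      fun s t hst => norm_image_sub_le_of_norm_deriv_right_le_segment (by fun_prop)
        (fun r _ => (hasDerivAt_rot_apply ξ r).hasDerivWithinAt)
        (fun r _ => ((lin (A₀ n)).le_opNorm _).trans (by gcongr; exact norm_rot_le r ξ)) t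
        ⟨hst, le_rfl⟩
    -- For ε = 0 the selection is multiplied by zero, so any admissible one serves; the sign of x₁
    -- is one.
    refine ⟨fun s t => ?_, ae_of_all _ fun t => ⟨SignType.sign (rot n t ξ (0, 0)), ⟨?_, ?_, ?_⟩, ?_⟩⟩
    · refine LipschitzOnWith.absolutelyContinuousOnInterval
        (K := ⟨‖lin (A₀ n)‖ * (2 * ‖ξ‖), by positivity⟩) ?_
      refine (LipschitzWith.of_dist_le_mul fun s t => ?_).lipschitzOnWith
      rw [dist_eq_norm, Real.dist_eq]
      change _ ≤ ‖lin (A₀ n)‖ * (2 * ‖ξ‖) * _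
      rcases le_total s t with h | h
      · rw [norm_sub_rev, abs_sub_comm, abs_of_nonneg (sub_nonneg.2 h)]
        exact hlip s t h
      · rw [abs_of_nonneg (sub_nonneg.2 h)]
        exact hlip t s h
    · intro h; rw [sign_neg h]; simp
    · intro h; rw [sign_pos h]; simp
    · intro h; rw [h, sign_zero]; simp
    · simpa using hasDerivAt_rot_apply ξ t
  period_pos := by positivity
  periodic t := by
    change rot n (t + 2 * Real.pi) ξ = rot n t ξ
    rw [two_mul, ← add_assoc, rot_add_pi, rot_add_pi, neg_neg]
  nonconstant := by
    refine ⟨0, 0 + Real.pi, fun h => hξ ?_⟩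
    rw [rot_add_pi, self_eq_neg] at h
    simpa using h

theorem bifurcatesFrom_cycle [NeZero n] :
    BifurcatesFrom (dampingMatrix n) (forcingVector n) (𝓝[≠] (0 : ℝ)) (baseBall n) (2 * Real.pi)
      (cycle n) := by
  have hex : ∀ ε : ℝ, ∃ g : ℝ → Phase n, |ε| < 1 → ε ≠ 0 →
      IsPeriodicSolution (dampingMatrix n) (forcingVector n) ε (2 * halfPeriod ε) g ∧
      range g = cycle n ε ∧ IsLimitCycle (dampingMatrix n) (forcingVector n) ε (cycle n ε) ∧
      g 0 = fixedPoint n ε ∧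
      ∀ t, ∃ u ∈ Icc (-1 : ℝ) 1, HasDerivWithinAt g
        (field (dampingMatrix n) ε (g t) + ε • u • forcingVector n) (Ici t) t := fun ε => by
    by_cases h : |ε| < 1 ∧ ε ≠ 0
    · obtain ⟨g, hg⟩ := exists_cycle_solution (n := n) h.1 h.2
      exact ⟨g, fun _ _ => hg⟩
    -- Outside 0 < |ε| < 1 the family is filled up with an arbitrary function.
    · exact ⟨0, fun h1 h2 => absurd ⟨h1, h2⟩ h⟩
  choose g hg using hex
  have hsmall : ∀ᶠ ε in 𝓝[≠] (0 : ℝ), |ε| < 1 ∧ ε ≠ 0 := by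
    refine Filter.eventually_and.2 ⟨?_, self_mem_nhdsWithin⟩
    exact nhdsWithin_le_nhds (continuous_abs.continuousAt.eventually_lt continuousAt_const (by simp))
  have hrot : polarMap 0 (basePoint n) = rot n (Real.pi / 2) (startPoint n) := by
    rw [startPoint, ← polarMap_add]; simp
  have hne : startPoint n ≠ 0 := fun h => by
    rw [h, map_zero] at hrot
    have := congrFun hrot (0, 0)
    simp [polarMap, basePoint, angle] at this
  refine ⟨fun t => rot n t (startPoint n), g, fun ε => 2 * halfPeriod ε,
    isPeriodicSolution_rot _ _ hne,
    ⟨basePoint n, Metric.mem_ball_self (by norm_num), Real.pi / 2, hrot.symm⟩, ?_, ?_,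
    tendsto_halfPeriod.const_mul 2⟩
  · filter_upwards [hsmall] with ε hε
    obtain ⟨h1, h2, h3, -⟩ := hg ε hε.1 hε.2
    exact ⟨h3, h1, h2⟩
  -- The distance to the limit is split into the rotated difference of the starting points and the
  -- drift from the linear flow, which is O(ε|t|) on a bounded cycle.
  · obtain ⟨C, hC⟩ := exists_bound_cycle (n := n)
    set M := ‖lin (dampingMatrix n)‖ * C + ‖forcingVector n‖ with hM
    have hdist : ∀ᶠ ε in 𝓝[≠] (0 : ℝ), ∀ t, dist (rot n t (startPoint n)) (g ε t) ≤
        2 * ‖fixedPoint n ε - startPoint n‖ + 4 * (|ε| * M) * |t| := by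
      filter_upwards [hsmall, hC] with ε hε hCε t
      obtain ⟨h1, h2, -, h3, h4⟩ := hg ε hε.1 hε.2
      have h5 := norm_sub_rot_le h1.isSolution.continuous
        (fun t => hCε _ (h2 ▸ mem_range_self t)) h4 t
      have h6 := norm_rot_le t (fixedPoint n ε - startPoint n)
      rw [h3] at h5
      rw [dist_comm, dist_eq_norm, add_comm]
      have h7 : g ε t - rot n t (startPoint n) =
          (g ε t - rot n t (fixedPoint n ε)) + rot n t (fixedPoint n ε - startPoint n) := by
        rw [map_sub]; abel
      rw [h7]
      exact norm_add_le_of_le h5 h6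
    refine Metric.tendstoLocallyUniformly_iff.2 fun δ hδ s =>
      ⟨Metric.ball s 1, Metric.ball_mem_nhds s one_pos, ?_⟩
    have hlim : Tendsto (fun ε => 2 * ‖fixedPoint n ε - startPoint n‖ + 4 * (|ε| * |M|) * (|s| + 1))
        (𝓝[≠] (0 : ℝ)) (𝓝 0) := by
      have h1 : Tendsto (fun ε : ℝ => |ε|) (𝓝[≠] (0 : ℝ)) (𝓝 0) := by
        simpa using (continuous_abs.tendsto (0 : ℝ)).mono_left (nhdsWithin_le_nhds (s := {0}ᶜ))
      simpa using (((tendsto_fixedPoint (n := n)).sub_const (startPoint n)).norm.const_mul 2).add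
        (((h1.mul_const |M|).const_mul 4).mul_const (|s| + 1))
    filter_upwards [hdist, hlim.eventually (gt_mem_nhds hδ)] with ε h1 h2 t ht
    have h3 : |t| ≤ |s| + 1 := by
      rw [Metric.mem_ball, Real.dist_eq] at ht
      linarith [abs_sub_abs_le_abs_sub t s]
    refine ((h1 t).trans ?_).trans_lt h2
    gcongr
    exact le_abs_self M

lemma forcingVector_ne_zero [NeZero n] : forcingVector n ≠ 0 := fun h => by
  have := congrFun h (0, 0)
  rw [forcingVector_zero, height_zero, freq_zero] at this
  simp at this

end

end ControlCenter

theorem theorem2 (n : ℕ) [NeZero n] :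
    (∀ (A : SqMatrix n) (b : Phase n), b ≠ 0 →
      ∀ C : Set (Polar n), AveragingConditions A b C →
      ∀ l : Filter ℝ, l ≤ 𝓝[≠] (0 : ℝ) →
      ∀ (T₁ T₂ : ℝ) (Γ₁ Γ₂ : ℝ → Set (Phase n)),
        BifurcatesFrom A b l C T₁ Γ₁ → BifurcatesFrom A b l C T₂ Γ₂ →
        ∀ᶠ ε in l, Γ₁ ε = Γ₂ ε) ∧
    (∃ (A : SqMatrix n) (b : Phase n), b ≠ 0 ∧
      ∃ C : Set (Polar n), AveragingConditions A b C ∧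
      ∃ Γ : ℝ → Set (Phase n), BifurcatesFrom A b (𝓝[≠] (0 : ℝ)) C (2 * Real.pi) Γ) := by
  refine ⟨fun A b _ C hC l hl T₁ T₂ Γ₁ Γ₂ h₁ h₂ => eventually_eq_of_bifurcatesFrom hC hl h₁ h₂,
    dampingMatrix n, forcingVector n, forcingVector_ne_zero, baseBall n, averagingConditions_damping,
    cycle n, bifurcatesFrom_cycle⟩
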